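/- **Equality of the four-dimensional ambitwistor-string formula for gravity with the Cachazo–Skinner formula.** *Conventions.* Let $d,\tilde d\ge 0$ and $n=d+\tilde d+2\ge 3$, $k=d+1$. External particles are labelled $i,j\in\{1,\dots,k\}$ and $p,q\in\{k+1,\dots,n\}$ (and $a,b$ for both kinds), with arbitrary spinors $\lambda_a,\tilde\lambda_a\in\mathbb C^2$ and anticommuting $\eta_a^A$. Write $\langle a\,b\rangle$, $[a\,b]$, $(a\,b)$ for $u_0v_1-u_1v_0$ evaluated on the $\lambda$'s, the $\tilde\lambda$'s and the worldsheet spinors $\sigma$, and $\delta^{0|N}(\eta)=\eta^1\cdots\eta^N$. *Meaning of the integrals.* Each integral $\int \frac{dx}{\mathrm{Vol}\,\mathrm{GL}(2,\mathbb C)}\,\mathcal I(x)\prod\bar\delta(f(x))$ below has as many holomorphic delta functions as variables, has the gauge group $\mathrm{SL}(2)\times\mathrm{GL}(1)$ (where $\mathrm{GL}(1)$ scales $Z\mapsto e^{\gamma}Z$), and satisfies a relation $P:=\sum_a\lambda_a\tilde\lambda_a=L(x)f(x)$. It equals $\bar\delta^4(P)$ times the sum, over the nondegenerate solutions of $f=0$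 modulo the gauge group, of $$\mathcal I\;\frac{\det(A\,G)\,\det(L\,B)}{\det\begin{pmatrix}\partial f&B\\A&0\end{pmatrix}}.$$ Here the columns of $G$ are the gauge vector fields; $A$ is the differential of any four gauge conditions with $\det(AG)\neq0$ (Faddeev–Popov); $B$ is any set of four directions in the space of constraints with $\det(LB)\ne0$ (removal of four delta functions in favour of $\bar\delta^4(P)$). A solution is nondegenerate if $\ker\partial f$ is contained in the gauge directions and $\ker L$ is contained in the image of $\partial f$. The coefficient of $\bar\delta^4(P)$ is the amplitude; it takes values in the Grassmann algebra generated by the $\eta_a^A$. The integral over the map moduli $\mu_r$ is normalised so that $\int d^2\mu\,e^{i[\mu\,\xi]}=\bar\delta^2(\xi)$. *Ambitwistor-string formula with $N$ supersymmetries.* For $\sigma_a\in\mathbb C^2$ with $(a\,b)\neq0$ for $a\ne b$, $$\mathcal M^{(N)}=\int\frac{\prod_a d^2\sigma_a}{\mathrm{Vol}\,\mathrm{GL}(2,\mathbb C)}\;{\det}'(\mathcal H)\prod_{i}\bar\delta^2\big(\tilde\lambda_i-\tilde\lambda(\sigma_i)\big)\prod_{p}\bar\delta^{2|N}\big(\lambda_p-\lambda(\sigma_p)\,\big|\,\eta_p-\chi(\sigma_p)\big),$$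 $$\lambda(\sigma)=\sum_i\frac{\lambda_i}{(\sigma\,\sigma_i)},\qquad \chi(\sigma)=\sum_i\frac{\eta_i}{(\sigma\,\sigma_i)},\qquad \tilde\lambda(\sigma)=\sum_p\frac{\tilde\lambda_p}{(\sigma\,\sigma_p)}.$$ Here $\mathcal H=\mathrm{diag}(\mathbb H,\tilde{\mathbb H})$, with $\mathbb H_{ij}=\frac{\langle i\,j\rangle}{(i\,j)}$, $\mathbb H_{ii}=-\sum_{j\ne i}\mathbb H_{ij}$, $\tilde{\mathbb H}_{pq}=\frac{[p\,q]}{(p\,q)}$, $\tilde{\mathbb H}_{pp}=-\sum_{q\neq p}\tilde{\mathbb H}_{pq}$. The reduced determinant $\det'(\mathcal H)$ is the determinant after removing the row and column of one particle $i_0$ from $\mathbb H$ and of one particle $p_0$ from $\tilde{\mathbb H}$. *Cachazo–Skinner formula ($N=8$).* Let $Z(\sigma)=(\lambda,\mu,\chi)(\sigma)=\sum_{r=0}^d(\rho_r,\mu_r,\chi_r)\,C_r(\sigma)$ with $C_r(\sigma)=(\sigma^0)^r(\sigma^1)^{d-r}$. With pairwise distinct marked points $\sigma_a=(1,z_a)$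 and $t_a\ne0$, $$\mathcal M_{CS}=\int\frac{\prod_{r=0}^d d^{4|8}Z_r}{\mathrm{Vol}\,\mathrm{GL}(2,\mathbb C)}\prod_a(\sigma_a\,d\sigma_a)\;|\Phi|'\,|\tilde\Phi|'\prod_a\int\frac{dt_a}{t_a^3}\,\bar\delta^{2|8}\big(\lambda_a-t_a\lambda(\sigma_a)\,\big|\,\eta_a-t_a\chi(\sigma_a)\big)\,e^{it_a[\mu(\sigma_a)\,\tilde\lambda_a]} .$$ For $a\neq b$ the matrices are $\tilde\Phi_{ab}=\frac{[a\,b]}{(a\,b)}t_at_b$ and $\Phi_{ab}=\frac{\langle a\,b\rangle}{(a\,b)}\frac1{t_at_b}$, with diagonal entries $$\tilde\Phi_{aa}=-\sum_{b\ne a}\tilde\Phi_{ab}\prod_{r=0}^d\frac{(b\,w_r)}{(a\,w_r)},\qquad \Phi_{aa}=-\sum_{b\ne a}\Phi_{ab}\prod_{r=0}^{\tilde d}\frac{(b\,u_r)}{(a\,u_r)}\;\frac{\prod_{c\ne a}(a\,c)}{\prod_{c\neq b}(b\,c)} .$$ The reference spinors $w_r,u_r$ are arbitrary (they may depend on the integration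 variables), provided that no denominator $(a\,w_r)$, $(a\,u_r)$ vanishes in a diagonal entry that occurs in the minors used. $|\tilde\Phi|'$ is any signed minor (sign of the removal of the chosen rows and columns) of $\tilde\Phi$ with $d+2$ rows and $d+2$ columns removed, divided by the Vandermonde determinants $\prod_{a<b}(a\,b)$ of the removed rows and of the removed columns. $|\Phi|'$ is any $d\times d$ minor of $\Phi$, divided by the Vandermonde determinants of the remaining rows and of the remaining columns. *Theorem.* For all kinematic data, all gauge fixings on the two sides, all choices of rows, columns and reference spinors as above, and all $i_0,p_0$: 1. $\mathcal M_{CS}=(-1)^{k}\,\mathcal M^{(8)}$ in the Grassmann algebra generated by the $\eta_a^A$. The overall sign is the orientation sign that arises because the holomorphic measure $\prod_a dz_a\,dt_a$ is compared with $\prod_a d^2\sigma_a$. 2. $\mathcal M_{CS}=(-1)^k\mathcal M^{(7)}$ after one of the eight components of $\eta$ is integrated out for the particles $p$ and set to zero for the particles $i$. 3. The equality in 1 holds term by term: there is a bijection between the gauge orbits of nondegenerate solutions on the two sides that matches their contributions (up to the overall factor $(-1)^k$). -/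

import Mathlib

open scoped Matrix

noncomputable section

/-! ### Integrals localised by holomorphic delta functions

An integral `∫ (∏ dx) / Vol GL(2,ℂ)  I(x)  ∏ δ̄(f(x))` has as many delta functions as integration
variables.  Four integrations are removed by the Faddeev-Popov procedure, and four delta functions
become the momentum conserving `δ̄⁴(P)`.  The coefficient of `δ̄⁴(P)` is the sum of the integrand
over the solutions of `f = 0` modulo the group, each divided by the Jacobian. -/

/-- The data of such an integral: integration variables and delta functions are both labelled by
`ν`; the group has Lie algebra `sl(2) ⊕ gl(1)`, with a basis labelled by `Fin 4`. -/
structure DeltaSystem (ν : Type) [Fintype ν] [DecidableEq ν] where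
  /-- the domain of integration -/
  dom : Set (ν → ℂ)
  /-- the arguments of the delta functions -/
  constraint : (ν → ℂ) → ν → ℂ
  /-- the columns are the vector fields generating the gauge group -/
  gauge : (ν → ℂ) → Matrix ν (Fin 4) ℂ
  /-- `orbit x y`: some element of the gauge group maps `x` to `y` -/
  orbit : (ν → ℂ) → (ν → ℂ) → Prop
  /-- the four components of the total momentum of the external particles -/
  total : Fin 4 → ℂ
  /-- the coefficients that express the total momentum through the constraints -/
  mom : (ν → ℂ) → Matrix (Fin 4) ν ℂ
  mom_spec : ∀ x ∈ dom, mom x *ᵥ constraint x = total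

namespace DeltaSystem

variable {ν : Type} [Fintype ν] [DecidableEq ν]

/-- The Jacobian matrix `∂ f_c / ∂ x_v`. -/
def jacobian (S : DeltaSystem ν) (x : ν → ℂ) : Matrix ν ν ℂ :=
  Matrix.of fun c v => fderiv ℂ (fun y => S.constraint y c) x (Pi.single v 1)

/-- The nondegenerate solutions of the constraints: the only zero modes of the Jacobian matrix are
the gauge directions, and the only relations between the linearised constraints are the four that
come from momentum conservation. -/
def solutions (S : DeltaSystem ν) : Set (ν → ℂ) :=
  {x | x ∈ S.dom ∧ S.constraint x = 0 ∧
    (∀ v, S.jacobian x *ᵥ v = 0 → ∃ X, v = S.gauge x *ᵥ X) ∧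
    (∀ y, S.mom x *ᵥ y = 0 → ∃ v, y = S.jacobian x *ᵥ v)}

/-- A choice of gauge, and of the four delta functions that are traded for `δ̄⁴(P)`. -/
structure GaugeFixing (S : DeltaSystem ν) where
  /-- one representative of every gauge orbit of solutions -/
  slice : Set (ν → ℂ)
  slice_subset : slice ⊆ S.solutions
  slice_unique : ∀ x ∈ S.solutions, ∃! y, y ∈ slice ∧ S.orbit x y
  /-- the differentials of four gauge conditions, which are transverse to the orbit -/
  cond : (ν → ℂ) → Matrix (Fin 4) ν ℂ
  cond_ne_zero : ∀ x ∈ slice, (cond x * S.gauge x).det ≠ 0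
  /-- four directions in the space of constraints along which the total momentum varies; taking
  coordinate directions amounts to removing four of the delta functions -/
  trade : (ν → ℂ) → Matrix ν (Fin 4) ℂ
  trade_ne_zero : ∀ x ∈ slice, (S.mom x * trade x).det ≠ 0

variable {S : DeltaSystem ν}

/-- The Faddeev-Popov determinant, times the determinant that converts four of the delta functions
into `δ̄⁴(P)`, divided by the Jacobian of the remaining gauge-fixed system. -/
def GaugeFixing.weight (g : S.GaugeFixing) (x : ν → ℂ) : ℂ :=
  (g.cond x * S.gauge x).det * (S.mom x * g.trade x).det /
    (Matrix.fromBlocks (S.jacobian x) (g.trade x) (g.cond x) 0).det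

/-- The coefficient of `δ̄⁴(P)` in `∫ (∏ dx) / Vol GL(2,ℂ)  I(x)  ∏ δ̄(f(x))`. -/
def GaugeFixing.localisedIntegral (g : S.GaugeFixing) {V : Type} [AddCommGroup V] [Module ℂ V]
    (I : (ν → ℂ) → V) : V :=
  ∑ᶠ x ∈ g.slice, g.weight x • I x

end DeltaSystem

/-! ### Spinors, particles and Grassmann variables -/

/-- The `SL(2)` invariant product `⟨a b⟩`, `[a b]` or `(a b)` of two spinors. -/
def br (a b : Fin 2 → ℂ) : ℂ := a 0 * b 1 - a 1 * b 0

/-- The `n = d + d' + 2` external particles: first the `k = d + 1` particles `i`, then the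
`n - k = d' + 1` particles `p`. -/
abbrev Particle (d d' : ℕ) : Type := Fin (d + 1) ⊕ Fin (d' + 1)

/-- The spinors of the external particles, with momenta `λ_a λ̃_a`. -/
structure Kinematics (d d' : ℕ) where
  lam : Particle d d' → Fin 2 → ℂ
  lamt : Particle d d' → Fin 2 → ℂ

/-- The four components of `∑ λ_a λ̃_a`. -/
def Kinematics.totalMomentum {d d' : ℕ} (K : Kinematics d d') (q : Fin 4) : ℂ :=
  ∑ a, K.lam a (finProdFinEquiv (m := 2) (n := 2) |>.symm q).1 *
    K.lamt a (finProdFinEquiv (m := 2) (n := 2) |>.symm q).2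

/-- The Grassmann algebra with anticommuting generators labelled by `ι`. -/
abbrev Grassmann (ι : Type) : Type := ExteriorAlgebra ℂ (ι → ℂ)

/-- The generator with label `i`. -/
def Grassmann.gen {ι : Type} [DecidableEq ι] (i : ι) : Grassmann ι :=
  ExteriorAlgebra.ι ℂ (Pi.single i 1 : ι → ℂ)

/-- Berezin integration over the generator with label `i`, that is, the left derivative. -/
def Grassmann.berezin {ι : Type} (i : ι) : Grassmann ι →ₗ[ℂ] Grassmann ι :=
  CliffordAlgebra.contractLeft (Q := (0 : QuadraticForm ℂ (ι → ℂ))) (LinearMap.proj i)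

/-- Iterated Berezin integration; the last variable in the list is integrated first. -/
def Grassmann.berezinList {ι : Type} (l : List ι) (x : Grassmann ι) : Grassmann ι :=
  l.foldr (fun i y => Grassmann.berezin i y) x

/-- The algebra homomorphism that renames the generator `f j` to `j`, and sets the generators
outside the range of `f` to zero (for injective `f`). -/
def Grassmann.restrict {ι κ : Type} (f : κ → ι) : Grassmann ι →ₐ[ℂ] Grassmann κ :=
  ExteriorAlgebra.map (LinearMap.funLeft ℂ ℂ f)

/-- The fermionic delta function `δ^{0|N}(v) = v_1 ⋯ v_N`. -/
def fermionicDelta {ι : Type} {N : ℕ} (v : Fin N → Grassmann ι) : Grassmann ι :=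
  (List.ofFn v).prod

/-! ### The ambitwistor string formula -/

/-- The integration variables are the components of the homogeneous coordinates `σ_a ∈ ℂ²`. -/
abbrev AmbVar (d d' : ℕ) : Type := Particle d d' × Fin 2

namespace Amb

variable {d d' : ℕ}

/-- The homogeneous coordinates `σ_a`. -/
def pt (x : AmbVar d d' → ℂ) (a : Particle d d') : Fin 2 → ℂ := fun α => x (a, α)

/-- `λ(σ) = ∑_i λ_i / (σ σ_i)`. -/
def lamMap (K : Kinematics d d') (x : AmbVar d d' → ℂ) (s : Fin 2 → ℂ) : Fin 2 → ℂ :=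
  fun α => ∑ i : Fin (d + 1), K.lam (.inl i) α / br s (pt x (.inl i))

/-- `λ̃(σ) = ∑_p λ̃_p / (σ σ_p)`. -/
def lamtMap (K : Kinematics d d') (x : AmbVar d d' → ℂ) (s : Fin 2 → ℂ) : Fin 2 → ℂ :=
  fun α => ∑ p : Fin (d' + 1), K.lamt (.inr p) α / br s (pt x (.inr p))

/-- The refined scattering equations `λ̃_i = λ̃(σ_i)` and `λ_p = λ(σ_p)`. -/
def constraint (K : Kinematics d d') (x : AmbVar d d' → ℂ) : AmbVar d d' → ℂ
  | (.inl i, α) => K.lamt (.inl i) α - lamtMap K x (pt x (.inl i)) α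
  | (.inr p, α) => K.lam (.inr p) α - lamMap K x (pt x (.inr p)) α

/-- The vector fields `σ_a ↦ X σ_a` for the standard basis `E, F, H` of `sl(2)`, and the one that
scales `Z ↦ e^γ Z`, `W ↦ e^{-γ} W`, which acts by `σ_i ↦ e^{-γ} σ_i`, `σ_p ↦ e^γ σ_p`. -/
def gauge (x : AmbVar d d' → ℂ) : Matrix (AmbVar d d') (Fin 4) ℂ :=
  Matrix.of fun v => ![
    (!![0, 1; 0, 0] *ᵥ pt x v.1) v.2,
    (!![0, 0; 1, 0] *ᵥ pt x v.1) v.2,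
    (!![1, 0; 0, -1] *ᵥ pt x v.1) v.2,
    Sum.elim (fun _ => -x v) (fun _ => x v) v.1]

/-- The action of `SL(2,ℂ) × GL(1,ℂ)`. -/
def orbit (x y : AmbVar d d' → ℂ) : Prop :=
  ∃ (g : Matrix.SpecialLinearGroup (Fin 2) ℂ) (c : ℂ), c ≠ 0 ∧
    (∀ i, pt y (.inl i) = c⁻¹ • (g.1 *ᵥ pt x (.inl i))) ∧
    (∀ p, pt y (.inr p) = c • (g.1 *ᵥ pt x (.inr p)))

/-- `P = ∑_i λ_i (λ̃_i - λ̃(σ_i)) + ∑_p (λ_p - λ(σ_p)) λ̃_p`. -/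
def mom (K : Kinematics d d') (q : Fin 4) : AmbVar d d' → ℂ
  | (.inl i, β) => if β = (finProdFinEquiv (m := 2) (n := 2) |>.symm q).2 then
      K.lam (.inl i) (finProdFinEquiv (m := 2) (n := 2) |>.symm q).1 else 0
  | (.inr p, β) => if β = (finProdFinEquiv (m := 2) (n := 2) |>.symm q).1 then
      K.lamt (.inr p) (finProdFinEquiv (m := 2) (n := 2) |>.symm q).2 else 0

/-- The matrix `ℍ`. -/
def H (K : Kinematics d d') (x : AmbVar d d' → ℂ) : Matrix (Fin (d + 1)) (Fin (d + 1)) ℂ :=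
  let off i j := br (K.lam (.inl i)) (K.lam (.inl j)) / br (pt x (.inl i)) (pt x (.inl j))
  Matrix.of fun i j => if i = j then -∑ l ∈ Finset.univ.erase i, off i l else off i j

/-- The matrix `ℍ̃`. -/
def Ht (K : Kinematics d d') (x : AmbVar d d' → ℂ) : Matrix (Fin (d' + 1)) (Fin (d' + 1)) ℂ :=
  let off p q := br (K.lamt (.inr p)) (K.lamt (.inr q)) / br (pt x (.inr p)) (pt x (.inr q))
  Matrix.of fun p q => if p = q then -∑ l ∈ Finset.univ.erase p, off p l else off p q

/-- `det' 𝓗`: one row and column, those of the particles `i₀` and `p₀`, is removed from each of the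
two blocks of `𝓗 = diag (ℍ, ℍ̃)`. -/
def detH (K : Kinematics d d') (i₀ : Fin (d + 1)) (p₀ : Fin (d' + 1)) (x : AmbVar d d' → ℂ) : ℂ :=
  ((Matrix.fromBlocks (H K x) 0 0 (Ht K x)).submatrix
    (Subtype.val : {a : Particle d d' // a ≠ .inl i₀ ∧ a ≠ .inr p₀} → Particle d d')
    Subtype.val).det

/-- The fermionic part `∏_p δ^{0|N}(η_p - χ(σ_p))` with `χ(σ) = ∑_i η_i / (σ σ_i)`. -/
def fermions (N : ℕ) (x : AmbVar d d' → ℂ) : Grassmann (Particle d d' × Fin N) :=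
  (List.ofFn fun p : Fin (d' + 1) => fermionicDelta fun A : Fin N =>
    Grassmann.gen (Sum.inr p, A) - ∑ i : Fin (d + 1),
      (br (pt x (.inr p)) (pt x (.inl i)))⁻¹ • Grassmann.gen (Sum.inl i, A)).prod

lemma mom_spec (K : Kinematics d d') (x : AmbVar d d' → ℂ) :
    Matrix.of (mom K) *ᵥ constraint K x = K.totalMomentum := by
  funext q
  have anti : ∀ s t : Fin 2 → ℂ, br s t = -br t s := fun s t => by simp only [br]; ring
  simp only [Matrix.mulVec, dotProduct, Matrix.of_apply, Fintype.sum_prod_type,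
    Fintype.sum_sum_type, mom, constraint, ite_mul, zero_mul, Finset.sum_ite_eq',
    Finset.mem_univ, if_true, Kinematics.totalMomentum]
  simp only [lamMap, lamtMap, mul_sub, Finset.sum_sub_distrib, Finset.mul_sum]
  rw [Finset.sum_comm (s := (Finset.univ : Finset (Fin (d' + 1))))]
  have key : ∀ (i : Fin (d + 1)) (p : Fin (d' + 1)) (a b : ℂ),
      a * (b / br (pt x (.inl i)) (pt x (.inr p))) =
        -(b * (a / br (pt x (.inr p)) (pt x (.inl i)))) := by
    intro i p a b
    rw [anti, div_neg]; ring
  simp only [key, Finset.sum_neg_distrib]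
  rw [sub_neg_eq_add, add_add_sub_cancel]
  exact congrArg₂ (· + ·) rfl (Finset.sum_congr rfl fun p _ => mul_comm _ _)

/-- The measure `∏ d²σ_a / Vol GL(2,ℂ)` and the bosonic delta functions of the ambitwistor formula,
for marked points that are pairwise distinct on the sphere. -/
def system (K : Kinematics d d') : DeltaSystem (AmbVar d d') where
  dom := {x | ∀ a b, a ≠ b → br (pt x a) (pt x b) ≠ 0}
  constraint := constraint K
  gauge := gauge
  orbit := orbit
  total := K.totalMomentum
  mom := fun _ => Matrix.of (mom K)
  mom_spec := fun x _ => mom_spec K x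

/-- The integrand that multiplies the bosonic measure and delta functions. -/
def integrand (K : Kinematics d d') (N : ℕ) (i₀ : Fin (d + 1)) (p₀ : Fin (d' + 1))
    (x : AmbVar d d' → ℂ) : Grassmann (Particle d d' × Fin N) :=
  detH K i₀ p₀ x • fermions N x

/-- The ambitwistor string formula for gravity with `N` supersymmetries. -/
def amplitude (K : Kinematics d d') (N : ℕ) (g : (system K).GaugeFixing)
    (i₀ : Fin (d + 1)) (p₀ : Fin (d' + 1)) : Grassmann (Particle d d' × Fin N) :=
  g.localisedIntegral (integrand K N i₀ p₀)

end Amb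

/-! ### The Cachazo-Skinner formula -/

/-- The bosonic integration variables: the map moduli `ρ_r ∈ ℂ²`, the marked points `z_a`, and the
scaling parameters `t_a` of the momentum eigenstates.  The delta functions have the same labels:
`(r, α)` for those that arise from the integral over `μ_r`, and `(a, α)` for
`λ_a - t_a λ(σ_a)`. -/
abbrev CSVar (d d' : ℕ) : Type := (Fin (d + 1) × Fin 2) ⊕ (Particle d d' × Fin 2)

namespace CS

variable {d d' : ℕ}

/-- The map moduli `ρ_r`. -/
def rho (x : CSVar d d' → ℂ) (r : Fin (d + 1)) : Fin 2 → ℂ := fun α => x (.inl (r, α))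

/-- The inhomogeneous coordinate `z_a`. -/
def z (x : CSVar d d' → ℂ) (a : Particle d d') : ℂ := x (.inr (a, 0))

/-- The scaling parameter `t_a`. -/
def t (x : CSVar d d' → ℂ) (a : Particle d d') : ℂ := x (.inr (a, 1))

/-- The marked point `σ_a = (1, z_a)`, so that `(σ_a dσ_a) = dz_a`. -/
def pt (x : CSVar d d' → ℂ) (a : Particle d d') : Fin 2 → ℂ := ![1, z x a]

/-- The basis `C_r(σ)` of the polynomials of degree `d`. -/
def C (r : Fin (d + 1)) (s : Fin 2 → ℂ) : ℂ := s 0 ^ (r : ℕ) * s 1 ^ (d - r : ℕ)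

/-- The component `λ(σ) = ∑_r ρ_r C_r(σ)` of the map. -/
def lamMap (x : CSVar d d' → ℂ) (s : Fin 2 → ℂ) : Fin 2 → ℂ :=
  fun α => ∑ r, rho x r α * C r s

/-- The phase `∑_a t_a [μ(σ_a) λ̃_a]` of the product of the momentum eigenstates, where
`μ(σ) = ∑_r μ_r C_r(σ)`. -/
def phase (K : Kinematics d d') (x : CSVar d d' → ℂ) (μ : Fin (d + 1) → Fin 2 → ℂ) : ℂ :=
  ∑ a, t x a * ∑ α, (∑ r, μ r α * C r (pt x a)) * K.lamt a α

/-- The arguments of the delta functions.  As the phase is linear in `μ`, the integral of its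
exponential over `μ_r` is the delta function of the coefficient of `μ_r`. -/
def constraint (K : Kinematics d d') (x : CSVar d d' → ℂ) : CSVar d d' → ℂ
  | .inl (r, α) => phase K x (Pi.single r (Pi.single α 1))
  | .inr (a, α) => K.lam a α - t x a * lamMap x (pt x a) α

/-- The coefficient `ρ_j`, extended by zero. -/
def coeff (x : CSVar d d' → ℂ) (j : ℕ) (α : Fin 2) : ℂ :=
  if h : j < d + 1 then rho x ⟨j, h⟩ α else 0

/-- The vector field of the element `X` of `sl(2)`: the points move by `σ ↦ X σ`, the map by
`λ(σ) ↦ λ(e^{-X} σ)`, and `t_a` so that `t_a λ(σ_a)` is unchanged. -/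
def sl2Field (x : CSVar d d' → ℂ) (X : Matrix (Fin 2) (Fin 2) ℂ) : CSVar d d' → ℂ
  | .inl (r, α) =>
      -(((r : ℂ) * X 0 0 + ((d : ℂ) - r) * X 1 1) * rho x r α
        + ((r : ℂ) + 1) * X 0 1 * coeff x (r + 1) α
        + (if (r : ℕ) = 0 then 0 else ((d : ℂ) - r + 1) * X 1 0 * coeff x (r - 1) α))
  | .inr (a, α) =>
      ![X 1 0 + (X 1 1 - X 0 0) * z x a - X 0 1 * z x a ^ 2,
        (d : ℂ) * (X 0 0 + X 0 1 * z x a) * t x a] α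

/-- The vector field of the scaling `Z ↦ e^γ Z`, `t_a ↦ e^{-γ} t_a`. -/
def scaleField (x : CSVar d d' → ℂ) : CSVar d d' → ℂ
  | .inl (r, α) => rho x r α
  | .inr (a, α) => ![0, -t x a] α

/-- The generators `E, F, H` of `sl(2)` and the scaling of `Z`. -/
def gauge (x : CSVar d d' → ℂ) : Matrix (CSVar d d') (Fin 4) ℂ :=
  Matrix.of fun v => ![sl2Field x !![0, 1; 0, 0] v, sl2Field x !![0, 0; 1, 0] v,
    sl2Field x !![1, 0; 0, -1] v, scaleField x v]

/-- The action of `SL(2,ℂ) × GL(1,ℂ)`; the compensating factor `(g σ_a)_0` appears because the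
points are written as `σ_a = (1, z_a)`. -/
def orbit (x y : CSVar d d' → ℂ) : Prop :=
  ∃ (g : Matrix.SpecialLinearGroup (Fin 2) ℂ) (c : ℂ), c ≠ 0 ∧
    (∀ s : Fin 2 → ℂ, lamMap y (g.1 *ᵥ s) = c • lamMap x s) ∧
    (∀ a, g.1 *ᵥ pt x a = ((g.1 *ᵥ pt x a) 0) • pt y a) ∧
    (∀ a, t y a = c⁻¹ * ((g.1 *ᵥ pt x a) 0) ^ d * t x a)

/-- `P = ∑_a (λ_a - t_a λ(σ_a)) λ̃_a + ∑_r ρ_r (∑_a t_a λ̃_a C_r(σ_a))`. -/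
def mom (K : Kinematics d d') (x : CSVar d d' → ℂ) (q : Fin 4) : CSVar d d' → ℂ
  | .inl (r, β) => if β = (finProdFinEquiv (m := 2) (n := 2) |>.symm q).2 then
      rho x r (finProdFinEquiv (m := 2) (n := 2) |>.symm q).1 else 0
  | .inr (a, β) => if β = (finProdFinEquiv (m := 2) (n := 2) |>.symm q).1 then
      K.lamt a (finProdFinEquiv (m := 2) (n := 2) |>.symm q).2 else 0

lemma mom_spec (K : Kinematics d d') (x : CSVar d d' → ℂ) :
    Matrix.of (mom K x) *ᵥ constraint K x = K.totalMomentum := by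
  funext q
  have hphase : ∀ r α, phase K x (Pi.single r (Pi.single α 1)) =
      ∑ a, t x a * (C r (pt x a) * K.lamt a α) := by
    intro r α
    unfold phase
    refine Finset.sum_congr rfl fun a _ => ?_
    congr 1
    rw [Finset.sum_eq_single α, Finset.sum_eq_single r]
    · simp
    · intro b _ hb; simp [Pi.single_eq_of_ne hb]
    · simp
    · intro b _ hb
      rw [Finset.sum_eq_zero, zero_mul]
      intro s _
      by_cases h : s = r
      · subst h; simp [Pi.single_eq_of_ne hb]
      · simp [Pi.single_eq_of_ne h]
    · simp
  simp only [Matrix.mulVec, dotProduct, Matrix.of_apply, Fintype.sum_sum_type (α₁ := _ × _),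
    Fintype.sum_prod_type, mom, constraint, ite_mul, zero_mul, Finset.sum_ite_eq',
    Finset.mem_univ, if_true, Kinematics.totalMomentum, hphase]
  simp only [lamMap, mul_sub, Finset.sum_sub_distrib, Finset.mul_sum]
  rw [Finset.sum_comm (s := (Finset.univ : Finset (Fin (d + 1))))]
  rw [add_sub_left_comm, ← Finset.sum_sub_distrib]
  have : ∀ a : Particle d d', (∑ r, rho x r (finProdFinEquiv (m := 2) (n := 2) |>.symm q).1 *
        (t x a * (C r (pt x a) * K.lamt a (finProdFinEquiv (m := 2) (n := 2) |>.symm q).2))) -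
      ∑ r, K.lamt a (finProdFinEquiv (m := 2) (n := 2) |>.symm q).2 *
        (t x a * (rho x r (finProdFinEquiv (m := 2) (n := 2) |>.symm q).1 * C r (pt x a))) = 0 := by
    intro a
    rw [← Finset.sum_sub_distrib]
    exact Finset.sum_eq_zero fun r _ => by ring
  rw [Finset.sum_congr rfl fun a _ => this a]
  simp [mul_comm]

/-- The bosonic measure `∏ d⁴Z_r ∏ (σ_a dσ_a) ∏ dt_a / Vol GL(2,ℂ)` and the delta functions of the
Cachazo-Skinner formula, for pairwise distinct marked points. -/
def system (K : Kinematics d d') : DeltaSystem (CSVar d d') where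
  dom := {x | (∀ a b, a ≠ b → z x a ≠ z x b) ∧ ∀ a, t x a ≠ 0}
  constraint := constraint K
  gauge := gauge
  orbit := orbit
  total := K.totalMomentum
  mom := fun x => Matrix.of (mom K x)
  mom_spec := fun x _ => mom_spec K x

/-- The matrix `Φ̃` with reference spinors `w_0, …, w_d`. -/
def Phit (K : Kinematics d d') (x : CSVar d d' → ℂ) (w : Fin (d + 1) → Fin 2 → ℂ) :
    Matrix (Particle d d') (Particle d d') ℂ :=
  let off a b := br (K.lamt a) (K.lamt b) / br (pt x a) (pt x b) * (t x a * t x b)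
  Matrix.of fun a b => if a = b then
    -∑ c ∈ Finset.univ.erase a, off a c * ∏ r, br (pt x c) (w r) / br (pt x a) (w r)
  else off a b

/-- The matrix `Φ` with reference spinors `u_0, …, u_{d'}`, where `d' = n - d - 2`. -/
def Phi (K : Kinematics d d') (x : CSVar d d' → ℂ) (u : Fin (d' + 1) → Fin 2 → ℂ) :
    Matrix (Particle d d') (Particle d d') ℂ :=
  let off a b := br (K.lam a) (K.lam b) / br (pt x a) (pt x b) * (1 / (t x a * t x b))
  Matrix.of fun a b => if a = b then
    -∑ c ∈ Finset.univ.erase a, off a c * (∏ r, br (pt x c) (u r) / br (pt x a) (u r)) *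
      ((∏ e ∈ Finset.univ.erase a, br (pt x a) (pt x e)) /
        ∏ e ∈ Finset.univ.erase c, br (pt x c) (pt x e))
  else off a b

/-- The Vandermonde determinant `|σ_{e 1} ⋯ σ_{e m}| = ∏_{i < j} (e_i e_j)`. -/
def vandermonde {m : ℕ} (x : CSVar d d' → ℂ) (e : Fin m → Particle d d') : ℂ :=
  ∏ i, ∏ j ∈ Finset.Ioi i, br (pt x (e i)) (pt x (e j))

/-- The choices in the two reduced determinants: which rows and columns are kept, and the
reference spinors.  A choice of rows of `Φ̃` is an arrangement of the particles into `d + 2` removed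
and `d' = n - d - 2` kept ones; of `Φ` a choice of `d` kept ones. -/
structure Choices (d d' : ℕ) where
  rowsT : Fin (d + 2) ⊕ Fin d' ≃ Particle d d'
  colsT : Fin (d + 2) ⊕ Fin d' ≃ Particle d d'
  rows : Fin d ↪ Particle d d'
  cols : Fin d ↪ Particle d d'
  w : (CSVar d d' → ℂ) → Fin (d + 1) → Fin 2 → ℂ
  u : (CSVar d d' → ℂ) → Fin (d' + 1) → Fin 2 → ℂ

/-- No reference spinor causes a pole in a diagonal entry that occurs in the minors. -/
def Choices.NonsingularAt (c : Choices d d') (x : CSVar d d' → ℂ) : Prop :=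
  (∀ i j, c.rowsT (.inr i) = c.colsT (.inr j) →
    ∀ r, br (pt x (c.rowsT (.inr i))) (c.w x r) ≠ 0) ∧
  (∀ i j, c.rows i = c.cols j → ∀ r, br (pt x (c.rows i)) (c.u x r) ≠ 0)

/-- `|Φ̃|'`: a minor of size `n - d - 2`, with the sign of the removal of these rows and columns,
divided by the Vandermonde determinants of the removed rows and of the removed columns. -/
def detPhit (K : Kinematics d d') (c : Choices d d') (x : CSVar d d' → ℂ) : ℂ :=
  ((Equiv.Perm.sign (c.rowsT.symm.trans c.colsT) : ℤ) : ℂ) *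
    ((Phit K x (c.w x)).submatrix (c.rowsT ∘ Sum.inr) (c.colsT ∘ Sum.inr)).det /
    (vandermonde x (c.rowsT ∘ Sum.inl) * vandermonde x (c.colsT ∘ Sum.inl))

/-- `|Φ|'`: a minor of size `d`, divided by the Vandermonde determinants of the remaining rows and
of the remaining columns. -/
def detPhi (K : Kinematics d d') (c : Choices d d') (x : CSVar d d' → ℂ) : ℂ :=
  ((Phi K x (c.u x)).submatrix c.rows c.cols).det / (vandermonde x c.rows * vandermonde x c.cols)

/-- The fermionic part `∫ ∏_r d^{0|8}χ_r ∏_a δ^{0|8}(η_a - t_a χ(σ_a))`, where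
`χ(σ) = ∑_r χ_r C_r(σ)`: a Berezin integral in the Grassmann algebra of the `η` and the `χ`, whose
result involves the `η` alone. -/
def fermions (x : CSVar d d' → ℂ) : Grassmann (Particle d d' × Fin 8) :=
  Grassmann.restrict Sum.inl <|
    Grassmann.berezinList
      ((List.finRange (d + 1) ×ˢ List.finRange 8).map
        (Sum.inr : _ → (Particle d d' × Fin 8) ⊕ (Fin (d + 1) × Fin 8)))
      ((List.ofFn fun i : Fin (d + 1) => delta (.inl i)).prod *
        (List.ofFn fun p : Fin (d' + 1) => delta (.inr p)).prod)
where
  /-- `δ^{0|8}(η_a - t_a χ(σ_a))` -/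
  delta (a : Particle d d') : Grassmann ((Particle d d' × Fin 8) ⊕ (Fin (d + 1) × Fin 8)) :=
    fermionicDelta fun A : Fin 8 =>
      Grassmann.gen (Sum.inl (a, A)) -
        t x a • ∑ r, C r (pt x a) • Grassmann.gen (Sum.inr (r, A))

/-- The integrand that multiplies the bosonic measure and delta functions; the momentum eigenstates
contribute the factors `1 / t_a³`. -/
def integrand (K : Kinematics d d') (c : Choices d d') (x : CSVar d d' → ℂ) :
    Grassmann (Particle d d' × Fin 8) :=
  (detPhi K c x * detPhit K c x * ∏ a, 1 / t x a ^ 3) • fermions x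

/-- The Cachazo-Skinner formula, evaluated on momentum eigenstates. -/
def amplitude (K : Kinematics d d') (g : (system K).GaugeFixing) (c : Choices d d') :
    Grassmann (Particle d d' × Fin 8) :=
  g.localisedIntegral (integrand K c)

end CS

/-- From `N = 8` to `N = 7`: one of the eight fermionic coordinates (the one with label `0`) is
integrated out for the particles `p` and set to zero for the particles `i`. -/
def reduceSusy {d d' : ℕ} (x : Grassmann (Particle d d' × Fin 8)) :
    Grassmann (Particle d d' × Fin 7) :=
  Grassmann.restrict (Prod.map id Fin.succ) <|
    Grassmann.berezinList ((List.finRange (d' + 1)).map fun p => (Sum.inr p, 0)) x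

end

/-! Everything rests on one change of variables. To a point of the Cachazo–Skinner integral, with
marked points `(1, z_a)`, scalings `t_a` and a map of degree `d`, it assigns the punctures `σ_a =
s_a (1, z_a)` with `s_i = t_i ∏_{j≠i} (z_j - z_i)` and `s_p = 1 / (t_p ∏_i (z_i - z_p))`. With these
scales the numbers `1 / (p i)` are Lagrange interpolation weights: `t_p f(z_p) = ∑_i t_i f(z_i) / (p
i)` for every polynomial `f` of degree at most `d` (`CS.Dom.interpolate`). Hence the map is
determined by its values at the `k = d + 1` points `σ_i`, its constraints at the `σ_p` become `λ_p =
λ(σ_p)`, and the constraints from the `μ`-integral become an invertible matrix times `λ̃_i =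
λ̃(σ_i)`.

On solutions the Jacobian therefore factors as (redefinition of the constraints) · diag(1,
ambitwistor Jacobian) · (change of variables). A Faddeev–Popov weight does not depend on the gauge
conditions or on the traded delta functions, and it changes only by the two outer determinants
(`Matrix.fpWeight_mul_mul`). Let `B` be the matrix of the values `t_i C_r(σ_i)`. The outer
determinants are `det B ^ 2` and `(-1)^k det B ^ 2 ∏_a s_a² / t_a`, and the `χ`-integral supplies
`det B ^ 8`.

For the reduced determinants, a solution has `λ_a = t_a P(z_a)` and `t_a ∏_{c≠a} (z_c - z_a) λ̃_a =
Q(z_a)` with `deg P ≤ d` and `deg Q ≤ d'`. The off-diagonal entries of all four matrices are then,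
up to diagonal factors, values of the Bézoutians of the two components of `P` or of `Q`. The
prescribed diagonal entries are the values on the diagonal, because `∑_b f(z_b) / ∏_{c≠b} (z_c -
z_b) = 0` for `f` of low degree. Each reduced determinant is thus the determinant of a Bézout matrix
times explicit Vandermonde factors (`CS.Dom.detPhi_mul_detPhit`), and the remaining powers match by
`CS.Dom.det_basisMatrix_pow_four`.

Finally, the change of variables induces a bijection of gauge orbits (`CS.exists_slice_equiv`), so
the equality holds term by term. The case `N = 7` follows by integrating out one fermionic
component. -/

noncomputable section

/-! ### Gauge-fixed Jacobians and Faddeev–Popov weights -/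

namespace Matrix

variable {ν κ μ : Type} [Fintype ν] [DecidableEq ν] [Fintype κ] [DecidableEq κ] [Fintype μ]
  [DecidableEq μ]

/-- The determinant of a matrix that is bordered by the rows of `A` and the columns of `B`. -/
def borderedDet (J : Matrix ν ν ℂ) (A : Matrix μ ν ℂ) (B : Matrix ν μ ℂ) : ℂ :=
  (fromBlocks J B A 0).det

lemma det_fromBlocks_one_zero (A : Matrix μ ν ℂ) (G : Matrix ν μ ℂ) :
    (fromBlocks 1 G A 0).det = (-1) ^ Fintype.card μ * (A * G).det := by
  rw [det_fromBlocks_one₁₁, zero_sub, det_neg]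

/-- Multiplying the bordered matrix on the right by `[[1, G], [A', 0]]` makes it block triangular,
since `J * G = 0`. The companion lemma for `L` multiplies on the left by `[[1, B'], [L, 0]]`. -/
lemma borderedDet_mul_det_gauge {J : Matrix ν ν ℂ} {G : Matrix ν μ ℂ} (hG : J * G = 0)
    (A A' : Matrix μ ν ℂ) (B : Matrix ν μ ℂ) :
    borderedDet J A B * ((-1) ^ Fintype.card μ * (A' * G).det) =
      (J + B * A').det * (A * G).det := by
  rw [borderedDet, ← det_fromBlocks_one_zero, ← det_mul, fromBlocks_multiply]
  simp [hG, det_fromBlocks_zero₁₂]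

lemma borderedDet_mul_det_mom {J : Matrix ν ν ℂ} {L : Matrix μ ν ℂ} (hL : L * J = 0)
    (A : Matrix μ ν ℂ) (B B' : Matrix ν μ ℂ) :
    ((-1) ^ Fintype.card μ * (L * B').det) * borderedDet J A B =
      (J + B' * A).det * (L * B).det := by
  rw [borderedDet, ← det_fromBlocks_one_zero, ← det_mul, fromBlocks_multiply]
  simp [hL, det_fromBlocks_zero₂₁]

/-- The gauge-fixed Jacobian depends on the gauge conditions and on the removed constraints only
through the Faddeev-Popov determinants. -/
lemma borderedDet_mul_comm {J : Matrix ν ν ℂ} {G : Matrix ν μ ℂ} {L : Matrix μ ν ℂ}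
    (hG : J * G = 0) (hL : L * J = 0) {A A' : Matrix μ ν ℂ} {B B' : Matrix ν μ ℂ}
    (hA' : (A' * G).det ≠ 0) (hB : (L * B).det ≠ 0) :
    borderedDet J A B * ((A' * G).det * (L * B').det) =
      borderedDet J A' B' * ((A * G).det * (L * B).det) := by
  have hs : ((-1 : ℂ) ^ Fintype.card μ) ≠ 0 := pow_ne_zero _ (by norm_num)
  -- The choices are exchanged one at a time, `(A, B) → (A', B) → (A', B')`; `J + B * A'` and `J +
  -- B' * A'` serve as intermediaries.
  have h1 := borderedDet_mul_det_gauge hG A A' B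
  have h2 := borderedDet_mul_det_mom hL A' B B
  have h3 := borderedDet_mul_det_mom hL A' B B'
  have h4 := borderedDet_mul_det_gauge hG A' A' B'
  have h2' : (J + B * A').det = (-1) ^ Fintype.card μ * borderedDet J A' B :=
    mul_right_cancel₀ hB (by rw [← h2]; ring)
  have h4' : (J + B' * A').det = (-1) ^ Fintype.card μ * borderedDet J A' B' :=
    mul_right_cancel₀ hA' (by rw [← h4]; ring)
  rw [h2'] at h1
  rw [h4'] at h3
  have h1' : borderedDet J A B * (A' * G).det = borderedDet J A' B * (A * G).det :=
    mul_left_cancel₀ hs (by linear_combination h1)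
  have h3' : (L * B').det * borderedDet J A' B = borderedDet J A' B' * (L * B).det :=
    mul_left_cancel₀ hs (by linear_combination h3)
  linear_combination (L * B').det * h1' + (A * G).det * h3'

/-- The Faddeev-Popov weight of a solution. -/
def fpWeight (J : Matrix ν ν ℂ) (G : Matrix ν μ ℂ) (L : Matrix μ ν ℂ) (A : Matrix μ ν ℂ)
    (B : Matrix ν μ ℂ) : ℂ :=
  (A * G).det * (L * B).det / borderedDet J A B

lemma borderedDet_mul_mul (U J V : Matrix ν ν ℂ) (A : Matrix μ ν ℂ) (B : Matrix ν μ ℂ) :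
    borderedDet (U * J * V) (A * V) (U * B) = U.det * V.det * borderedDet J A B := by
  have h : fromBlocks (U * J * V) (U * B) (A * V) (0 : Matrix μ μ ℂ) =
      fromBlocks U 0 0 1 * fromBlocks J B A 0 * fromBlocks V 0 0 1 := by
    simp [fromBlocks_multiply, Matrix.mul_assoc]
  rw [borderedDet, h, det_mul, det_mul, det_fromBlocks_zero₂₁, det_fromBlocks_zero₂₁, borderedDet]
  simp
  ring

/-- The weight under a change of variables `V` and a linear redefinition `U` of the constraints. -/
lemma fpWeight_mul_mul {J J' U V : Matrix ν ν ℂ} {G G' : Matrix ν μ ℂ} {L L' : Matrix μ ν ℂ}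
    {X : Matrix μ μ ℂ} (hG : J * G = 0) (hL : L * J = 0)
    (hJ' : J' = U * J * V) (hG' : V * G' = G * X) (hL' : L' * U = L)
    (hU : U.det ≠ 0) (hV : V.det ≠ 0) (hX : X.det = 1)
    {A A' : Matrix μ ν ℂ} {B B' : Matrix ν μ ℂ}
    (hA : (A * G).det ≠ 0) (hB : (L * B).det ≠ 0)
    (hA' : (A' * G').det ≠ 0) (hB' : (L' * B').det ≠ 0) :
    fpWeight J' G' L' A' B' * (U.det * V.det) = fpWeight J G L A B := by
  have hGJ' : J' * G' = 0 := by
    rw [hJ', Matrix.mul_assoc, hG', ← Matrix.mul_assoc, Matrix.mul_assoc U, hG]; simp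
  have hLJ' : L' * J' = 0 := by
    rw [hJ', Matrix.mul_assoc, ← Matrix.mul_assoc, hL', ← Matrix.mul_assoc, hL]; simp
  have key := borderedDet_mul_comm hGJ' hLJ' (A := A') (A' := A * V) (B := B') (B' := U * B)
    (by rw [Matrix.mul_assoc, hG', ← Matrix.mul_assoc, det_mul, hX, mul_one]; exact hA) hB'
  have e1 : (A * V * G').det = (A * G).det := by
    rw [Matrix.mul_assoc, hG', ← Matrix.mul_assoc, det_mul, hX, mul_one]
  have e2 : (L' * (U * B)).det = (L * B).det := by rw [← Matrix.mul_assoc, hL']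
  have e3 : borderedDet J' (A * V) (U * B) = U.det * V.det * borderedDet J A B := by
    rw [hJ', borderedDet_mul_mul]
  rw [e1, e2, e3] at key
  unfold fpWeight
  -- The two bordered determinants vanish together, and then both weights are `0` by the convention
  -- for division by zero.
  by_cases hD : borderedDet J A B = 0
  · have : borderedDet J' A' B' = 0 := by
      rw [hD] at key
      simpa [hA, hB] using key
    simp [hD, this]
  · have : borderedDet J' A' B' ≠ 0 := by
      intro h
      rw [h, zero_mul] at key
      exact mul_ne_zero (mul_ne_zero (mul_ne_zero hU hV) hD) (mul_ne_zero hA' hB') key.symm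
    field_simp
    linear_combination -key

/-- Adding variables that are fixed by delta functions does not change the weight. -/
lemma fpWeight_fromBlocks_one (J : Matrix ν ν ℂ) (G : Matrix ν μ ℂ) (L : Matrix μ ν ℂ)
    (A : Matrix μ ν ℂ) (B : Matrix ν μ ℂ) :
    fpWeight (fromBlocks (1 : Matrix κ κ ℂ) 0 0 J) (fromRows 0 G) (fromCols 0 L)
      (fromCols 0 A) (fromRows 0 B) = fpWeight J G L A B := by
  have hb : borderedDet (fromBlocks (1 : Matrix κ κ ℂ) 0 0 J) (fromCols 0 A) (fromRows 0 B) =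
      borderedDet J A B := by
    have : fromBlocks (fromBlocks (1 : Matrix κ κ ℂ) 0 0 J) (fromRows 0 B) (fromCols 0 A)
        (0 : Matrix μ μ ℂ) =
        (fromBlocks (1 : Matrix κ κ ℂ) 0 0 (fromBlocks J B A 0)).submatrix
          (Equiv.sumAssoc κ ν μ) (Equiv.sumAssoc κ ν μ) := by
      ext i j
      rcases i with (i | i) | i <;> rcases j with (j | j) | j <;> rfl
    rw [borderedDet, this, det_submatrix_equiv_self, det_fromBlocks_zero₂₁, det_one, one_mul,
      borderedDet]
  rw [fpWeight, hb, fromCols_mul_fromRows, fromCols_mul_fromRows]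
  simp [fpWeight]

/-- The nondegeneracy of a solution: the kernel of the Jacobian consists of gauge directions, and
the linearised constraints satisfy no relation other than momentum conservation. -/
def GaugeNondegenerate (J : Matrix ν ν ℂ) (G : Matrix ν μ ℂ) (L : Matrix μ ν ℂ) : Prop :=
  (∀ v, J *ᵥ v = 0 → ∃ X, v = G *ᵥ X) ∧ ∀ y, L *ᵥ y = 0 → ∃ v, y = J *ᵥ v

lemma GaugeNondegenerate.of_mul_mul {J J' U V : Matrix ν ν ℂ} {G G' : Matrix ν μ ℂ}
    {L L' : Matrix μ ν ℂ} {X : Matrix μ μ ℂ}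
    (hJ' : J' = U * J * V) (hG' : V * G' = G * X) (hL' : L' * U = L)
    (hU : U.det ≠ 0) (hV : V.det ≠ 0) (hX : X.det = 1) (h : GaugeNondegenerate J G L) :
    GaugeNondegenerate J' G' L' := by
  have hU' : IsUnit U.det := isUnit_iff_ne_zero.2 hU
  have hV' : IsUnit V.det := isUnit_iff_ne_zero.2 hV
  have hX' : IsUnit X.det := by rw [hX]; exact isUnit_one
  refine ⟨fun v hv => ?_, fun y hy => ?_⟩
  · have h1 : J *ᵥ (V *ᵥ v) = 0 := by
      have := congrArg (U⁻¹ *ᵥ ·) hv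
      simpa [hJ', Matrix.mul_assoc, nonsing_inv_mul_cancel_left _ _ hU'] using this
    obtain ⟨Y, hY⟩ := h.1 _ h1
    refine ⟨X⁻¹ *ᵥ Y, ?_⟩
    have h2 : V *ᵥ v = V *ᵥ (G' *ᵥ (X⁻¹ *ᵥ Y)) := by
      rw [hY, mulVec_mulVec, mulVec_mulVec, hG', Matrix.mul_assoc, mul_nonsing_inv _ hX',
        Matrix.mul_one]
    have := congrArg (V⁻¹ *ᵥ ·) h2
    simpa only [mulVec_mulVec, nonsing_inv_mul _ hV', one_mulVec,
      nonsing_inv_mul_cancel_left _ _ hV'] using this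
  · obtain ⟨v, hv⟩ := h.2 (U⁻¹ *ᵥ y) (by
      rw [← hL', mulVec_mulVec, Matrix.mul_assoc, mul_nonsing_inv _ hU', Matrix.mul_one, hy])
    refine ⟨V⁻¹ *ᵥ v, ?_⟩
    rw [hJ', mulVec_mulVec, Matrix.mul_assoc, mul_nonsing_inv _ hV', Matrix.mul_one,
      ← mulVec_mulVec, ← hv, mulVec_mulVec, mul_nonsing_inv _ hU', one_mulVec]

lemma gaugeNondegenerate_mul_mul_iff {J J' U V : Matrix ν ν ℂ} {G G' : Matrix ν μ ℂ}
    {L L' : Matrix μ ν ℂ} {X : Matrix μ μ ℂ}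
    (hJ' : J' = U * J * V) (hG' : V * G' = G * X) (hL' : L' * U = L)
    (hU : U.det ≠ 0) (hV : V.det ≠ 0) (hX : X.det = 1) :
    GaugeNondegenerate J' G' L' ↔ GaugeNondegenerate J G L := by
  refine ⟨fun h => ?_, GaugeNondegenerate.of_mul_mul hJ' hG' hL' hU hV hX⟩
  have hU' : IsUnit U.det := isUnit_iff_ne_zero.2 hU
  have hV' : IsUnit V.det := isUnit_iff_ne_zero.2 hV
  have hX' : IsUnit X.det := by rw [hX]; exact isUnit_one
  refine GaugeNondegenerate.of_mul_mul (U := U⁻¹) (V := V⁻¹) (X := X⁻¹) ?_ ?_ ?_ ?_ ?_ ?_ h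
  · rw [hJ', Matrix.mul_assoc, Matrix.mul_assoc, mul_nonsing_inv _ hV', Matrix.mul_one,
      nonsing_inv_mul_cancel_left _ _ hU']
  · have := congrArg (fun M => V⁻¹ * M * X⁻¹) hG'
    simp only [nonsing_inv_mul_cancel_left _ _ hV'] at this
    rw [this, Matrix.mul_assoc, Matrix.mul_assoc, mul_nonsing_inv _ hX', Matrix.mul_one]
  · rw [← hL', Matrix.mul_assoc, mul_nonsing_inv _ hU', Matrix.mul_one]
  · rw [det_nonsing_inv]; simpa using hU
  · rw [det_nonsing_inv]; simpa using hV
  · rw [det_nonsing_inv, hX]; simp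

/-- The identity block neither enlarges the kernel nor obstructs the image. This discards the values
of the map at the points `σ_i`, which the ambitwistor formula does not contain. -/
lemma gaugeNondegenerate_fromBlocks_one_iff (J : Matrix ν ν ℂ) (G : Matrix ν μ ℂ) (L : Matrix μ ν ℂ) :
    GaugeNondegenerate (fromBlocks (1 : Matrix κ κ ℂ) 0 0 J) (fromRows 0 G) (fromCols 0 L) ↔
      GaugeNondegenerate J G L := by
  have hJ : ∀ u v, fromBlocks (1 : Matrix κ κ ℂ) 0 0 J *ᵥ Sum.elim u v =
      Sum.elim u (J *ᵥ v) := by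
    intro u v; simp [fromBlocks_mulVec, Function.comp_def]
  have hG : ∀ X, fromRows (0 : Matrix κ μ ℂ) G *ᵥ X = Sum.elim (0 : κ → ℂ) (G *ᵥ X) := by
    intro X; simp [fromRows_mulVec]
  have hL : ∀ u v, fromCols (0 : Matrix μ κ ℂ) L *ᵥ Sum.elim u v = L *ᵥ v := by
    intro u v; simp [fromCols_mulVec, Function.comp_def]
  have hs : ∀ f : κ ⊕ ν → ℂ, ∃ u v, f = Sum.elim u v := fun f =>
    ⟨f ∘ Sum.inl, f ∘ Sum.inr, (Sum.elim_comp_inl_inr f).symm⟩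
  have z : (0 : κ ⊕ ν → ℂ) = Sum.elim (0 : κ → ℂ) (0 : ν → ℂ) := by ext (i | i) <;> rfl
  constructor
  · rintro ⟨h1, h2⟩
    refine ⟨fun v hv => ?_, fun y hy => ?_⟩
    · obtain ⟨X, hX⟩ := h1 (Sum.elim 0 v) (by rw [hJ, hv, z])
      rw [hG, Sum.elim_eq_iff] at hX
      exact ⟨X, hX.2⟩
    · obtain ⟨v, hv⟩ := h2 (Sum.elim 0 y) (by rw [hL, hy])
      obtain ⟨a, b, rfl⟩ := hs v
      rw [hJ, Sum.elim_eq_iff] at hv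
      exact ⟨b, hv.2⟩
  · rintro ⟨h1, h2⟩
    refine ⟨fun v hv => ?_, fun y hy => ?_⟩
    · obtain ⟨a, b, rfl⟩ := hs v
      rw [hJ, z, Sum.elim_eq_iff] at hv
      obtain ⟨X, hX⟩ := h1 b hv.2
      exact ⟨X, by rw [hG, ← hX, hv.1]⟩
    · obtain ⟨a, b, rfl⟩ := hs y
      rw [hL] at hy
      obtain ⟨v, hv⟩ := h2 b hy
      exact ⟨Sum.elim a v, by rw [hJ, hv]⟩

end Matrix
end

/-! ### Lagrange interpolation, Bézoutians and Vandermonde determinants -/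

noncomputable section

section Interpolation

open Polynomial Finset

variable {ι : Type} [Fintype ι] [DecidableEq ι]

/-- The product `∏_{c ≠ a} (z_c - z_a)`. -/
def nodeProd (z : ι → ℂ) (a : ι) : ℂ := ∏ c ∈ univ.erase a, (z c - z a)

lemma nodeProd_ne_zero {z : ι → ℂ} (hz : Function.Injective z) (a : ι) : nodeProd z a ≠ 0 :=
  prod_ne_zero_iff.2 fun _ hc => sub_ne_zero.2 (hz.ne (ne_of_mem_erase hc))

/-- Up to a common sign, the sum is the coefficient of `X ^ (card ι - 1)` in the Lagrange
interpolant of `f` on all the nodes. That interpolant is `f` itself, whose degree is smaller. The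
sign arises because `nodeProd` uses `z c - z a` instead of `z a - z c`. -/
lemma sum_eval_div_nodeProd {z : ι → ℂ} (hz : Function.Injective z) {f : ℂ[X]}
    (hf : f.natDegree + 1 < Fintype.card ι) : ∑ b, f.eval (z b) / nodeProd z b = 0 := by
  have hdeg : f.degree < ((#(univ : Finset ι) : ℕ) : WithBot ℕ) :=
    lt_of_le_of_lt degree_le_natDegree (by rw [card_univ]; exact_mod_cast by omega)
  have h := Lagrange.coeff_eq_sum (s := univ) (v := z) hz.injOn hdeg
  rw [coeff_eq_zero_of_natDegree_lt (by rw [card_univ]; omega)] at h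
  have h2 : ∀ b, nodeProd z b =
      (-1) ^ (Fintype.card ι - 1) * ∏ c ∈ univ.erase b, (z b - z c) := by
    intro b
    rw [nodeProd, ← card_univ, ← card_erase_of_mem (mem_univ b), ← prod_const, ← prod_mul_distrib]
    exact prod_congr rfl fun _ _ => by ring
  simp_rw [h2, mul_comm ((-1 : ℂ) ^ _), ← div_div]
  rw [← Finset.sum_div, ← h, zero_div]

/-- The symmetric polynomial kernel with coefficient matrix `N`. -/
def kernelEval {m : ℕ} (N : Matrix (Fin m) (Fin m) ℂ) (x y : ℂ) : ℂ :=
  ∑ r : Fin m, ∑ s : Fin m, x ^ (r : ℕ) * N r s * y ^ (s : ℕ)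

lemma kernelEval_eq_sub {m : ℕ} (a b : ℕ) (hab : a < b) (hb : b ≤ m) :
    ∃ N : Matrix (Fin m) (Fin m) ℂ, ∀ x y,
      (y - x) * kernelEval N x y = x ^ a * y ^ b - x ^ b * y ^ a := by
  -- The quotient by `y - x` is the geometric sum `∑_{a ≤ r < b} x^r y^(a+b-1-r)`, so the matrix is
  -- supported on a segment of the antidiagonal `r + s = a + b - 1`.
  refine ⟨Matrix.of fun r s => if a ≤ (r : ℕ) ∧ (r : ℕ) < b ∧ (r : ℕ) + s + 1 = a + b
    then 1 else 0, fun x y => ?_⟩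
  have h1 : kernelEval (m := m) (Matrix.of fun r s => if a ≤ (r : ℕ) ∧ (r : ℕ) < b ∧
      (r : ℕ) + s + 1 = a + b then (1 : ℂ) else 0) x y =
      ∑ i ∈ range (b - a), (x * y) ^ a * (x ^ i * y ^ (b - a - 1 - i)) := by
    have inner : ∀ r : Fin m, (∑ s : Fin m, x ^ (r : ℕ) * (if a ≤ (r : ℕ) ∧ (r : ℕ) < b ∧
        (r : ℕ) + s + 1 = a + b then (1 : ℂ) else 0) * y ^ (s : ℕ)) =
        if a ≤ (r : ℕ) ∧ (r : ℕ) < b then x ^ (r : ℕ) * y ^ (a + b - 1 - r) else 0 := by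
      intro r
      split_ifs with h
      · rw [Fintype.sum_eq_single (⟨a + b - 1 - r, by omega⟩ : Fin m)]
        · rw [if_pos ⟨h.1, h.2, by simp; omega⟩, mul_one]
        · intro s hs
          rw [if_neg, mul_zero, zero_mul]
          rintro ⟨_, _, h3⟩
          exact hs (Fin.ext (by simp; omega))
      · refine sum_eq_zero fun s _ => ?_
        rw [if_neg (fun h' => h ⟨h'.1, h'.2.1⟩), mul_zero, zero_mul]
    unfold kernelEval
    simp only [Matrix.of_apply, inner]
    rw [Fin.sum_univ_eq_sum_range
      (fun r => if a ≤ r ∧ r < b then x ^ r * y ^ (a + b - 1 - r) else 0) m,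
      ← sum_filter]
    have : filter (fun r => a ≤ r ∧ r < b) (range m) = Ico a b := by
      ext r; simp; omega
    rw [this, sum_Ico_eq_sum_range]
    refine sum_congr rfl fun i hi => ?_
    rw [mem_range] at hi
    rw [show a + b - 1 - (a + i) = (b - a - 1 - i) + a by omega, pow_add, pow_add]
    ring
  rw [h1, ← mul_sum]
  have h2 := Commute.geom_sum₂_mul (Commute.all x y) (b - a)
  have hxb : x ^ b = x ^ a * x ^ (b - a) := by rw [← pow_add]; congr 1; omega
  have hyb : y ^ b = y ^ a * y ^ (b - a) := by rw [← pow_add]; congr 1; omega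
  rw [hxb, hyb]
  linear_combination -(x * y) ^ a * h2 +
    (x ^ a * y ^ a - (x * y) ^ a) * (y ^ (b - a) - x ^ (b - a))

lemma kernelEval_sum {m : ℕ} {κ : Type} (s : Finset κ) (N : κ → Matrix (Fin m) (Fin m) ℂ)
    (c : κ → ℂ) (x y : ℂ) :
    kernelEval (∑ k ∈ s, c k • N k) x y = ∑ k ∈ s, c k * kernelEval (N k) x y := by
  classical
  induction s using Finset.induction_on with
  | empty => simp [kernelEval]
  | insert k s hk ih =>
    rw [sum_insert hk, sum_insert hk, ← ih]
    simp only [kernelEval, mul_sum, ← sum_add_distrib]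
    refine sum_congr rfl fun r _ => sum_congr rfl fun s _ => ?_
    rw [Matrix.add_apply, Matrix.smul_apply, smul_eq_mul]
    ring

/-- The Bézoutian of two polynomials of degree at most `m`. -/
lemma exists_bezoutian {m : ℕ} {f g : ℂ[X]} (hf : f.natDegree ≤ m) (hg : g.natDegree ≤ m) :
    ∃ N : Matrix (Fin m) (Fin m) ℂ, ∀ x y,
      (y - x) * kernelEval N x y = f.eval x * g.eval y - g.eval x * f.eval y := by
  have basic : ∀ a b : ℕ, a ≤ m → b ≤ m → ∃ N : Matrix (Fin m) (Fin m) ℂ, ∀ x y,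
      (y - x) * kernelEval N x y = x ^ a * y ^ b - x ^ b * y ^ a := by
    intro a b ha hb
    rcases lt_trichotomy a b with h | h | h
    · exact kernelEval_eq_sub a b h hb
    · exact ⟨0, fun x y => by simp [kernelEval, h]⟩
    · obtain ⟨N, hN⟩ := kernelEval_eq_sub b a h ha
      exact ⟨-N, fun x y => by
        have : kernelEval (-N) x y = -kernelEval N x y := by simp [kernelEval]
        rw [this]; linear_combination -hN x y⟩
  -- The bounds are moved behind the existential quantifier, so that `choose` gives a matrix for all
  -- pairs of exponents.
  have basic' : ∀ a b : ℕ, ∃ N : Matrix (Fin m) (Fin m) ℂ, a ≤ m → b ≤ m → ∀ x y,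
      (y - x) * kernelEval N x y = x ^ a * y ^ b - x ^ b * y ^ a := by
    intro a b
    by_cases h : a ≤ m ∧ b ≤ m
    · obtain ⟨N, hN⟩ := basic a b h.1 h.2
      exact ⟨N, fun _ _ => hN⟩
    · exact ⟨0, fun ha hb => (h ⟨ha, hb⟩).elim⟩
  choose N hN using basic'
  refine ⟨∑ k ∈ range (m + 1) ×ˢ range (m + 1), (f.coeff k.1 * g.coeff k.2) • N k.1 k.2,
    fun x y => ?_⟩
  rw [kernelEval_sum, mul_sum, eval_eq_sum_range' (Nat.lt_succ_of_le hf) x,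
    eval_eq_sum_range' (Nat.lt_succ_of_le hg) y, eval_eq_sum_range' (Nat.lt_succ_of_le hg) x,
    eval_eq_sum_range' (Nat.lt_succ_of_le hf) y, sum_mul_sum,
    mul_comm (∑ i ∈ range m.succ, g.coeff i * x ^ i), sum_mul_sum, ← sum_product',
    ← sum_product', ← sum_sub_distrib]
  refine sum_congr rfl fun k hk => ?_
  simp only [mem_product, mem_range] at hk
  linear_combination (f.coeff k.1 * g.coeff k.2) *
    hN k.1 k.2 (by omega) (by omega) x y

/-- A polynomial kernel of low degree on the diagonal, in terms of its other values. -/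
lemma kernelEval_diag {m : ℕ} (N : Matrix (Fin m) (Fin m) ℂ) {z : ι → ℂ}
    (hz : Function.Injective z) {U : ℂ[X]} (hU : m + U.natDegree < Fintype.card ι) (a : ι) :
    kernelEval N (z a) (z a) * (U.eval (z a) / nodeProd z a) =
      -∑ b ∈ univ.erase a, kernelEval N (z a) (z b) * (U.eval (z b) / nodeProd z b) := by
  rw [eq_neg_iff_add_eq_zero, add_sum_erase univ
    (fun b => kernelEval N (z a) (z b) * (U.eval (z b) / nodeProd z b)) (mem_univ a)]
  -- Each power of `z b` in the kernel is summed separately. Its exponent is at most `m - 1`, so `m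
  -- + deg U < card ι` is exactly what the vanishing sum needs.
  have hs : ∀ s : Fin m, ∑ b, z b ^ (s : ℕ) * (U.eval (z b) / nodeProd z b) = 0 := by
    intro s
    have := sum_eval_div_nodeProd hz (f := X ^ (s : ℕ) * U) (lt_of_le_of_lt
      (Nat.succ_le_succ natDegree_mul_le) (by rw [natDegree_X_pow]; omega))
    simpa [mul_div_assoc] using this
  simp only [kernelEval, sum_mul]
  rw [sum_comm]
  refine sum_eq_zero fun r _ => ?_
  rw [sum_comm]
  refine sum_eq_zero fun s _ => ?_
  have := congrArg (fun t => z a ^ (r : ℕ) * N r s * t) (hs s)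
  simpa [mul_sum, mul_assoc] using this

/-- The matrix factors as diagonal · Vandermonde · `N` · transposed Vandermonde · diagonal. The
minors of all four matrices of the two formulae are evaluated in this way. -/
lemma of_kernelEval_submatrix_det {m : ℕ} (N : Matrix (Fin m) (Fin m) ℂ) (x y c e : Fin m → ℂ) :
    (Matrix.of fun i j => c i * kernelEval N (x i) (y j) * e j).det =
      (∏ i, c i) * (Matrix.vandermonde x).det * N.det * (Matrix.vandermonde y).det *
        ∏ i, e i := by
  have : (Matrix.of fun i j => c i * kernelEval N (x i) (y j) * e j) =
      Matrix.diagonal c * (Matrix.vandermonde x * N * (Matrix.vandermonde y)ᵀ) *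
        Matrix.diagonal e := by
    ext i j
    rw [Matrix.mul_diagonal, Matrix.diagonal_mul, Matrix.of_apply]
    congr 2
    simp only [kernelEval, Matrix.mul_apply, Matrix.vandermonde_apply, Matrix.transpose_apply,
      sum_mul]
    rw [sum_comm]
  rw [this]
  simp only [Matrix.det_mul, Matrix.det_diagonal, Matrix.det_transpose]
  ring

lemma prod_erase_eq_prod_ite {M : Type} [CommMonoid M] (a : ι) (f : ι → M) :
    ∏ c ∈ univ.erase a, f c = ∏ c, if c = a then 1 else f c := by
  rw [← mul_prod_erase univ _ (mem_univ a), if_pos rfl, one_mul]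
  exact prod_congr rfl fun c hc => (if_neg (ne_of_mem_erase hc)).symm

lemma nodeProd_comp_equiv {κ : Type} [Fintype κ] [DecidableEq κ] (e : κ ≃ ι) (z : ι → ℂ) (a : κ) :
    nodeProd (z ∘ e) a = nodeProd z (e a) := by
  simp only [nodeProd, prod_erase_eq_prod_ite]
  rw [← e.prod_comp]
  simp

/-- Each of the `n.choose 2` pairs of nodes occurs once in either order and contributes minus the
square of its difference. -/
lemma prod_nodeProd_fin {n : ℕ} (z : Fin n → ℂ) :
    ∏ a, nodeProd z a = (-1) ^ n.choose 2 * (Matrix.vandermonde z).det ^ 2 := by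
  have h := prod_prod_Ioi_mul_eq_prod_prod_off_diag (α := Fin n) (fun i j => z i - z j)
  have h1 : ∏ a, nodeProd z a = ∏ i, ∏ j ∈ ({i} : Finset (Fin n))ᶜ, (z j - z i) :=
    prod_congr rfl fun a _ => prod_congr (by ext; simp) fun _ _ => rfl
  have h2 : ∀ i : Fin n, ∏ j ∈ Ioi i, (z j - z i) * (z i - z j) =
      (-1) ^ (n - 1 - i : ℕ) * (∏ j ∈ Ioi i, (z j - z i)) ^ 2 := by
    intro i
    rw [← Fin.card_Ioi i, ← prod_const, ← prod_pow, ← prod_mul_distrib]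
    exact prod_congr rfl fun _ _ => by ring
  rw [h1, ← h, Matrix.det_vandermonde, prod_congr rfl fun i _ => h2 i, prod_mul_distrib, prod_pow,
    prod_pow_eq_pow_sum, Fin.sum_univ_eq_sum_range (fun i => n - 1 - i) n, sum_range_reflect (fun i => i),
    sum_range_id, Nat.choose_two_right]

/-- The square of a Vandermonde determinant does not depend on the order of the nodes. -/
lemma vandermonde_det_sq {n : ℕ} (e : Fin n ≃ ι) (z : ι → ℂ) :
    (Matrix.vandermonde (z ∘ e)).det ^ 2 = (-1) ^ n.choose 2 * ∏ a, nodeProd z a := by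
  have h := prod_nodeProd_fin (z ∘ e)
  simp only [nodeProd_comp_equiv, e.prod_comp (fun a => nodeProd z a)] at h
  rw [h, ← mul_assoc, ← pow_add, Even.neg_one_pow (Even.add_self _), one_mul]

lemma vandermonde_det_sum {a b : ℕ} (z : Fin a ⊕ Fin b → ℂ) :
    (Matrix.vandermonde (z ∘ finSumFinEquiv.symm)).det =
      (Matrix.vandermonde (z ∘ Sum.inl)).det * (Matrix.vandermonde (z ∘ Sum.inr)).det *
        ∏ i, ∏ j, (z (.inr j) - z (.inl i)) := by
  have key : ∀ {n : ℕ} (v : Fin n → ℂ), (Matrix.vandermonde v).det =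
      ∏ i, ∏ j, if i < j then v j - v i else 1 := by
    intro n v
    rw [Matrix.det_vandermonde]
    refine prod_congr rfl fun i _ => ?_
    rw [← prod_filter]
    exact prod_congr (by ext; simp) fun _ _ => rfl
  have hlt : ∀ (i : Fin a) (j : Fin b), Fin.castAdd b i < Fin.natAdd a j := fun i j => by
    rw [Fin.lt_def]; simp; omega
  have hlt' : ∀ i j : Fin a, Fin.castAdd b i < Fin.castAdd b j ↔ i < j := fun _ _ => Iff.rfl
  simp only [key, Fin.prod_univ_add, Function.comp_apply, finSumFinEquiv_symm_apply_castAdd,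
    finSumFinEquiv_symm_apply_natAdd, if_pos (hlt _ _), if_neg (hlt _ _).not_gt, prod_const_one,
    one_mul, prod_mul_distrib, Fin.natAdd_lt_natAdd_iff, hlt']
  ring

lemma nodeProd_inl {κ : Type} [Fintype κ] [DecidableEq κ] (z : κ ⊕ ι → ℂ) (j : κ) :
    nodeProd z (.inl j) = nodeProd (z ∘ Sum.inl) j * ∏ i, (z (.inr i) - z (.inl j)) := by
  simp only [nodeProd, prod_erase_eq_prod_ite, Fintype.prod_sum_type]
  simp

lemma nodeProd_inr {κ : Type} [Fintype κ] [DecidableEq κ] (z : κ ⊕ ι → ℂ) (j : ι) :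
    nodeProd z (.inr j) = (∏ i, (z (.inl i) - z (.inr j))) * nodeProd (z ∘ Sum.inr) j := by
  simp only [nodeProd, prod_erase_eq_prod_ite, Fintype.prod_sum_type]
  simp

lemma prod_sub_comm {b : ℕ} (f g : Fin b → ℂ) :
    ∏ j, (f j - g j) = (-1) ^ b * ∏ j, (g j - f j) := by
  have : ∀ j, f j - g j = -1 * (g j - f j) := fun j => by ring
  simp only [this, prod_mul_distrib, prod_const, card_univ, Fintype.card_fin]

/-- The node product of a right node splits into its differences to the left nodes and to the other
right nodes. The latter multiply to the squared Vandermonde of the right nodes, up to sign; the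
former complete the product of the two small Vandermondes to that of all the nodes. -/
lemma prod_nodeProd_inr {a b : ℕ} (z : Fin a ⊕ Fin b → ℂ) :
    (∏ j, nodeProd z (.inr j)) * (Matrix.vandermonde (z ∘ Sum.inl)).det =
      (-1) ^ (a * b + b.choose 2) * (Matrix.vandermonde (z ∘ finSumFinEquiv.symm)).det *
        (Matrix.vandermonde (z ∘ Sum.inr)).det := by
  have h : ∏ j, ∏ i, (z (.inl i) - z (.inr j)) =
      (-1) ^ (a * b) * ∏ i, ∏ j, (z (.inr j) - z (.inl i)) := by
    rw [prod_comm]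
    have : ∀ i : Fin a, ∏ j : Fin b, (z (.inl i) - z (.inr j)) =
        (-1) ^ b * ∏ j : Fin b, (z (.inr j) - z (.inl i)) := fun i => prod_sub_comm _ _
    simp only [this, prod_mul_distrib, prod_const, card_univ, Fintype.card_fin, ← pow_mul,
      mul_comm b a]
  simp only [nodeProd_inr, prod_mul_distrib]
  rw [h, prod_nodeProd_fin, vandermonde_det_sum]
  ring

/-- The reduced determinant of a matrix built from a kernel with an `m`-dimensional space of
coefficients, evaluated at `m + 1` points. -/
lemma det_succAbove_kernelEval {m : ℕ} (N : Matrix (Fin m) (Fin m) ℂ) {z : Fin (m + 1) → ℂ}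
    (hz : Function.Injective z) (i₀ : Fin (m + 1)) :
    (Matrix.of fun i j => (nodeProd z (i₀.succAbove i))⁻¹ *
      kernelEval N (z (i₀.succAbove i)) (z (i₀.succAbove j)) *
        (nodeProd z (i₀.succAbove j))⁻¹).det * (Matrix.vandermonde z).det ^ 2 = N.det := by
  rw [of_kernelEval_submatrix_det]
  have hD : ∀ j, nodeProd z (i₀.succAbove j) =
      (z i₀ - z (i₀.succAbove j)) * nodeProd (z ∘ i₀.succAbove) j := by
    intro j
    simp only [nodeProd, prod_erase_eq_prod_ite]
    rw [Fin.prod_univ_succAbove _ i₀, if_neg (Fin.succAbove_ne i₀ j).symm]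
    simp
  have hD0 : nodeProd z i₀ = (-1) ^ m * ∏ j, (z i₀ - z (i₀.succAbove j)) := by
    simp only [nodeProd, prod_erase_eq_prod_ite]
    rw [Fin.prod_univ_succAbove _ i₀, if_pos rfl, one_mul]
    rw [← prod_sub_comm]
    simp
  have h1 := vandermonde_det_sq (Equiv.refl _) z
  have h2 := prod_nodeProd_fin (z ∘ i₀.succAbove)
  have hP : ∏ j, nodeProd z (i₀.succAbove j) =
      (∏ j, (z i₀ - z (i₀.succAbove j))) * ∏ j, nodeProd (z ∘ i₀.succAbove) j := by
    simp only [hD, prod_mul_distrib]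
  have hPne : ∏ j, nodeProd z (i₀.succAbove j) ≠ 0 :=
    prod_ne_zero_iff.2 fun _ _ => nodeProd_ne_zero hz _
  rw [Fin.prod_univ_succAbove _ i₀, hD0] at h1
  rw [prod_inv_distrib]
  have hc : (m + 1).choose 2 = m + m.choose 2 := by rw [Nat.choose_succ_succ']; simp
  have hs : ((-1 : ℂ) ^ m) ^ 2 = 1 := by rw [← pow_mul, mul_comm, pow_mul]; simp
  have hs' : ((-1 : ℂ) ^ m.choose 2) ^ 2 = 1 := by rw [← pow_mul, mul_comm, pow_mul]; simp
  -- Both squared Vandermondes are products of node products. The sign `(-1) ^ m` of `nodeProd z i₀`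
  -- cancels the difference between `(m + 1).choose 2` and `m.choose 2`.
  have key : (Matrix.vandermonde z).det ^ 2 * (Matrix.vandermonde (z ∘ i₀.succAbove)).det ^ 2 =
      (∏ j, nodeProd z (i₀.succAbove j)) ^ 2 := by
    have h1' : (Matrix.vandermonde z).det ^ 2 = (-1) ^ (m.choose 2) *
        ((∏ j, (z i₀ - z (i₀.succAbove j))) * ∏ j, nodeProd z (i₀.succAbove j)) := by
      have : (z ∘ (Equiv.refl (Fin (m + 1)))) = z := rfl
      rw [this] at h1
      rw [h1, hc, pow_add]
      linear_combination ((-1) ^ (m.choose 2) *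
        ((∏ j, (z i₀ - z (i₀.succAbove j))) * ∏ j, nodeProd z (i₀.succAbove j))) * hs
    rw [h1', sq (∏ j, nodeProd z (i₀.succAbove j))]
    nth_rewrite 2 [hP]
    rw [h2]
    ring
  have : (Matrix.vandermonde fun i => z (i₀.succAbove i)) =
      Matrix.vandermonde (z ∘ i₀.succAbove) := rfl
  rw [this]
  field_simp
  linear_combination N.det * key

lemma vandermonde_det_comp_perm {n : ℕ} (z : Fin n → ℂ) (σ : Equiv.Perm (Fin n)) :
    (Matrix.vandermonde (z ∘ σ)).det = ((Equiv.Perm.sign σ : ℤ) : ℂ) * (Matrix.vandermonde z).det := by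
  have : Matrix.vandermonde (z ∘ σ) = (Matrix.vandermonde z).submatrix σ id := rfl
  rw [this, Matrix.det_permute]

/-- The reduced determinant of a matrix of corank `a`, from any rows and columns. -/
lemma det_kernelEval_complement {a b : ℕ} (N : Matrix (Fin b) (Fin b) ℂ) {z : ι → ℂ}
    (hz : Function.Injective z) (e f : Fin a ⊕ Fin b ≃ ι) :
    ((Equiv.Perm.sign (e.symm.trans f) : ℤ) : ℂ) *
      (Matrix.of fun i j => (nodeProd z (e (.inr i)))⁻¹ *
        kernelEval N (z (e (.inr i))) (z (f (.inr j))) * (nodeProd z (f (.inr j)))⁻¹).det /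
      ((Matrix.vandermonde (z ∘ e ∘ Sum.inl)).det * (Matrix.vandermonde (z ∘ f ∘ Sum.inl)).det) *
      ((-1) ^ (a + b).choose 2 * ∏ c, nodeProd z c) = N.det := by
  rw [of_kernelEval_submatrix_det]
  have hvne : ∀ {n : ℕ} (g : Fin n → ι), Function.Injective g →
      (Matrix.vandermonde (z ∘ g)).det ≠ 0 := fun g hg =>
    Matrix.det_vandermonde_ne_zero_iff.2 (hz.comp hg)
  have hP : ∀ g : Fin a ⊕ Fin b ≃ ι, ∏ j, nodeProd z (g (.inr j)) ≠ 0 := fun g =>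
    prod_ne_zero_iff.2 fun _ _ => nodeProd_ne_zero hz _
  have h1 : ∀ g : Fin a ⊕ Fin b ≃ ι,
      (∏ j, nodeProd z (g (.inr j))) * (Matrix.vandermonde (z ∘ g ∘ Sum.inl)).det =
      (-1) ^ (a * b + b.choose 2) * (Matrix.vandermonde (z ∘ finSumFinEquiv.symm.trans g)).det *
        (Matrix.vandermonde (z ∘ g ∘ Sum.inr)).det := by
    intro g
    have := prod_nodeProd_inr (z ∘ g)
    simp only [nodeProd_comp_equiv] at this
    exact this
  have hsq := vandermonde_det_sq (finSumFinEquiv.symm.trans e) z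
  -- The orderings of the nodes by `e` and by `f` differ by a conjugate of `e.symm.trans f`. Its
  -- sign cancels the explicit sign of the minor.
  have hperm : (Matrix.vandermonde (z ∘ finSumFinEquiv.symm.trans f)).det =
      ((Equiv.Perm.sign (e.symm.trans f) : ℤ) : ℂ) *
        (Matrix.vandermonde (z ∘ finSumFinEquiv.symm.trans e)).det := by
    have hs : Equiv.Perm.sign (e.symm.trans f) = Equiv.Perm.sign
        ((finSumFinEquiv.symm.trans e).trans ((e.symm.trans f).trans
          (finSumFinEquiv.symm.trans e).symm)) := by
      rw [← Equiv.trans_assoc, Equiv.Perm.sign_trans_trans_symm]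
    rw [hs, ← vandermonde_det_comp_perm]
    congr 2
    ext i
    simp
  have he := h1 e
  have hf := h1 f
  have hie : Function.Injective (e ∘ Sum.inl) := e.injective.comp Sum.inl_injective
  have hif : Function.Injective (f ∘ Sum.inl) := f.injective.comp Sum.inl_injective
  have hs1 : (((Equiv.Perm.sign (e.symm.trans f) : ℤ) : ℂ)) ^ 2 = 1 := by
    rcases Int.units_eq_one_or (Equiv.Perm.sign (e.symm.trans f)) with h | h <;> simp [h]
  have hs2 : ((-1 : ℂ) ^ (a * b + b.choose 2)) ^ 2 = 1 := by
    rw [← pow_mul, mul_comm, pow_mul]; simp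
  rw [hperm] at hf
  rw [← hsq, prod_inv_distrib, prod_inv_distrib]
  have v1 : (Matrix.vandermonde fun i => z (e (.inr i))) =
      Matrix.vandermonde (z ∘ e ∘ Sum.inr) := rfl
  have v2 : (Matrix.vandermonde fun i => z (f (.inr i))) =
      Matrix.vandermonde (z ∘ f ∘ Sum.inr) := rfl
  rw [v1, v2]
  have n1 := hvne _ hie
  have n2 := hvne _ hif
  have n3 := hP e
  have n4 := hP f
  generalize (Equiv.Perm.sign (e.symm.trans f) : ℤ) = s at *
  generalize (∏ j, nodeProd z (e (.inr j))) = Pe at *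
  generalize (∏ j, nodeProd z (f (.inr j))) = Pf at *
  generalize (Matrix.vandermonde (z ∘ e ∘ Sum.inl)).det = Re at *
  generalize (Matrix.vandermonde (z ∘ f ∘ Sum.inl)).det = Rf at *
  generalize (Matrix.vandermonde (z ∘ e ∘ Sum.inr)).det = Ae at *
  generalize (Matrix.vandermonde (z ∘ f ∘ Sum.inr)).det = Af at *
  generalize (Matrix.vandermonde (z ∘ finSumFinEquiv.symm.trans e)).det = E at *
  generalize (-1 : ℂ) ^ (a * b + b.choose 2) = κ at *
  have : (Pe * Re) * (Pf * Rf) = (s : ℂ) * E ^ 2 * Ae * Af := by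
    rw [he, hf]
    linear_combination ((s : ℂ) * E ^ 2 * Ae * Af) * hs2
  field_simp
  linear_combination -N.det * this

end Interpolation
end

/-! ### Berezin integrals of products of linear forms -/

noncomputable section

namespace Grassmann

open Finset

variable {ι κ : Type}

/-- The product of the odd elements given by a list of vectors. -/
def wedge (l : List (ι → ℂ)) : Grassmann ι := (l.map (ExteriorAlgebra.ι ℂ)).prod

@[simp] lemma wedge_nil : wedge ([] : List (ι → ℂ)) = 1 := rfl

@[simp] lemma wedge_cons (v : ι → ℂ) (l : List (ι → ℂ)) :
    wedge (v :: l) = ExteriorAlgebra.ι ℂ v * wedge l := by simp [wedge]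

@[simp] lemma wedge_append (l l' : List (ι → ℂ)) : wedge (l ++ l') = wedge l * wedge l' := by
  simp [wedge]

lemma berezin_ι_mul (i : ι) (v : ι → ℂ) (Z : Grassmann ι) :
    berezin i (ExteriorAlgebra.ι ℂ v * Z) = v i • Z - ExteriorAlgebra.ι ℂ v * berezin i Z :=
  CliffordAlgebra.contractLeft_ι_mul _ _ _

@[simp] lemma berezin_one (i : ι) : berezin i (1 : Grassmann ι) = 0 :=
  CliffordAlgebra.contractLeft_one _ _

lemma berezin_wedge_mul {i : ι} {l : List (ι → ℂ)} (h : ∀ v ∈ l, v i = 0) (Z : Grassmann ι) :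
    berezin i (wedge l * Z) = (-1 : ℂ) ^ l.length • (wedge l * berezin i Z) := by
  induction l with
  | nil => simp
  | cons v l ih =>
    rw [wedge_cons, mul_assoc, berezin_ι_mul, h v (by simp), zero_smul, zero_sub,
      ih fun w hw => h w (by simp [hw]), List.length_cons, pow_succ, mul_smul_comm, mul_neg_one,
      neg_smul, mul_assoc]

lemma berezin_wedge {i : ι} {l : List (ι → ℂ)} (h : ∀ v ∈ l, v i = 0) :
    berezin i (wedge l) = 0 := by
  have := berezin_wedge_mul h 1
  simpa using this

lemma ι_mul_ι_comm (u v : ι → ℂ) : ExteriorAlgebra.ι ℂ u * ExteriorAlgebra.ι ℂ v =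
    -(ExteriorAlgebra.ι ℂ v * ExteriorAlgebra.ι ℂ u) :=
  eq_neg_of_add_eq_zero_left (ExteriorAlgebra.ι_add_mul_swap u v)

lemma wedge_mul_ι (l : List (ι → ℂ)) (u : ι → ℂ) :
    wedge l * ExteriorAlgebra.ι ℂ u =
      (-1 : ℂ) ^ l.length • (ExteriorAlgebra.ι ℂ u * wedge l) := by
  induction l with
  | nil => simp
  | cons v l ih =>
    rw [wedge_cons, mul_assoc, ih, mul_smul_comm, ← mul_assoc, ι_mul_ι_comm v u, List.length_cons,
      pow_succ, mul_neg_one, neg_smul, neg_mul, smul_neg, mul_assoc]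

lemma wedge_mul_ι_of_mem {l : List (ι → ℂ)} {u : ι → ℂ} (hu : u ∈ l) :
    wedge l * ExteriorAlgebra.ι ℂ u = 0 := by
  induction l with
  | nil => simp at hu
  | cons v l ih =>
    rcases List.mem_cons.1 hu with rfl | h
    · rw [wedge_cons, mul_assoc, wedge_mul_ι, mul_smul_comm, ← mul_assoc,
        ExteriorAlgebra.ι_sq_zero, zero_mul, smul_zero]
    · rw [wedge_cons, mul_assoc, ih h, mul_zero]

lemma wedge_mul_ι_of_mem_span {l : List (ι → ℂ)} {u : ι → ℂ}
    (hu : u ∈ Submodule.span ℂ {v | v ∈ l}) : wedge l * ExteriorAlgebra.ι ℂ u = 0 := by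
  induction hu using Submodule.span_induction with
  | mem v hv => exact wedge_mul_ι_of_mem hv
  | zero => simp
  | add a b _ _ ha hb => rw [map_add, mul_add, ha, hb, add_zero]
  | smul c a _ ha => rw [map_smul, mul_smul_comm, ha, smul_zero]

/-- Modulo the factors of `wedge l`, other vectors may be shifted by elements of their span. -/
lemma wedge_mul_wedge_map_congr {l : List (ι → ℂ)} {L : List κ} {f g : κ → ι → ℂ}
    (h : ∀ q ∈ L, f q - g q ∈ Submodule.span ℂ {v | v ∈ l}) :
    wedge l * wedge (L.map f) = wedge l * wedge (L.map g) := by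
  induction L with
  | nil => rfl
  | cons q L ih =>
    have hq : wedge l * ExteriorAlgebra.ι ℂ (f q) = wedge l * ExteriorAlgebra.ι ℂ (g q) := by
      rw [← sub_eq_zero, ← mul_sub, ← map_sub]
      exact wedge_mul_ι_of_mem_span (h q (by simp))
    rw [List.map_cons, List.map_cons, wedge_cons, wedge_cons, ← mul_assoc, hq, wedge_mul_ι,
      smul_mul_assoc, mul_assoc, ih fun q hq => h q (by simp [hq]), ← mul_assoc,
      ← smul_mul_assoc, ← wedge_mul_ι, mul_assoc]

lemma berezin_wedge_ofFn_mul {i : ι} {Y : Grassmann ι} (hY : berezin i Y = 0) :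
    ∀ {m : ℕ} (v : Fin (m + 1) → ι → ℂ), berezin i (wedge (List.ofFn v) * Y) =
      ∑ j : Fin (m + 1), ((-1 : ℂ) ^ (j : ℕ) * v j i) •
        (wedge (List.ofFn fun a => v (j.succAbove a)) * Y)
  | 0, v => by
    simp [List.ofFn_succ, berezin_ι_mul, hY]
  | m + 1, v => by
    rw [List.ofFn_succ, wedge_cons, mul_assoc, berezin_ι_mul,
      berezin_wedge_ofFn_mul hY (fun a => v a.succ), Fin.sum_univ_succ (n := m + 1), mul_sum, sub_eq_add_neg,
      ← sum_neg_distrib]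
    congr 1
    · simp
    · refine sum_congr rfl fun j _ => ?_
      rw [List.ofFn_succ (f := fun a => v (j.succ.succAbove a)), wedge_cons, mul_assoc,
        mul_smul_comm, ← neg_smul]
      simp [pow_succ]

lemma berezinList_append (l l' : List ι) (Z : Grassmann ι) :
    berezinList (l ++ l') Z = berezinList l (berezinList l' Z) := by
  simp [berezinList]

@[simp] lemma berezinList_nil (Z : Grassmann ι) : berezinList [] Z = Z := rfl

@[simp] lemma berezinList_cons (i : ι) (l : List ι) (Z : Grassmann ι) :
    berezinList (i :: l) Z = berezin i (berezinList l Z) := rfl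

/-- Iterated Berezin integration as a linear map. -/
def berezinListₗ (l : List ι) : Grassmann ι →ₗ[ℂ] Grassmann ι :=
  l.foldr (fun i T => berezin i ∘ₗ T) LinearMap.id

lemma berezinListₗ_apply (l : List ι) (Z : Grassmann ι) : berezinListₗ l Z = berezinList l Z := by
  induction l with
  | nil => rfl
  | cons i l ih => rw [berezinList_cons, ← ih]; rfl

/-- Integrating the last variable first is the Laplace expansion along the last column. The left
derivative gives the `j`-th factor the sign `(-1) ^ j` instead of `(-1) ^ (j + m)`; the
discrepancies `(-1) ^ m` accumulate to `(-1) ^ m.choose 2`. -/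
lemma berezinList_wedge_ofFn_mul {Y : Grassmann ι} :
    ∀ {m : ℕ} (idx : Fin m → ι) (_ : ∀ j, berezin (idx j) Y = 0) (v : Fin m → ι → ℂ),
      berezinList (List.ofFn idx) (wedge (List.ofFn v) * Y) =
        ((-1) ^ m.choose 2 * (Matrix.of fun a b => v a (idx b)).det) • Y
  | 0, _, _, _ => by simp
  | m + 1, idx, hY, v => by
    rw [List.ofFn_succ', List.concat_eq_append, berezinList_append, berezinList_cons,
      berezinList_nil, berezin_wedge_ofFn_mul (hY _), ← berezinListₗ_apply, map_sum,
      Matrix.det_succ_column _ (Fin.last m), mul_sum, sum_smul]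
    refine sum_congr rfl fun j _ => ?_
    rw [map_smul, berezinListₗ_apply, berezinList_wedge_ofFn_mul (fun a => idx a.castSucc)
      (fun a => hY _), smul_smul]
    congr 1
    have : (Matrix.of fun a b => v (j.succAbove a) (idx b.castSucc)) =
        (Matrix.of fun a b => v a (idx b)).submatrix j.succAbove (Fin.last m).succAbove := by
      ext a b; simp
    rw [this, Nat.choose_succ_succ', Nat.choose_one_right, Matrix.of_apply, Fin.val_last, pow_add,
      pow_add]
    have h1 : ((-1 : ℂ) ^ m) * (-1) ^ m = 1 := by rw [← mul_pow]; simp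
    linear_combination (-(-1) ^ (j : ℕ) * v j (idx (Fin.last m)) * (-1) ^ m.choose 2 *
      ((Matrix.of fun a b => v a (idx b)).submatrix j.succAbove (Fin.last m).succAbove).det) * h1

/-- Factors and variables are enumerated by the same list, so the determinant does not depend on the
enumeration. -/
lemma berezinList_map_wedge_map_mul [Fintype κ] [DecidableEq κ] {l : List κ} (hl : l.Nodup)
    (hm : ∀ a, a ∈ l) (idx : κ → ι) {Y : Grassmann ι} (hY : ∀ a, berezin (idx a) Y = 0)
    (v : κ → ι → ℂ) : berezinList (l.map idx) (wedge (l.map v) * Y) =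
      ((-1) ^ (Fintype.card κ).choose 2 * (Matrix.of fun a b => v a (idx b)).det) • Y := by
  have hmap : ∀ {β : Type} (g : κ → β), l.map g = List.ofFn fun a => g (l.get a) := by
    intro β g
    conv_lhs => rw [← List.ofFn_get l]
    rw [List.map_ofFn]
    rfl
  have hlen : l.length = Fintype.card κ := by
    rw [← Fintype.card_fin l.length]
    exact Fintype.card_congr (hl.getEquivOfForallMemList l hm)
  have hchoose : l.length.choose 2 = (Fintype.card κ).choose 2 := by rw [hlen]
  rw [hmap, hmap, berezinList_wedge_ofFn_mul _ fun j => hY _, hchoose]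
  congr 2
  rw [← Matrix.det_submatrix_equiv_self (hl.getEquivOfForallMemList l hm)]
  rfl

lemma fermionicDelta_ι {N : ℕ} (v : Fin N → ι → ℂ) :
    fermionicDelta (fun A => ExteriorAlgebra.ι ℂ (v A)) = wedge ((List.finRange N).map v) := by
  rw [fermionicDelta, wedge, List.map_map, ← List.ofFn_eq_map]
  rfl

lemma prod_fermionicDelta_ι {k N : ℕ} (v : Fin k → Fin N → ι → ℂ) :
    (List.ofFn fun i => fermionicDelta fun A => ExteriorAlgebra.ι ℂ (v i A)).prod =
      wedge ((List.finRange k ×ˢ List.finRange N).map fun x => v x.1 x.2) := by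
  simp only [fermionicDelta_ι]
  rw [List.ofFn_eq_map]
  induction List.finRange k with
  | nil => simp
  | cons i l ih =>
    rw [List.map_cons, List.prod_cons, ih, List.product_cons, List.map_append, wedge_append,
      List.map_map]
    rfl

lemma gen_eq [DecidableEq ι] (i : ι) : gen i = ExteriorAlgebra.ι ℂ (Pi.single i 1 : ι → ℂ) := rfl

lemma restrict_ι (f : κ → ι) (v : ι → ℂ) :
    restrict f (ExteriorAlgebra.ι ℂ v) = ExteriorAlgebra.ι ℂ (v ∘ f) := by
  rw [restrict, ExteriorAlgebra.map_apply_ι]; rfl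

lemma restrict_wedge (f : κ → ι) (l : List (ι → ℂ)) :
    restrict f (wedge l) = wedge (l.map (· ∘ f)) := by
  induction l with
  | nil => simp
  | cons v l ih => rw [wedge_cons, map_mul, ih, restrict_ι, List.map_cons, wedge_cons]

end Grassmann

/-! ### The fermionic delta functions of the two formulae -/

section Fermions

open Grassmann Finset

variable {d d' : ℕ}

lemma mem_finRange_product {k N : ℕ} (x : Fin k × Fin N) :
    x ∈ List.finRange k ×ˢ List.finRange N :=
  List.pair_mem_product.2 ⟨List.mem_finRange _, List.mem_finRange _⟩

lemma nodup_finRange_product (k N : ℕ) : (List.finRange k ×ˢ List.finRange N).Nodup :=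
  (List.nodup_finRange k).product (List.nodup_finRange N)

/-- The vector of `η_p^A - χ^A(σ_p)`. -/
def ambVec (N : ℕ) (x : AmbVar d d' → ℂ) (p : Fin (d' + 1)) (A : Fin N) :
    Particle d d' × Fin N → ℂ :=
  Pi.single (Sum.inr p, A) 1 - ∑ i : Fin (d + 1),
    (br (Amb.pt x (.inr p)) (Amb.pt x (.inl i)))⁻¹ • Pi.single (Sum.inl i, A) 1

lemma ambFermions_eq (N : ℕ) (x : AmbVar d d' → ℂ) :
    Amb.fermions N x =
      wedge ((List.finRange (d' + 1) ×ˢ List.finRange N).map fun q => ambVec N x q.1 q.2) := by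
  rw [← prod_fermionicDelta_ι]
  unfold Amb.fermions
  simp only [gen_eq, ambVec, map_sub, map_sum, map_smul]

/-- On the support of the delta functions of the particles `i`, the values `t_i χ(σ_i)` equal `η_i`,
so interpolation turns `t_p χ(σ_p)` into `∑_i η_i / (p i)`. The delta functions of the particles `p`
are then free of `χ`, and the `χ`-integral of the others is the determinant of minus the matrix of
the `t_i C_r(σ_i)`, once for each of the eight components. -/
lemma csFermions_eq {x : CSVar d d' → ℂ} {y : AmbVar d d' → ℂ}
    (h : ∀ (p : Fin (d' + 1)) (r : Fin (d + 1)), CS.t x (.inr p) * CS.C r (CS.pt x (.inr p)) =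
      ∑ i : Fin (d + 1), (br (Amb.pt y (.inr p)) (Amb.pt y (.inl i)))⁻¹ *
        (CS.t x (.inl i) * CS.C r (CS.pt x (.inl i)))) :
    CS.fermions x = (Matrix.of fun i r : Fin (d + 1) =>
      CS.t x (.inl i) * CS.C r (CS.pt x (.inl i))).det ^ 8 • Amb.fermions 8 y := by
  set ι' := (Particle d d' × Fin 8) ⊕ (Fin (d + 1) × Fin 8)
  let w : Particle d d' → Fin 8 → ι' → ℂ := fun a A =>
    Pi.single (Sum.inl (a, A)) 1 -
      CS.t x a • ∑ r, CS.C r (CS.pt x a) • Pi.single (Sum.inr (r, A)) 1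
  let u : Fin (d' + 1) → Fin 8 → ι' → ℂ := fun p A =>
    Pi.single (Sum.inl (Sum.inr p, A)) 1 - ∑ i : Fin (d + 1),
      (br (Amb.pt y (.inr p)) (Amb.pt y (.inl i)))⁻¹ • Pi.single (Sum.inl (Sum.inl i, A)) 1
  have hdelta : ∀ a, CS.fermions.delta x a =
      fermionicDelta fun A => ExteriorAlgebra.ι ℂ (w a A) := by
    intro a
    simp only [CS.fermions.delta, gen_eq, w, map_sub, map_sum, map_smul]
  simp only [CS.fermions, hdelta]
  rw [prod_fermionicDelta_ι (fun i => w (.inl i)), prod_fermionicDelta_ι (fun p => w (.inr p))]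
  -- The arguments of the delta functions at `p` before and after the replacement differ by a
  -- combination of those at the `i`, which are factors to the left.
  have hshift := wedge_mul_wedge_map_congr
    (l := (List.finRange (d + 1) ×ˢ List.finRange 8).map fun q => w (.inl q.1) q.2)
    (L := List.finRange (d' + 1) ×ˢ List.finRange 8)
    (f := fun q => w (.inr q.1) q.2) (g := fun q => u q.1 q.2) (by
      rintro ⟨p, A⟩ -
      have : w (.inr p) A - u p A = ∑ i : Fin (d + 1),
          (br (Amb.pt y (.inr p)) (Amb.pt y (.inl i)))⁻¹ • w (.inl i) A := by
        simp only [w, u, smul_sub, sum_sub_distrib, smul_sum, smul_smul]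
        rw [sum_comm, sub_sub_sub_cancel_left]
        congr 1
        refine sum_congr rfl fun r _ => ?_
        rw [h, sum_smul]
      rw [this]
      refine Submodule.sum_mem _ fun i _ => Submodule.smul_mem _ _ (Submodule.subset_span ?_)
      exact List.mem_map.2 ⟨(i, A), by simp, rfl⟩)
  have hu : ∀ a, berezin (Sum.inr a : ι') (wedge ((List.finRange (d' + 1) ×ˢ List.finRange 8).map
      fun q => u q.1 q.2)) = 0 := by
    intro a
    refine berezin_wedge fun v hv => ?_
    obtain ⟨q, -, rfl⟩ := List.mem_map.1 hv
    simp [u, Finset.sum_apply]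
  rw [hshift, berezinList_map_wedge_map_mul (nodup_finRange_product _ _) mem_finRange_product _ hu,
    map_smul, restrict_wedge, List.map_map, ambFermions_eq]
  congr 1
  · have hM : (Matrix.of fun a b : Fin (d + 1) × Fin 8 => w (.inl a.1) a.2 (Sum.inr b)) =
        Matrix.kronecker (-(Matrix.of fun i r : Fin (d + 1) =>
          CS.t x (.inl i) * CS.C r (CS.pt x (.inl i)))) (1 : Matrix (Fin 8) (Fin 8) ℂ) := by
      ext ⟨i, A⟩ ⟨r, B⟩
      simp only [w, Matrix.of_apply, Matrix.kronecker, Matrix.kroneckerMap_apply, Matrix.neg_apply,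
        Matrix.one_apply, Pi.sub_apply, Pi.smul_apply, Finset.sum_apply, smul_eq_mul]
      rw [sum_eq_single r]
      · by_cases hAB : A = B
        · subst hAB; simp
        · have : (Sum.inr (r, B) : ι') ≠ Sum.inr (r, A) := by simp [Ne.symm hAB]
          simp [hAB, Pi.single_eq_of_ne this]
      · intro s _ hs
        have : (Sum.inr (r, B) : ι') ≠ Sum.inr (s, A) := by simp [Ne.symm hs]
        simp [Pi.single_eq_of_ne this]
      · simp
    rw [hM, Matrix.kronecker, Matrix.det_kronecker, Matrix.det_neg, Matrix.det_one]
    -- The number of pairs among `8 (d + 1)` variables is `4 (d + 1) (8 (d + 1) - 1)`, so reversing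
    -- the order of integration costs no sign.
    have e1 : Even ((Fintype.card (Fin (d + 1) × Fin 8)).choose 2) := by
      rw [Fintype.card_prod, Fintype.card_fin, Fintype.card_fin, Nat.choose_two_right]
      refine ⟨2 * (d + 1) * ((d + 1) * 8 - 1), ?_⟩
      refine Nat.div_eq_of_eq_mul_left (by norm_num) (by ring)
    have e2 : ((-1 : ℂ) ^ Fintype.card (Fin (d + 1))) ^ 8 = 1 := by
      rw [← pow_mul, mul_comm, pow_mul]; norm_num
    rw [e1.neg_one_pow, one_mul, one_pow, mul_one, Fintype.card_fin 8, mul_pow, e2, one_mul]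
  · congr 2
    funext q
    simp only [Function.comp_apply, ambVec, u]
    ext ⟨a, A⟩
    simp [Pi.single_apply, Finset.sum_apply]

/-- The coefficients of the generators `η_p` form the identity matrix, so integrating over all of
them gives `±1`. Because of this, integrating out a component cannot annihilate individual terms of
the sum over solutions. -/
lemma ambFermions_seven_ne_zero (x : AmbVar d d' → ℂ) : Amb.fermions 7 x ≠ 0 := by
  intro h
  have h1 := berezinList_map_wedge_map_mul (nodup_finRange_product (d' + 1) 7)
    mem_finRange_product (fun q : Fin (d' + 1) × Fin 7 => ((Sum.inr q.1, q.2) : Particle d d' × Fin 7))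
    (Y := 1) (fun _ => berezin_one _) (fun q => ambVec 7 x q.1 q.2)
  have hM : (Matrix.of fun a b : Fin (d' + 1) × Fin 7 =>
      ambVec (d := d) 7 x a.1 a.2 (Sum.inr b.1, b.2)) = 1 := by
    ext ⟨p, A⟩ ⟨q, B⟩
    simp [ambVec, Finset.sum_apply, Pi.single_apply, Matrix.one_apply, eq_comm]
  rw [hM, mul_one, ← ambFermions_eq, h, ← berezinListₗ_apply, map_zero, Matrix.det_one, mul_one] at h1
  have h2 : (-1 : ℂ) ^ (Fintype.card (Fin (d' + 1) × Fin 7)).choose 2 ≠ 0 :=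
    pow_ne_zero _ (by norm_num)
  exact one_ne_zero ((smul_eq_zero.1 h1.symm).resolve_left h2)

/-- The passage from eight to seven supersymmetries as a linear map. -/
def reduceSusyₗ : Grassmann (Particle d d' × Fin 8) →ₗ[ℂ] Grassmann (Particle d d' × Fin 7) :=
  (Grassmann.restrict (Prod.map id Fin.succ)).toLinearMap ∘ₗ
    berezinListₗ ((List.finRange (d' + 1)).map fun p => (Sum.inr p, 0))

lemma reduceSusyₗ_apply (Z : Grassmann (Particle d d' × Fin 8)) :
    reduceSusyₗ Z = reduceSusy Z := by
  simp [reduceSusyₗ, reduceSusy, berezinListₗ_apply]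

/-- Passing an even number of odd factors costs no sign. It is applied to the block of eight factors
of a single particle. -/
lemma berezinList_wedge_mul_of_even {ι : Type} {L : List ι} {l : List (ι → ℂ)}
    (h : ∀ i ∈ L, ∀ v ∈ l, v i = 0) (he : Even l.length) (Z : Grassmann ι) :
    berezinList L (wedge l * Z) = wedge l * berezinList L Z := by
  induction L with
  | nil => rfl
  | cons i L ih =>
    rw [berezinList_cons, ih fun j hj => h j (by simp [hj]), berezin_wedge_mul (h i (by simp)),
      he.neg_one_pow, one_smul, berezinList_cons]

/-- Every particle `p` contributes an even block in which only the factor `A = 0` contains `η_p^0`,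
with coefficient `1` and in first position; its integral deletes this factor without a sign. The
generators `η_i^0` occur only in deleted factors, so setting them to zero has no further effect. -/
lemma reduceSusy_ambFermions (x : AmbVar d d' → ℂ) :
    reduceSusy (Amb.fermions 8 x) = Amb.fermions 7 x := by
  have hval : ∀ (p q : Fin (d' + 1)) (A B : Fin 8),
      ambVec (d := d) 8 x p A (Sum.inr q, B) = if p = q ∧ A = B then 1 else 0 := by
    intro p q A B
    simp [ambVec, Finset.sum_apply, Pi.single_apply, eq_comm]
  have key : ∀ l : List (Fin (d' + 1)), l.Nodup →
      berezinList (l.map fun p => ((Sum.inr p, 0) : Particle d d' × Fin 8))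
        (wedge ((l ×ˢ List.finRange 8).map fun q => ambVec 8 x q.1 q.2)) =
      wedge ((l ×ˢ List.finRange 7).map fun q => ambVec 8 x q.1 q.2.succ) := by
    intro l hl
    induction l with
    | nil => rfl
    | cons p l ih =>
      rw [List.nodup_cons] at hl
      rw [List.product_cons, List.product_cons, List.map_append, List.map_append, wedge_append,
        wedge_append, List.map_map, List.map_map, List.map_cons, berezinList_cons,
        berezinList_wedge_mul_of_even, ih hl.2]
      · rw [List.finRange_succ, List.map_cons, wedge_cons, mul_assoc, berezin_ι_mul, List.map_map,
          ← wedge_append, berezin_wedge]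
        · simp [hval, Function.comp_def]
        · intro v hv
          rcases List.mem_append.1 hv with hv | hv
          · obtain ⟨A, -, rfl⟩ := List.mem_map.1 hv
            simp [hval]
          · obtain ⟨q, -, rfl⟩ := List.mem_map.1 hv
            simp [hval]
      · intro i hi v hv
        obtain ⟨q, hq, rfl⟩ := List.mem_map.1 hi
        obtain ⟨A, -, rfl⟩ := List.mem_map.1 hv
        simp only [Function.comp_apply, hval]
        rw [if_neg]
        rintro ⟨rfl, -⟩
        exact hl.1 hq
      · rw [List.length_map, List.length_finRange]; decide
  rw [reduceSusy, ambFermions_eq, ambFermions_eq, key _ (List.nodup_finRange _), restrict_wedge,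
    List.map_map]
  congr 2
  funext q
  ext ⟨a, A⟩
  simp [ambVec, Finset.sum_apply, Pi.single_apply]

end Fermions
end

/-! ### The change of variables and the linear relation between the constraints -/

noncomputable section

open Finset in
/-- Lagrange interpolation of a polynomial of low degree. -/
lemma eval_eq_prod_mul_sum_nodeProd {ι : Type} [Fintype ι] [DecidableEq ι] {z : ι → ℂ}
    (hz : Function.Injective z) {w : ℂ} (hw : ∀ i, z i ≠ w) {f : Polynomial ℂ}
    (hf : f.natDegree < Fintype.card ι) :
    f.eval w = (∏ i, (z i - w)) * ∑ i, f.eval (z i) / (nodeProd z i * (z i - w)) := by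
  -- The point `w` is adjoined as an extra node, and the vanishing sum over all nodes is solved for
  -- its term.
  have hinj : Function.Injective (Sum.elim z fun _ : Unit => w) :=
    hz.sumElim (fun _ _ _ => rfl) fun i _ => hw i
  have h := sum_eval_div_nodeProd hinj (f := f) (by simpa using hf)
  have hp : ∏ i, (z i - w) ≠ 0 := prod_ne_zero_iff.2 fun i _ => sub_ne_zero.2 (hw i)
  have hr : nodeProd (Sum.elim z fun _ : Unit => w) (Sum.inr ()) = ∏ i, (z i - w) := by
    rw [nodeProd_inr]
    simp [nodeProd]
  rw [Fintype.sum_sum_type, Fintype.sum_unique (ι := Unit), PUnit.default_eq_unit, hr] at h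
  simp only [Sum.elim_inl, Sum.elim_inr, nodeProd_inl, univ_unique, prod_singleton,
    Sum.elim_comp_inl] at h
  rw [add_comm, add_eq_zero_iff_eq_neg, ← sum_neg_distrib, div_eq_iff hp, mul_comm] at h
  rw [h]
  congr 1
  refine sum_congr rfl fun i _ => ?_
  rw [← div_neg, ← mul_neg, neg_sub]

namespace CS

open Finset

variable {d d' : ℕ}

lemma br_pt (x : CSVar d d' → ℂ) (a b : Particle d d') :
    br (pt x a) (pt x b) = z x b - z x a := by
  simp [br, pt]

lemma C_pt (x : CSVar d d' → ℂ) (r : Fin (d + 1)) (a : Particle d d') :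
    C r (pt x a) = z x a ^ (d - r : ℕ) := by
  simp [C, pt]

/-- The homogeneous scale of the ambitwistor puncture that corresponds to a particle. -/
def scale (x : CSVar d d' → ℂ) : Particle d d' → ℂ
  | .inl i => t x (.inl i) * nodeProd (z x ∘ Sum.inl) i
  | .inr p => (t x (.inr p) * ∏ i : Fin (d + 1), (z x (.inl i) - z x (.inr p)))⁻¹

/-- The punctures `σ_a` of the ambitwistor formula in terms of the variables of the
Cachazo-Skinner formula. -/
def toAmb (x : CSVar d d' → ℂ) : AmbVar d d' → ℂ := fun v => scale x v.1 * pt x v.1 v.2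

lemma pt_toAmb (x : CSVar d d' → ℂ) (a : Particle d d') :
    Amb.pt (toAmb x) a = scale x a • pt x a := rfl

lemma br_toAmb (x : CSVar d d' → ℂ) (a b : Particle d d') :
    br (Amb.pt (toAmb x) a) (Amb.pt (toAmb x) b) = scale x a * scale x b * (z x b - z x a) := by
  rw [← br_pt, pt_toAmb, pt_toAmb]
  simp only [br, Pi.smul_apply, smul_eq_mul]
  ring

/-- The domain of integration. -/
def Dom (x : CSVar d d' → ℂ) : Prop := (∀ a b, a ≠ b → z x a ≠ z x b) ∧ ∀ a, t x a ≠ 0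


lemma Dom.injective {x : CSVar d d' → ℂ} (hx : Dom x) : Function.Injective (z x) := fun a b h =>
  by_contra fun hab => hx.1 a b hab h

lemma Dom.injective_inl {x : CSVar d d' → ℂ} (hx : Dom x) :
    Function.Injective (z x ∘ (Sum.inl : Fin (d + 1) → Particle d d')) :=
  hx.injective.comp Sum.inl_injective

lemma Dom.injective_inr {x : CSVar d d' → ℂ} (hx : Dom x) :
    Function.Injective (z x ∘ (Sum.inr : Fin (d' + 1) → Particle d d')) :=
  hx.injective.comp Sum.inr_injective

lemma Dom.sub_ne_zero {x : CSVar d d' → ℂ} (hx : Dom x) {a b : Particle d d'} (h : a ≠ b) :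
    z x a - z x b ≠ 0 := _root_.sub_ne_zero.2 (hx.1 a b h)

lemma Dom.prod_ne_zero {x : CSVar d d' → ℂ} (hx : Dom x) (p : Fin (d' + 1)) :
    ∏ i : Fin (d + 1), (z x (.inl i) - z x (.inr p)) ≠ 0 :=
  prod_ne_zero_iff.2 fun _ _ => hx.sub_ne_zero (by simp)

lemma Dom.scale_ne_zero {x : CSVar d d' → ℂ} (hx : Dom x) (a : Particle d d') :
    scale x a ≠ 0 := by
  rcases a with i | p
  · exact mul_ne_zero (hx.2 _) (nodeProd_ne_zero hx.injective_inl i)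
  · exact inv_ne_zero (mul_ne_zero (hx.2 _) (hx.prod_ne_zero p))

lemma Dom.br_toAmb_ne_zero {x : CSVar d d' → ℂ} (hx : Dom x) {a b : Particle d d'} (h : a ≠ b) :
    br (Amb.pt (toAmb x) a) (Amb.pt (toAmb x) b) ≠ 0 := by
  rw [br_toAmb]
  exact mul_ne_zero (mul_ne_zero (hx.scale_ne_zero a) (hx.scale_ne_zero b))
    (hx.sub_ne_zero h.symm)

/-- The coefficient `1 / (p i)` of the ambitwistor map. -/
def invBr (x : CSVar d d' → ℂ) (p : Fin (d' + 1)) (i : Fin (d + 1)) : ℂ :=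
  (br (Amb.pt (toAmb x) (.inr p)) (Amb.pt (toAmb x) (.inl i)))⁻¹

/-- The definition of `scale` is made for this identity: `t_p / (t_i (p i)⁻¹)` is the inverse of the
Lagrange basis value at `z_p`, so that the `(p i)⁻¹` are the interpolation weights for the rescaled
values `t_a f(z_a)`. The `d + 1` points `z_i` suffice in degree at most `d`. -/
lemma Dom.interpolate {x : CSVar d d' → ℂ} (hx : Dom x) (p : Fin (d' + 1)) {f : Polynomial ℂ}
    (hf : f.natDegree ≤ d) : t x (.inr p) * f.eval (z x (.inr p)) =
      ∑ i : Fin (d + 1), invBr x p i * (t x (.inl i) * f.eval (z x (.inl i))) := by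
  rw [eval_eq_prod_mul_sum_nodeProd hx.injective_inl (w := z x (.inr p))
    (fun i => hx.1 _ _ (by simp)) (by rw [Fintype.card_fin]; omega), mul_sum, mul_sum]
  refine sum_congr rfl fun i _ => ?_
  have h1 := hx.prod_ne_zero p
  have h2 := hx.2 (.inr p)
  have h3 := hx.2 (.inl i)
  have h4 := nodeProd_ne_zero hx.injective_inl i
  have h5 := hx.sub_ne_zero (a := .inl i) (b := .inr p) (by simp)
  rw [invBr, br_toAmb]
  simp only [scale, Function.comp_apply]
  field_simp

lemma Dom.interpolate_C {x : CSVar d d' → ℂ} (hx : Dom x) (p : Fin (d' + 1)) (r : Fin (d + 1)) :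
    t x (.inr p) * C r (pt x (.inr p)) =
      ∑ i : Fin (d + 1), invBr x p i * (t x (.inl i) * C r (pt x (.inl i))) := by
  have := hx.interpolate p (f := Polynomial.X ^ (d - r : ℕ))
    (by rw [Polynomial.natDegree_X_pow]; omega)
  simpa [C_pt] using this

lemma Dom.interpolate_lamMap {x : CSVar d d' → ℂ} (hx : Dom x) (p : Fin (d' + 1)) (α : Fin 2) :
    t x (.inr p) * lamMap x (pt x (.inr p)) α =
      ∑ i : Fin (d + 1), invBr x p i * (t x (.inl i) * lamMap x (pt x (.inl i)) α) := by
  simp only [lamMap, mul_sum]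
  rw [sum_comm]
  refine sum_congr rfl fun r _ => ?_
  have := congrArg (fun y => rho x r α * y) (hx.interpolate_C p r)
  simp only [mul_sum] at this
  rw [← mul_assoc, mul_comm (t x _), mul_assoc, this]
  exact sum_congr rfl fun i _ => by ring

/-- The constraints on the map at the points `σ_i`, followed by the ambitwistor constraints. -/
def extConstraint (K : Kinematics d d') (x : CSVar d d' → ℂ) : CSVar d d' → ℂ
  | .inl (i, α) => K.lam (.inl i) α - t x (.inl i) * lamMap x (pt x (.inl i)) α
  | .inr v => Amb.constraint K (toAmb x) v

/-- The values `t_i C_r(σ_i)` of the basis polynomials. -/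
def basisMatrix (x : CSVar d d' → ℂ) : Matrix (Fin (d + 1)) (Fin (d + 1)) ℂ :=
  Matrix.of fun i r => t x (.inl i) * C r (pt x (.inl i))

/-- The linear relation between the two sets of constraints, for one spinor component. -/
def relationCore (x : CSVar d d' → ℂ) :
    Matrix (Fin (d + 1) ⊕ Particle d d') (Fin (d + 1) ⊕ Particle d d') ℂ :=
  Matrix.fromBlocks 0 (Matrix.fromCols (basisMatrix x)ᵀ 0)
    (Matrix.fromRows 1 (Matrix.of (invBr x))) (Matrix.fromBlocks 0 0 0 1)

/-- The spinor index as a separate factor. -/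
def spinEquiv : CSVar d d' ≃ (Fin (d + 1) ⊕ Particle d d') × Fin 2 :=
  (Equiv.sumProdDistrib _ _ _).symm

/-- The linear relation between the two sets of constraints. -/
def relation (x : CSVar d d' → ℂ) : Matrix (CSVar d d') (CSVar d d') ℂ :=
  (Matrix.kroneckerMap (· * ·) (relationCore x) (1 : Matrix (Fin 2) (Fin 2) ℂ)).submatrix
    spinEquiv spinEquiv

lemma relation_mulVec (x y : CSVar d d' → ℂ) (v : CSVar d d') :
    (relation x *ᵥ y) v =
      ∑ l, relationCore x (spinEquiv v).1 l * y (spinEquiv.symm (l, (spinEquiv v).2)) := by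
  simp only [Matrix.mulVec, dotProduct, relation, Matrix.submatrix_apply,
    Matrix.kroneckerMap_apply]
  rw [← spinEquiv.symm.sum_comp, Fintype.sum_prod_type]
  refine sum_congr rfl fun l _ => ?_
  have e : ∀ β, spinEquiv (d := d) (d' := d') (spinEquiv.symm (l, β)) = (l, β) := fun β =>
    Equiv.apply_symm_apply _ _
  rw [sum_eq_single (spinEquiv v).2]
  · erw [e]
    rw [Matrix.one_apply_eq, mul_one]
  · intro β _ hβ
    erw [e]
    simp [Matrix.one_apply_ne hβ.symm]
  · simp

lemma vecMul_relation (x y : CSVar d d' → ℂ) (v : CSVar d d') :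
    (y ᵥ* relation x) v =
      ∑ l, y (spinEquiv.symm (l, (spinEquiv v).2)) * relationCore x l (spinEquiv v).1 := by
  simp only [Matrix.vecMul, dotProduct, relation, Matrix.submatrix_apply,
    Matrix.kroneckerMap_apply]
  rw [← spinEquiv.symm.sum_comp, Fintype.sum_prod_type]
  refine sum_congr rfl fun l _ => ?_
  have e : ∀ β, spinEquiv (d := d) (d' := d') (spinEquiv.symm (l, β)) = (l, β) := fun β =>
    Equiv.apply_symm_apply _ _
  rw [sum_eq_single (spinEquiv v).2]
  · erw [e]
    rw [Matrix.one_apply_eq, mul_one]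
  · intro β _ hβ
    erw [e]
    simp [Matrix.one_apply_ne hβ]
  · simp

lemma phase_single (K : Kinematics d d') (x : CSVar d d' → ℂ) (r : Fin (d + 1)) (α : Fin 2) :
    phase K x (Pi.single r (Pi.single α 1)) = ∑ a, t x a * C r (pt x a) * K.lamt a α := by
  unfold phase
  refine sum_congr rfl fun a _ => ?_
  rw [mul_assoc]
  congr 1
  rw [sum_eq_single α, sum_eq_single r]
  · simp
  · intro b _ hb; simp [Pi.single_eq_of_ne hb]
  · simp
  · intro b _ hb
    rw [sum_eq_zero, zero_mul]
    intro s _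
    by_cases h : s = r
    · subst h; simp [Pi.single_eq_of_ne hb]
    · simp [Pi.single_eq_of_ne h]
  · simp

lemma br_anti (s u : Fin 2 → ℂ) : br s u = -br u s := by simp only [br]; ring

lemma lamtMap_toAmb (K : Kinematics d d') (x : CSVar d d' → ℂ) (i : Fin (d + 1)) (α : Fin 2) :
    Amb.lamtMap K (toAmb x) (Amb.pt (toAmb x) (.inl i)) α =
      -∑ p : Fin (d' + 1), invBr x p i * K.lamt (.inr p) α := by
  rw [Amb.lamtMap, ← sum_neg_distrib]
  refine sum_congr rfl fun p _ => ?_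
  rw [br_anti, invBr, div_neg, div_eq_mul_inv, mul_comm]

lemma lamMap_toAmb (K : Kinematics d d') (x : CSVar d d' → ℂ) (p : Fin (d' + 1)) (α : Fin 2) :
    Amb.lamMap K (toAmb x) (Amb.pt (toAmb x) (.inr p)) α =
      ∑ i : Fin (d + 1), invBr x p i * K.lam (.inl i) α := by
  rw [Amb.lamMap]
  refine sum_congr rfl fun i _ => ?_
  rw [invBr, div_eq_mul_inv, mul_comm]

/-- The constraints of the two formulae are related by an invertible linear map. -/
lemma Dom.constraint_eq {x : CSVar d d' → ℂ} (hx : Dom x) (K : Kinematics d d') :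
    constraint K x = relation x *ᵥ extConstraint K x := by
  funext v
  rw [relation_mulVec]
  rcases v with ⟨r, α⟩ | ⟨i | p, α⟩
  · simp only [spinEquiv, relationCore, constraint, phase_single, Fintype.sum_sum_type]
    simp only [Equiv.symm_symm, Equiv.sumProdDistrib_symm_apply_left, Equiv.sumProdDistrib_apply_left,
      Equiv.sumProdDistrib_apply_right,
      Matrix.fromBlocks_apply₁₁, Matrix.fromBlocks_apply₁₂, Matrix.fromCols_apply_inl,
      Matrix.fromCols_apply_inr, Matrix.transpose_apply, basisMatrix, Matrix.of_apply,
      Matrix.zero_apply, zero_mul, sum_const_zero, zero_add, add_zero, extConstraint,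
      Amb.constraint, lamtMap_toAmb, sub_neg_eq_add, mul_add, sum_add_distrib]
    congr 1
    -- Interpolating `t_p C_r(σ_p)` from the points `σ_i` turns the sum over all particles into one
    -- over the `i`, with coefficients `λ̃_i - λ̃(σ_i)`.
    simp only [hx.interpolate_C, mul_sum, sum_mul]
    rw [sum_comm]
    exact sum_congr rfl fun i _ => sum_congr rfl fun p _ => by ring
  · simp only [spinEquiv, relationCore, constraint, Fintype.sum_sum_type]
    simp [extConstraint, Matrix.one_apply]
  · simp only [spinEquiv, relationCore, constraint, Fintype.sum_sum_type]
    simp only [Equiv.symm_symm, Equiv.sumProdDistrib_symm_apply_right,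
      Equiv.sumProdDistrib_apply_left, Equiv.sumProdDistrib_apply_right,
      Matrix.fromBlocks_apply₂₁, Matrix.fromBlocks_apply₂₂, Matrix.fromRows_apply_inr,
      Matrix.of_apply, Matrix.one_apply, ite_mul, one_mul, sum_ite_eq, mem_univ, if_true,
      Matrix.zero_apply, zero_mul, sum_const_zero, zero_add, add_zero, extConstraint,
      Amb.constraint, lamMap_toAmb, mul_sub, sum_sub_distrib, hx.interpolate_lamMap]
    ring

/-- Exchanging the two blocks of `d + 1` rows makes the core block triangular. The sign of the
exchange is squared away by the two spinor components. -/
lemma relation_det (x : CSVar d d' → ℂ) : (relation x).det = (basisMatrix x).det ^ 2 := by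
  rw [relation, Matrix.det_submatrix_equiv_self, Matrix.det_kronecker, Matrix.det_one, one_pow,
    mul_one, Fintype.card_fin]
  let σ : Equiv.Perm (Fin (d + 1) ⊕ Particle d d') :=
    ((Equiv.sumAssoc _ _ _).symm.trans ((Equiv.sumComm _ _).sumCongr (Equiv.refl _))).trans
      (Equiv.sumAssoc _ _ _)
  have h : (relationCore x).submatrix σ id = Matrix.fromBlocks 1 0
      (Matrix.fromRows 0 (Matrix.of (invBr x))) (Matrix.fromBlocks (basisMatrix x)ᵀ 0 0 1) := by
    ext a b
    rcases a with i | i | p <;> rcases b with j | j | q <;> rfl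
  have h2 := congrArg Matrix.det h
  rw [Matrix.det_permute, Matrix.det_fromBlocks_zero₁₂, Matrix.det_one, one_mul,
    Matrix.det_fromBlocks_zero₁₂, Matrix.det_one, mul_one, Matrix.det_transpose] at h2
  rw [← h2, mul_pow]
  rcases Int.units_eq_one_or (Equiv.Perm.sign σ) with hs | hs <;> simp [hs]

/-- The determinant of the values of the basis polynomials is a Vandermonde determinant. -/
lemma basisMatrix_det_sq (x : CSVar d d' → ℂ) : (basisMatrix x).det ^ 2 =
    ((∏ i : Fin (d + 1), t x (.inl i)) *
      (Matrix.vandermonde (z x ∘ (Sum.inl : Fin (d + 1) → Particle d d'))).det) ^ 2 := by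
  -- At `(1, z)` the polynomial `C_r` is `z ^ (d - r)`, so the columns of the Vandermonde matrix
  -- appear in reverse order.
  have h : basisMatrix x = Matrix.of fun i r => t x (.inl i) *
      (Matrix.vandermonde (z x ∘ (Sum.inl : Fin (d + 1) → Particle d d'))).submatrix
        id Fin.revPerm i r := by
    ext i r
    simp only [basisMatrix, Matrix.of_apply, C_pt, Matrix.submatrix_apply, id,
      Matrix.vandermonde_apply, Function.comp_apply, Fin.revPerm_apply, Fin.val_rev]
    congr 2
    omega
  rw [h, Matrix.det_mul_column, Matrix.det_permute', mul_pow, mul_pow, mul_pow]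
  rcases Int.units_eq_one_or (Equiv.Perm.sign (Fin.revPerm : Equiv.Perm (Fin (d + 1))))
    with hs | hs <;> simp [hs]

lemma Dom.basisMatrix_det_ne_zero {x : CSVar d d' → ℂ} (hx : Dom x) :
    (basisMatrix x).det ≠ 0 := by
  have := basisMatrix_det_sq x
  intro h
  rw [h] at this
  refine pow_ne_zero 2 (mul_ne_zero (prod_ne_zero_iff.2 fun i _ => hx.2 _)
    (Matrix.det_vandermonde_ne_zero_iff.2 hx.injective_inl)) (this.symm.trans (by simp))

lemma Dom.relation_det_ne_zero {x : CSVar d d' → ℂ} (hx : Dom x) : (relation x).det ≠ 0 := by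
  rw [relation_det]; exact pow_ne_zero 2 hx.basisMatrix_det_ne_zero

lemma Dom.constraint_eq_zero_iff {x : CSVar d d' → ℂ} (hx : Dom x) (K : Kinematics d d') :
    constraint K x = 0 ↔ extConstraint K x = 0 := by
  rw [hx.constraint_eq]
  refine ⟨fun h => ?_, fun h => by rw [h, Matrix.mulVec_zero]⟩
  exact Matrix.eq_zero_of_mulVec_eq_zero hx.relation_det_ne_zero h

/-- The two expressions for the total momentum agree on solutions. -/
lemma mom_mul_relation (K : Kinematics d d') {x : CSVar d d' → ℂ}
    (h : extConstraint K x = 0) :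
    Matrix.of (mom K x) * relation x = Matrix.fromCols 0 (Matrix.of (Amb.mom K)) := by
  -- The map constraint identifies `∑_r ρ_r t_i C_r(σ_i)` with `λ_i`; `h2` is the ambitwistor
  -- constraint, which makes the columns of the map constraints vanish.
  have h1 : ∀ i α, t x (.inl i) * lamMap x (pt x (.inl i)) α = K.lam (.inl i) α := fun i α =>
    (sub_eq_zero.1 (congrFun h (.inl (i, α)))).symm
  have h2 : ∀ i α, K.lamt (.inl i) α + ∑ p : Fin (d' + 1), invBr x p i * K.lamt (.inr p) α = 0 := by
    intro i α
    have := congrFun h (.inr (.inl i, α))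
    simp only [extConstraint, Amb.constraint, lamtMap_toAmb, sub_neg_eq_add] at this
    exact this
  ext q v
  change (mom K x q ᵥ* relation x) v = _
  rw [vecMul_relation]
  rcases v with ⟨r, α⟩ | ⟨i | p, α⟩
  · simp only [spinEquiv, relationCore, Fintype.sum_sum_type]
    simp only [Equiv.symm_symm, Equiv.sumProdDistrib_symm_apply_left,
      Equiv.sumProdDistrib_apply_left, Equiv.sumProdDistrib_apply_right,
      Matrix.fromBlocks_apply₁₁, Matrix.fromBlocks_apply₂₁, Matrix.fromRows_apply_inl,
      Matrix.fromRows_apply_inr, Matrix.fromCols_apply_inl, Matrix.of_apply, Matrix.one_apply,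
      mul_ite, mul_one, mul_zero, sum_ite_eq', mem_univ, if_true, Matrix.zero_apply,
      sum_const_zero, zero_add, mom, ite_mul, zero_mul]
    split_ifs with hα
    · rw [← h2 r]
      congr 1
      exact sum_congr rfl fun p _ => mul_comm _ _
    · simp
  · simp only [spinEquiv, relationCore, Fintype.sum_sum_type]
    simp only [Equiv.symm_symm, Equiv.sumProdDistrib_symm_apply_right,
      Equiv.sumProdDistrib_apply_left, Equiv.sumProdDistrib_apply_right,
      Matrix.fromBlocks_apply₁₂, Matrix.fromBlocks_apply₂₂, Matrix.fromBlocks_apply₁₁,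
      Matrix.fromBlocks_apply₂₁, Matrix.fromCols_apply_inl, Matrix.fromCols_apply_inr,
      Matrix.of_apply, mul_zero, Matrix.zero_apply, Matrix.transpose_apply, basisMatrix,
      sum_const_zero, add_zero, mom, Amb.mom, ite_mul, zero_mul]
    split_ifs with hα
    · rw [← h1, lamMap, mul_sum]
      exact sum_congr rfl fun p _ => by ring
    · simp
  · simp only [spinEquiv, relationCore, Fintype.sum_sum_type]
    simp [mom, Amb.mom, Matrix.one_apply]

lemma Dom.fermions_eq {x : CSVar d d' → ℂ} (hx : Dom x) :
    fermions x = (basisMatrix x).det ^ 8 • Amb.fermions 8 (toAmb x) :=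
  csFermions_eq fun p r => hx.interpolate_C p r

end CS
end

/-! ### Jacobian matrices and the symmetries of the ambitwistor constraints -/

noncomputable section

section Jacobian

variable {ν κ μ : Type} [Fintype ν] [DecidableEq ν] [Fintype κ] [DecidableEq κ] [Fintype μ]

/-- The Jacobian matrix of a map between coordinate spaces. -/
def jac (f : (κ → ℂ) → μ → ℂ) (x : κ → ℂ) : Matrix μ κ ℂ :=
  Matrix.of fun c v => fderiv ℂ (fun y => f y c) x (Pi.single v 1)

lemma jac_mulVec (f : (κ → ℂ) → μ → ℂ) (x w : κ → ℂ) (c : μ) :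
    (jac f x *ᵥ w) c = fderiv ℂ (fun y => f y c) x w := by
  conv_rhs => rw [pi_eq_sum_univ' w, map_sum]
  simp only [Matrix.mulVec, dotProduct, jac, Matrix.of_apply]
  refine Finset.sum_congr rfl fun v _ => ?_
  rw [map_smul, smul_eq_mul, mul_comm]

lemma jac_comp {f : (ν → ℂ) → μ → ℂ} {g : (κ → ℂ) → ν → ℂ} {x : κ → ℂ}
    (hf : ∀ c, DifferentiableAt ℂ (fun y => f y c) (g x))
    (hg : ∀ c, DifferentiableAt ℂ (fun y => g y c) x) :
    jac (fun y => f (g y)) x = jac f (g x) * jac g x := by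
  have hg' : DifferentiableAt ℂ g x := differentiableAt_pi.2 hg
  ext c v
  have h1 : fderiv ℂ (fun y => f (g y) c) x =
      (fderiv ℂ (fun y => f y c) (g x)).comp (fderiv ℂ g x) :=
    fderiv_comp x (g := fun y => f y c) (hf c) hg'
  have h2 : fderiv ℂ g x (Pi.single v 1) = (jac g x).col v := by
    ext u
    change _ = fderiv ℂ (fun y => g y u) x (Pi.single v 1)
    rw [(hasFDerivAt_pi'.1 hg'.hasFDerivAt u).fderiv]
    rfl
  change fderiv ℂ (fun y => f (g y) c) x (Pi.single v 1) = _
  rw [h1, ContinuousLinearMap.comp_apply, ← jac_mulVec, h2]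
  rfl

/-- In the product rule the term with the derivative of `U` is proportional to `f x = 0`. The linear
relation between the constraints may thus depend on the point. -/
lemma jac_mulVec_of_eq_zero {U : (κ → ℂ) → Matrix μ ν ℂ} {f : (κ → ℂ) → ν → ℂ} {x : κ → ℂ}
    (hU : ∀ c e, DifferentiableAt ℂ (fun y => U y c e) x)
    (hf : ∀ e, DifferentiableAt ℂ (fun y => f y e) x) (h0 : f x = 0) :
    jac (fun y => U y *ᵥ f y) x = U x * jac f x := by
  ext c v
  have h1 : HasFDerivAt (fun y => ∑ e, U y c e * f y e)
      (∑ e, (U x c e • fderiv ℂ (fun y => f y e) x + f x e • fderiv ℂ (fun y => U y c e) x)) x :=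
    HasFDerivAt.fun_sum fun e _ => (hU c e).hasFDerivAt.mul (hf e).hasFDerivAt
  change fderiv ℂ (fun y => ∑ e, U y c e * f y e) x (Pi.single v 1) = _
  rw [h1.fderiv, h0]
  simp [Matrix.mul_apply, jac]

lemma jac_congr {f g : (κ → ℂ) → μ → ℂ} {x : κ → ℂ} (h : ∀ᶠ y in nhds x, f y = g y) :
    jac f x = jac g x := by
  ext c v
  have : (fun y => f y c) =ᶠ[nhds x] fun y => g y c := h.mono fun y hy => congrFun hy c
  simp only [jac, Matrix.of_apply, this.fderiv_eq]

lemma jac_toLin (T : Matrix μ κ ℂ) (x : κ → ℂ) : jac (fun y => T *ᵥ y) x = T := by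
  ext c v
  have h1 : HasFDerivAt (fun y : κ → ℂ => ∑ e, T c e * y e)
      (∑ e, T c e • (ContinuousLinearMap.proj e : (κ → ℂ) →L[ℂ] ℂ)) x :=
    HasFDerivAt.fun_sum fun e _ => (hasFDerivAt_apply e x).const_mul _
  change fderiv ℂ (fun y => ∑ e, T c e * y e) x (Pi.single v 1) = _
  rw [h1.fderiv]
  simp [Pi.single_apply]

lemma fderiv_eq_of_hasDerivAt_line {f : (κ → ℂ) → ℂ} {x w : κ → ℂ} {f' : ℂ}
    (hf : DifferentiableAt ℂ f x) (h : HasDerivAt (fun τ : ℂ => f (x + τ • w)) f' 0) :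
    fderiv ℂ f x w = f' := by
  rw [← hf.lineDeriv_eq_fderiv]
  exact HasLineDerivAt.lineDeriv h

lemma hasDerivAt_coord (x w : κ → ℂ) (v : κ) :
    HasDerivAt (fun τ : ℂ => (x + τ • w) v) (w v) 0 := by
  simpa using ((hasDerivAt_id (0 : ℂ)).mul_const (w v)).const_add (x v)

lemma differentiableAt_coord (x : κ → ℂ) (v : κ) : DifferentiableAt ℂ (fun y : κ → ℂ => y v) x :=
  differentiableAt_apply v x

end Jacobian

namespace Amb

open Finset

variable {d d' : ℕ}

lemma differentiableAt_br (a b : Particle d d') (x : AmbVar d d' → ℂ) :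
    DifferentiableAt ℂ (fun y : AmbVar d d' → ℂ => br (pt y a) (pt y b)) x := by
  simp only [br, pt]
  exact ((differentiableAt_coord _ _).mul (differentiableAt_coord _ _)).sub
    ((differentiableAt_coord _ _).mul (differentiableAt_coord _ _))

/-- The domain of integration. -/
def Dom (x : AmbVar d d' → ℂ) : Prop := ∀ a b, a ≠ b → br (pt x a) (pt x b) ≠ 0

lemma Dom.differentiableAt_constraint {x : AmbVar d d' → ℂ} (hx : Dom x) (K : Kinematics d d')
    (c : AmbVar d d') : DifferentiableAt ℂ (fun y => constraint K y c) x := by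
  have h : ∀ (e : ℂ) (a b : Particle d d'), a ≠ b →
      DifferentiableAt ℂ (fun y => e / br (pt y a) (pt y b)) x := by
    intro e a b hab
    simp only [div_eq_mul_inv]
    exact ((differentiableAt_br a b x).fun_inv (hx _ _ hab)).const_mul e
  rcases c with ⟨i | p, α⟩
  · exact (differentiableAt_const _).fun_sub (DifferentiableAt.fun_sum fun p _ =>
      h (K.lamt (.inr p) α) (.inl i) (.inr p) (by simp))
  · exact (differentiableAt_const _).fun_sub (DifferentiableAt.fun_sum fun i _ =>
      h (K.lam (.inl i) α) (.inr p) (.inl i) (by simp))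

lemma hasDerivAt_br (x w : AmbVar d d' → ℂ) (a b : Particle d d') :
    HasDerivAt (fun τ : ℂ => br (pt (x + τ • w) a) (pt (x + τ • w) b))
      (br (pt w a) (pt x b) + br (pt x a) (pt w b)) 0 := by
  have h := fun v => hasDerivAt_coord x w v
  have := (((h (a, 0)).mul (h (b, 1))).sub ((h (a, 1)).mul (h (b, 0))))
  refine this.congr_deriv ?_
  simp [br, pt]
  ring

/-- The constraints depend on the punctures only through the brackets `(i p)`. -/
lemma Dom.jac_mulVec_eq_zero {x : AmbVar d d' → ℂ} (hx : Dom x) (K : Kinematics d d')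
    {w : AmbVar d d' → ℂ} (hw : ∀ i p,
      br (pt w (.inl i)) (pt x (.inr p)) + br (pt x (.inl i)) (pt w (.inr p)) = 0) :
    jac (constraint K) x *ᵥ w = 0 := by
  have hw' : ∀ i p,
      br (pt w (.inr p)) (pt x (.inl i)) + br (pt x (.inr p)) (pt w (.inl i)) = 0 := by
    intro i p
    have := hw i p
    simp only [br] at this ⊢
    linear_combination -this
  funext c
  rw [jac_mulVec]
  refine fderiv_eq_of_hasDerivAt_line (hx.differentiableAt_constraint K c) ?_
  have hdiv : ∀ (e : ℂ) (a b : Particle d d'), a ≠ b →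
      br (pt w a) (pt x b) + br (pt x a) (pt w b) = 0 →
      HasDerivAt (fun τ : ℂ => e / br (pt (x + τ • w) a) (pt (x + τ • w) b)) 0 0 := by
    intro e a b hab h0
    have h1 := hasDerivAt_br x w a b
    rw [h0] at h1
    have := (hasDerivAt_const (0 : ℂ) e).div h1 (by simpa using hx a b hab)
    exact this.congr_deriv (by simp)
  rcases c with ⟨i | p, α⟩
  · have := (hasDerivAt_const (0 : ℂ) (K.lamt (.inl i) α)).sub
      (HasDerivAt.fun_sum (u := univ) fun (p : Fin (d' + 1)) _ =>
        hdiv (K.lamt (.inr p) α) (.inl i) (.inr p) (by simp) (hw i p))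
    exact this.congr_deriv (by simp)
  · have := (hasDerivAt_const (0 : ℂ) (K.lam (.inr p) α)).sub
      (HasDerivAt.fun_sum (u := univ) fun (i : Fin (d + 1)) _ =>
        hdiv (K.lam (.inl i) α) (.inr p) (.inl i) (by simp) (hw' i p))
    exact this.congr_deriv (by simp)

/-- Traceless matrices preserve all brackets, and the opposite charges of `σ_i` and `σ_p` cancel in
the brackets `(i p)`. -/
lemma Dom.jac_mul_gauge {x : AmbVar d d' → ℂ} (hx : Dom x) (K : Kinematics d d') :
    jac (constraint K) x * gauge x = 0 := by
  ext c j
  have h : jac (constraint K) x *ᵥ (gauge x).col j = 0 := by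
    refine hx.jac_mulVec_eq_zero K fun i p => ?_
    fin_cases j <;> simp [br, pt, gauge, Matrix.col, Matrix.mulVec, dotProduct] <;> ring
  exact congrFun h c

/-- The coefficients `mom K` are constant, so differentiating the identity `mom_spec`, whose right
side is constant, gives the relation everywhere on the domain and not only at solutions. -/
lemma Dom.mom_mul_jac {x : AmbVar d d' → ℂ} (hx : Dom x) (K : Kinematics d d') :
    Matrix.of (mom K) * jac (constraint K) x = 0 := by
  ext q v
  have h : HasFDerivAt (fun y => ∑ c, mom K q c * constraint K y c)
      (∑ c, mom K q c • fderiv ℂ (fun y => constraint K y c) x) x :=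
    HasFDerivAt.fun_sum fun c _ => (hx.differentiableAt_constraint K c).hasFDerivAt.const_mul _
  have hc : (fun y => ∑ c, mom K q c * constraint K y c) = fun _ => K.totalMomentum q :=
    funext fun y => congrFun (mom_spec K y) q
  rw [hc] at h
  have := congrArg (fun L => L (Pi.single v 1)) (h.unique (hasFDerivAt_const _ _))
  simpa [Matrix.mul_apply, jac] using this

end Amb
end

/-! ### Factorisation of the Cachazo–Skinner Jacobian and logarithmic derivatives -/

noncomputable section

namespace CS

open Finset

variable {d d' : ℕ}

lemma differentiableAt_z (a : Particle d d') (x : CSVar d d' → ℂ) :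
    DifferentiableAt ℂ (fun y : CSVar d d' → ℂ => z y a) x := differentiableAt_coord _ _

lemma differentiableAt_t (a : Particle d d') (x : CSVar d d' → ℂ) :
    DifferentiableAt ℂ (fun y : CSVar d d' → ℂ => t y a) x := differentiableAt_coord _ _

lemma differentiableAt_C (r : Fin (d + 1)) (a : Particle d d') (x : CSVar d d' → ℂ) :
    DifferentiableAt ℂ (fun y : CSVar d d' → ℂ => C r (pt y a)) x := by
  simp only [C_pt]
  exact (differentiableAt_z a x).fun_pow _

lemma Dom.differentiableAt_scale {x : CSVar d d' → ℂ} (hx : Dom x) (a : Particle d d') :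
    DifferentiableAt ℂ (fun y : CSVar d d' → ℂ => scale y a) x := by
  have hprod : ∀ (b : Particle d d') (s : Finset (Fin (d + 1))), DifferentiableAt ℂ
      (fun y : CSVar d d' → ℂ => ∏ i ∈ s, (z y (.inl i) - z y b)) x := fun b s =>
    (HasFDerivAt.finsetProd (u := s) fun i _ => ((differentiableAt_z (.inl i) x).fun_sub
      (differentiableAt_z b x)).hasFDerivAt).differentiableAt
  rcases a with i | p
  · exact (differentiableAt_t _ x).fun_mul (hprod _ _)
  · exact ((differentiableAt_t _ x).fun_mul (hprod _ _)).fun_inv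
      (mul_ne_zero (hx.2 _) (hx.prod_ne_zero p))

lemma Dom.differentiableAt_toAmb {x : CSVar d d' → ℂ} (hx : Dom x) (v : AmbVar d d') :
    DifferentiableAt ℂ (fun y : CSVar d d' → ℂ => toAmb y v) x := by
  obtain ⟨a, α⟩ := v
  refine (hx.differentiableAt_scale a).fun_mul ?_
  fin_cases α
  · exact differentiableAt_const _
  · exact differentiableAt_z a x

lemma Dom.toAmb {x : CSVar d d' → ℂ} (hx : Dom x) : Amb.Dom (toAmb x) :=
  fun _ _ hab => hx.br_toAmb_ne_zero hab

/-- The constraints on the map at the points `σ_i`. -/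
def mapConstraint (K : Kinematics d d') (x : CSVar d d' → ℂ) (v : Fin (d + 1) × Fin 2) : ℂ :=
  K.lam (.inl v.1) v.2 - t x (.inl v.1) * lamMap x (pt x (.inl v.1)) v.2

lemma differentiableAt_mapConstraint (K : Kinematics d d') (x : CSVar d d' → ℂ)
    (v : Fin (d + 1) × Fin 2) : DifferentiableAt ℂ (fun y => mapConstraint K y v) x := by
  refine (differentiableAt_const _).fun_sub ((differentiableAt_t _ x).fun_mul ?_)
  exact DifferentiableAt.fun_sum fun r _ => (differentiableAt_coord _ _).fun_mul
    (differentiableAt_C r _ x)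

lemma Dom.differentiableAt_ambConstraint {x : CSVar d d' → ℂ} (hx : Dom x) (K : Kinematics d d')
    (v : AmbVar d d') : DifferentiableAt ℂ (fun y => Amb.constraint K (CS.toAmb y) v) x :=
  DifferentiableAt.fun_comp' x (hx.toAmb.differentiableAt_constraint K v)
    (differentiableAt_pi.2 hx.differentiableAt_toAmb)

lemma Dom.differentiableAt_invBr {x : CSVar d d' → ℂ} (hx : Dom x) (p : Fin (d' + 1))
    (i : Fin (d + 1)) : DifferentiableAt ℂ (fun y : CSVar d d' → ℂ => invBr y p i) x :=
  (DifferentiableAt.fun_comp' x (Amb.differentiableAt_br (.inr p) (.inl i) (CS.toAmb x))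
    (differentiableAt_pi.2 hx.differentiableAt_toAmb)).fun_inv (hx.br_toAmb_ne_zero (by simp))

lemma Dom.differentiableAt_relation {x : CSVar d d' → ℂ} (hx : Dom x) (c e : CSVar d d') :
    DifferentiableAt ℂ (fun y => relation y c e) x := by
  have h : ∀ a b, DifferentiableAt ℂ (fun y : CSVar d d' → ℂ => relationCore y a b) x := by
    rintro (r | i | p) (j | j | q)
    · exact differentiableAt_const _
    · exact (differentiableAt_t _ x).fun_mul (differentiableAt_C r _ x)
    · exact differentiableAt_const _
    · exact differentiableAt_const _
    · exact differentiableAt_const _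
    · exact differentiableAt_const _
    · exact hx.differentiableAt_invBr p j
    · exact differentiableAt_const _
    · exact differentiableAt_const _
  exact (h _ _).fun_mul (differentiableAt_const _)

lemma eventually_dom {x : CSVar d d' → ℂ} (hx : Dom x) : ∀ᶠ y in nhds x, Dom y := by
  have h1 : ∀ a : Particle d d', ∀ᶠ y in nhds x, t y a ≠ 0 := fun a =>
    (differentiableAt_t a x).continuousAt.eventually_ne (hx.2 a)
  have h2 : ∀ a b : Particle d d', ∀ᶠ y in nhds x, a ≠ b → z y a ≠ z y b := by
    intro a b
    by_cases hab : a = b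
    · exact Filter.Eventually.of_forall fun y h => (h hab).elim
    · exact (((differentiableAt_z a x).continuousAt.ne_iff_eventually_ne
        (differentiableAt_z b x).continuousAt).1 (hx.1 a b hab)).mono fun y hy _ => hy
  filter_upwards [Filter.eventually_all.2 h1,
    Filter.eventually_all.2 fun a => Filter.eventually_all.2 (h2 a)] with y hy1 hy2
  exact ⟨hy2, hy1⟩

/-- The change of variables from the Cachazo-Skinner to the ambitwistor formula. -/
def varChange (K : Kinematics d d') (x : CSVar d d' → ℂ) : Matrix (CSVar d d') (CSVar d d') ℂ :=
  Matrix.fromRows (jac (mapConstraint K) x) (jac toAmb x)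

/-- The Jacobian matrices of the two formulae at a solution. -/
lemma Dom.jac_constraint {x : CSVar d d' → ℂ} (hx : Dom x) {K : Kinematics d d'}
    (h0 : extConstraint K x = 0) : jac (constraint K) x = relation x *
      Matrix.fromBlocks 1 0 0 (jac (Amb.constraint K) (CS.toAmb x)) * varChange K x := by
  -- The relation between the constraints holds in a whole neighbourhood of `x`, since the domain is
  -- open; it may therefore be differentiated.
  have h1 : jac (constraint K) x = relation x * jac (extConstraint K) x := by
    rw [jac_congr ((eventually_dom hx).mono fun y hy => hy.constraint_eq K)]
    refine jac_mulVec_of_eq_zero hx.differentiableAt_relation ?_ h0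
    rintro (v | v)
    · exact differentiableAt_mapConstraint K x v
    · exact hx.differentiableAt_ambConstraint K v
  have h2 : jac (extConstraint K) x = Matrix.fromRows (jac (mapConstraint K) x)
      (jac (fun y => Amb.constraint K (CS.toAmb y)) x) := by
    ext (v | v) w <;> rfl
  rw [h1, Matrix.mul_assoc, h2, jac_comp (hx.toAmb.differentiableAt_constraint K)
    hx.differentiableAt_toAmb, varChange, Matrix.fromBlocks_mul_fromRows]
  simp

/-- The derivative of `F` at `x` in the direction `w` is `F x * l`. -/
def HasLogDeriv (F : (CSVar d d' → ℂ) → ℂ) (x w : CSVar d d' → ℂ) (l : ℂ) : Prop :=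
  HasDerivAt (fun τ : ℂ => F (x + τ • w)) (F x * l) 0

namespace HasLogDeriv

variable {F G : (CSVar d d' → ℂ) → ℂ} {x w : CSVar d d' → ℂ} {l m : ℂ}

lemma mul (hF : HasLogDeriv F x w l) (hG : HasLogDeriv G x w m) :
    HasLogDeriv (fun y => F y * G y) x w (l + m) := by
  refine (HasDerivAt.fun_mul hF hG).congr_deriv ?_
  simp only [zero_smul, add_zero]
  ring

lemma inv (hF : HasLogDeriv F x w l) (h0 : F x ≠ 0) :
    HasLogDeriv (fun y => (F y)⁻¹) x w (-l) := by
  refine (HasDerivAt.fun_inv hF (by simpa using h0)).congr_deriv ?_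
  simp only [zero_smul, add_zero]
  field_simp

lemma prod {κ : Type} [DecidableEq κ] (s : Finset κ) {F : κ → (CSVar d d' → ℂ) → ℂ} {l : κ → ℂ}
    (h : ∀ i ∈ s, HasLogDeriv (F i) x w (l i)) :
    HasLogDeriv (fun y => ∏ i ∈ s, F i y) x w (∑ i ∈ s, l i) := by
  induction s using Finset.induction_on with
  | empty => simpa [HasLogDeriv] using hasDerivAt_const (0 : ℂ) (1 : ℂ)
  | insert a s ha ih =>
    simp only [prod_insert ha, sum_insert ha]
    exact (h a (by simp)).mul (ih fun i hi => h i (by simp [hi]))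

end HasLogDeriv

/-- The logarithmic derivative of the scale of a puncture. -/
def scaleRate (τ : Particle d d' → ℂ) (m : Particle d d' → Particle d d' → ℂ) :
    Particle d d' → ℂ
  | .inl i => τ (.inl i) + ∑ j ∈ univ.erase i, m (.inl i) (.inl j)
  | .inr p => -(τ (.inr p) + ∑ j : Fin (d + 1), m (.inr p) (.inl j))

lemma Dom.hasLogDeriv_scale {x : CSVar d d' → ℂ} (hx : Dom x) {w : CSVar d d' → ℂ}
    {τ : Particle d d' → ℂ} {m : Particle d d' → Particle d d' → ℂ}
    (hτ : ∀ a, t w a = t x a * τ a)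
    (hm : ∀ a b, z w b - z w a = (z x b - z x a) * m a b) (a : Particle d d') :
    HasLogDeriv (fun y => scale y a) x w (scaleRate τ m a) := by
  have ht : ∀ a, HasLogDeriv (fun y => t y a) x w (τ a) := fun a =>
    (hasDerivAt_coord x w (.inr (a, 1))).congr_deriv (hτ a)
  have hz : ∀ a b, HasLogDeriv (fun y => z y b - z y a) x w (m a b) := fun a b =>
    ((hasDerivAt_coord x w (.inr (b, 0))).fun_sub
      (hasDerivAt_coord x w (.inr (a, 0)))).congr_deriv (hm a b)
  rcases a with i | p
  · exact (ht _).mul (HasLogDeriv.prod _ fun j _ => hz _ _)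
  · exact ((ht _).mul (HasLogDeriv.prod _ fun j _ => hz _ _)).inv
      (mul_ne_zero (hx.2 _) (hx.prod_ne_zero p))

/-- The scales are products of the `t_a` and of differences of the `z_a`, so their derivatives only
require the relative rates `τ` of the `t_a` and `m` of the differences. Both coordinate directions
and gauge vector fields have this form, without dividing by zero on the diagonal. -/
lemma Dom.fderiv_toAmb {x : CSVar d d' → ℂ} (hx : Dom x) {w : CSVar d d' → ℂ}
    {τ : Particle d d' → ℂ} {m : Particle d d' → Particle d d' → ℂ}
    (hτ : ∀ a, t w a = t x a * τ a)
    (hm : ∀ a b, z w b - z w a = (z x b - z x a) * m a b) (a : Particle d d') :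
    (jac CS.toAmb x *ᵥ w) (a, 0) = scale x a * scaleRate τ m a ∧
      (jac CS.toAmb x *ᵥ w) (a, 1) =
        scale x a * scaleRate τ m a * z x a + scale x a * z w a := by
  have hs := hx.hasLogDeriv_scale hτ hm a
  constructor
  · rw [jac_mulVec]
    refine fderiv_eq_of_hasDerivAt_line (hx.differentiableAt_toAmb _) ?_
    have : ∀ y : CSVar d d' → ℂ, CS.toAmb y (a, 0) = scale y a := fun y => by simp [CS.toAmb, pt]
    simp only [this]
    exact hs
  · rw [jac_mulVec]
    refine fderiv_eq_of_hasDerivAt_line (hx.differentiableAt_toAmb _) ?_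
    have h := HasDerivAt.fun_mul hs (hasDerivAt_coord x w (.inr (a, 0)))
    refine h.congr_deriv ?_
    simp [z]

end CS
end

/-! ### The determinant of the change of variables and its action on the gauge fields -/

noncomputable section

namespace CS

open Finset

variable {d d' : ℕ}

lemma mulVec_single_apply {κ μ : Type} [Fintype κ] [DecidableEq κ] (M : Matrix μ κ ℂ) (c : μ)
    (v : κ) : (M *ᵥ Pi.single v 1) c = M c v := by
  rw [Matrix.mulVec_single_one]; rfl

lemma jac_mapConstraint_mulVec (K : Kinematics d d') (x w : CSVar d d' → ℂ) (i : Fin (d + 1))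
    (α : Fin 2) : (jac (mapConstraint K) x *ᵥ w) (i, α) =
      -(t w (.inl i) * lamMap x (pt x (.inl i)) α + t x (.inl i) *
        ∑ r, (rho w r α * z x (.inl i) ^ (d - r : ℕ) + rho x r α *
          (((d - r : ℕ) : ℂ) * z x (.inl i) ^ (d - r - 1 : ℕ) * z w (.inl i)))) := by
  rw [jac_mulVec]
  refine fderiv_eq_of_hasDerivAt_line (differentiableAt_mapConstraint K x _) ?_
  have hz := hasDerivAt_coord x w (.inr (.inl i, 0))
  have ht := hasDerivAt_coord x w (.inr (.inl i, 1))
  have hr := fun r : Fin (d + 1) => (hasDerivAt_coord x w (.inl (r, α))).fun_mul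
    (hz.fun_pow (d - r : ℕ))
  have h := (hasDerivAt_const (0 : ℂ) (K.lam (.inl i) α)).fun_sub
    (ht.fun_mul (HasDerivAt.fun_sum (u := univ) fun r _ => hr r))
  simp only [mapConstraint, lamMap, C_pt, rho, z, t]
  refine h.congr_deriv ?_
  simp only [zero_smul, add_zero, zero_sub]

lemma Dom.jac_toAmb_inl {x : CSVar d d' → ℂ} (hx : Dom x) (v : AmbVar d d')
    (u : Fin (d + 1) × Fin 2) : jac CS.toAmb x v (.inl u) = 0 := by
  obtain ⟨a, α⟩ := v
  have h := hx.fderiv_toAmb (w := Pi.single (.inl u) 1) (τ := 0) (m := 0)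
    (fun a => by simp [t]) (fun a b => by simp [z]) a
  have h0 : scaleRate (0 : Particle d d' → ℂ) 0 a = 0 := by
    rcases a with i | p <;> simp [scaleRate]
  refine (mulVec_single_apply _ _ _).symm.trans ?_
  fin_cases α
  · exact h.1.trans (by rw [h0, mul_zero])
  · exact h.2.trans (by rw [h0]; simp [z])

/-- The sign with which `t_a` enters the scale of a puncture. -/
def tSign : Particle d d' → ℂ := Sum.elim (fun _ => 1) (fun _ => -1)

/-- The two components of a spinor as separate blocks. -/
def blockEquiv (ι : Type) : ι ⊕ ι ≃ ι × Fin 2 where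
  toFun := Sum.elim (fun a => (a, 0)) (fun a => (a, 1))
  invFun v := if v.2 = 0 then .inl v.1 else .inr v.1
  left_inv := by rintro (a | a) <;> simp
  right_inv := by rintro ⟨a, α⟩; fin_cases α <;> simp

/-- Block row operations remove the complicated dependence of the scales on the `z_a`: what is left
involves only `∂s_a/∂t_a = ± s_a / t_a` and the factor `s_a` of `dz_a`. Combining the block sign
`(-1) ^ n` with the `d' + 1` signs from `s_p ∝ t_p⁻¹` leaves `(-1) ^ (d + 1)`, the overall sign of
the theorem. -/
lemma Dom.det_jac_toAmb {x : CSVar d d' → ℂ} (hx : Dom x) :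
    (Matrix.of fun v u => jac CS.toAmb x v (.inr u)).det =
      (-1) ^ (d + 1) * ∏ a, (scale x a ^ 2 / t x a) := by
  let E : Particle d d' → ℂ := fun a => scale x a * (tSign a / t x a)
  let S : Matrix (Particle d d') (Particle d d') ℂ := Matrix.of fun a b =>
    jac CS.toAmb x (a, 0) (.inr (b, 0))
  have ht : ∀ a b, jac CS.toAmb x (a, 0) (.inr (b, 1)) = Matrix.diagonal E a b ∧
      jac CS.toAmb x (a, 1) (.inr (b, 1)) = Matrix.diagonal E a b * z x a := by
    intro a b
    have h := hx.fderiv_toAmb (w := Pi.single (.inr (b, 1)) 1)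
      (τ := fun a => if a = b then (t x a)⁻¹ else 0) (m := 0)
      (fun a => by
        by_cases hab : a = b
        · subst hab; simp [t, mul_inv_cancel₀ (show x (.inr (a, 1)) ≠ 0 from hx.2 a)]
        · simp [t, hab])
      (fun a b => by simp [z]) a
    have h0 : scaleRate (fun a => if a = b then (t x a)⁻¹ else 0) 0 a =
        if a = b then tSign a / t x a else 0 := by
      rcases a with i | p <;> simp only [scaleRate, tSign] <;> split_ifs <;>
        simp [div_eq_mul_inv]
    have hz : z (Pi.single (.inr (b, 1)) 1 : CSVar d d' → ℂ) a = 0 := by simp [z]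
    rw [h0, hz, mulVec_single_apply, mulVec_single_apply] at h
    rw [h.1, h.2, Matrix.diagonal_apply]
    split_ifs <;> simp [E]
  have hz : ∀ a b, jac CS.toAmb x (a, 1) (.inr (b, 0)) =
      z x a * S a b + Matrix.diagonal (scale x) a b := by
    intro a b
    have h := hx.fderiv_toAmb (w := Pi.single (.inr (b, 0)) 1) (τ := 0)
      (m := fun a c => ((if c = b then 1 else 0) - (if a = b then 1 else 0)) / (z x c - z x a))
      (fun a => by simp [t])
      (fun a c => by
        by_cases hac : a = c
        · subst hac; simp
        · rw [mul_div_cancel₀ _ (hx.sub_ne_zero (Ne.symm hac))]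
          simp [z, Pi.single_apply]) a
    rw [mulVec_single_apply, mulVec_single_apply] at h
    rw [h.2, ← h.1, mul_comm, Matrix.diagonal_apply]
    congr 1
    by_cases hab : a = b
    · subst hab; simp [z]
    · simp [z, hab]
  -- The lower row of blocks is `z_a` times the upper one plus `[diag s, 0]`. The block `diag s` is
  -- then used to replace the derivatives `S` by `1`.
  have hQ : (Matrix.of fun v u => jac CS.toAmb x v (.inr u)).submatrix (blockEquiv _)
      (blockEquiv _) = Matrix.fromBlocks 1 0 (Matrix.diagonal (z x)) 1 *
        (Matrix.fromBlocks 1 ((S - 1) * Matrix.diagonal fun a => (scale x a)⁻¹) 0 1 *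
          Matrix.fromBlocks 1 (Matrix.diagonal E) (Matrix.diagonal (scale x)) 0) := by
    have hd : (Matrix.diagonal fun a => (scale x a)⁻¹) * Matrix.diagonal (scale x) = 1 := by
      rw [Matrix.diagonal_mul_diagonal, ← Matrix.diagonal_one]
      congr 1
      funext a
      exact inv_mul_cancel₀ (hx.scale_ne_zero a)
    simp only [Matrix.fromBlocks_multiply, Matrix.one_mul, Matrix.mul_zero, Matrix.zero_mul,
      Matrix.mul_assoc, hd, Matrix.mul_one, add_zero, zero_add, add_sub_cancel]
    ext (a | a) (b | b)
    · rfl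
    · exact (ht a b).1
    · exact (hz a b).trans (by simp [Matrix.diagonal_mul])
    · exact (ht a b).2.trans (by simp [Matrix.diagonal_apply, mul_comm])
  rw [← Matrix.det_submatrix_equiv_self (blockEquiv _), hQ, Matrix.det_mul, Matrix.det_mul,
    Matrix.det_fromBlocks_zero₁₂, Matrix.det_fromBlocks_zero₂₁, Matrix.det_fromBlocks_one_zero,
    Matrix.diagonal_mul_diagonal, Matrix.det_diagonal]
  simp only [Matrix.det_one, one_mul, mul_one, E]
  have h1 : ∏ a : Particle d d', (tSign a : ℂ) = (-1) ^ (d' + 1) := by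
    simp [Fintype.prod_sum_type, tSign]
  have h2 : ∀ a : Particle d d', scale x a * (scale x a * (tSign a / t x a)) =
      tSign a * (scale x a ^ 2 / t x a) := fun a => by ring
  simp only [h2, prod_mul_distrib, h1, Fintype.card_sum, Fintype.card_fin]
  rw [← mul_assoc, ← pow_add, show d + 1 + (d' + 1) + (d' + 1) = d + 1 + 2 * (d' + 1) by ring,
    pow_add, pow_mul]
  simp

/-- The punctures do not involve the moduli `ρ_r`, so the matrix is block triangular. The block of
the `ρ`-derivatives is minus the basis matrix, once for each spinor component, and the two signs
cancel. -/
lemma Dom.varChange_det {x : CSVar d d' → ℂ} (hx : Dom x) (K : Kinematics d d') :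
    (varChange K x).det = (basisMatrix x).det ^ 2 *
      ((-1) ^ (d + 1) * ∏ a, (scale x a ^ 2 / t x a)) := by
  have h : varChange K x = Matrix.fromBlocks
      (Matrix.kroneckerMap (· * ·) (-basisMatrix x) (1 : Matrix (Fin 2) (Fin 2) ℂ))
      (Matrix.of fun v u => jac (mapConstraint K) x v (.inr u)) 0
      (Matrix.of fun v u => jac CS.toAmb x v (.inr u)) := by
    ext (⟨i, α⟩ | v) (⟨r, β⟩ | u)
    · change jac (mapConstraint K) x (i, α) (.inl (r, β)) = _
      refine (mulVec_single_apply _ _ _).symm.trans ?_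
      rw [jac_mapConstraint_mulVec]
      have h1 : t (Pi.single (.inl (r, β)) 1 : CSVar d d' → ℂ) (.inl i) = 0 := by simp [t]
      have h2 : z (Pi.single (.inl (r, β)) 1 : CSVar d d' → ℂ) (.inl i) = 0 := by simp [z]
      rw [h1, h2, sum_eq_single r]
      · simp only [rho, basisMatrix, C_pt, Matrix.fromBlocks_apply₁₁, Matrix.kroneckerMap_apply,
          Matrix.neg_apply, Matrix.of_apply, Matrix.one_apply, Pi.single_apply, Sum.inl.injEq,
          Prod.mk.injEq, true_and]
        split_ifs <;> ring
      · intro s _ hs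
        have : (Sum.inl (s, α) : CSVar d d') ≠ .inl (r, β) := by simp [hs]
        simp [rho, Pi.single_eq_of_ne this]
      · simp
    · rfl
    · exact hx.jac_toAmb_inl _ _
    · rfl
  rw [h, Matrix.det_fromBlocks_zero₂₁, hx.det_jac_toAmb, Matrix.det_kronecker, Matrix.det_one,
    Matrix.det_neg, one_pow, mul_one, Fintype.card_fin, mul_pow, ← pow_mul, mul_comm (d + 1),
    pow_mul]
  simp

lemma Dom.varChange_det_ne_zero {x : CSVar d d' → ℂ} (hx : Dom x) (K : Kinematics d d') :
    (varChange K x).det ≠ 0 := by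
  rw [hx.varChange_det]
  refine mul_ne_zero (pow_ne_zero _ hx.basisMatrix_det_ne_zero)
    (mul_ne_zero (pow_ne_zero _ (by norm_num)) (prod_ne_zero_iff.2 fun a _ => ?_))
  exact div_ne_zero (pow_ne_zero _ (hx.scale_ne_zero a)) (hx.2 a)

/-- The relation between the Lie algebras of the two gauge groups. -/
def gaugeMix (x : CSVar d d' → ℂ) : Matrix (Fin 4) (Fin 4) ℂ :=
  !![1, 0, 0, 0; 0, 1, 0, 0; 0, 0, 1, 0; ∑ i : Fin (d + 1), z x (.inl i), 0, d + 1, 1]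

lemma gaugeMix_det (x : CSVar d d' → ℂ) : (gaugeMix x).det = 1 := by
  simp [gaugeMix, Matrix.det_succ_row_zero, Fin.sum_univ_succ]

/-- When the map and the point are moved together, `λ(σ)` is unchanged as a homogeneous function.
The right side comes only from rescaling `σ` back to `(1, ζ)`, and is what the variation of `t_a`
compensates. -/
lemma sum_sl2Field (x : CSVar d d' → ℂ) (X : Matrix (Fin 2) (Fin 2) ℂ)
    (hX : X 1 1 = -X 0 0) (α : Fin 2) (ζ : ℂ) :
    ∑ r : Fin (d + 1), (sl2Field x X (.inl (r, α)) * ζ ^ (d - r : ℕ) + rho x r α *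
      (((d - r : ℕ) : ℂ) * ζ ^ (d - r - 1 : ℕ) *
        (X 1 0 + (X 1 1 - X 0 0) * ζ - X 0 1 * ζ ^ 2))) =
      -((d : ℂ) * (X 0 0 + X 0 1 * ζ)) * ∑ r : Fin (d + 1), rho x r α * ζ ^ (d - r : ℕ) := by
  have hc : ∀ r : Fin (d + 1), rho x r α = coeff x r α := fun r => by
    rw [coeff, dif_pos r.is_lt]
  have hc0 : coeff x (d + 1) α = 0 := by simp [coeff]
  let f : ℕ → ℂ := fun r => coeff x r α
  have s1 : ∑ r ∈ range (d + 1), ((r : ℂ) + 1) * f (r + 1) * ζ ^ (d - r) =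
      ∑ r ∈ range (d + 1), (r : ℂ) * f r * ζ ^ (d - r + 1) := by
    rw [sum_range_succ, sum_range_succ' (fun r => (r : ℂ) * f r * ζ ^ (d - r + 1))]
    simp only [f, hc0]
    simp only [mul_zero, zero_mul, add_zero, Nat.cast_zero, Nat.cast_add, Nat.cast_one]
    refine sum_congr rfl fun r hr => ?_
    rw [mem_range] at hr
    rw [show d - (r + 1) + 1 = d - r by omega]
  have s2 : ∑ r ∈ range (d + 1), (if r = 0 then 0 else ((d : ℂ) - r + 1) * f (r - 1)) *
      ζ ^ (d - r) = ∑ r ∈ range (d + 1), ((d : ℂ) - r) * f r * ζ ^ (d - r - 1) := by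
    rw [sum_range_succ', sum_range_succ (fun r => ((d : ℂ) - r) * f r * ζ ^ (d - r - 1))]
    simp only [if_true, zero_mul, add_zero, sub_self]
    refine sum_congr rfl fun r hr => ?_
    rw [if_neg (by omega), Nat.sub_sub, Nat.add_sub_cancel]
    push_cast
    ring
  -- For `r = d` the truncated exponent `d - r - 1` is wrong, but the factor `d - r` vanishes.
  have hpow : ∀ r ∈ range (d + 1), ((d : ℂ) - r) * f r * ζ ^ (d - r - 1) * ζ =
      ((d : ℂ) - r) * f r * ζ ^ (d - r) := by
    intro r hr
    rw [mem_range] at hr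
    rcases eq_or_ne r d with rfl | h
    · simp
    · rw [mul_assoc, ← pow_succ, show d - r - 1 + 1 = d - r by omega]
  have key : ∑ r ∈ range (d + 1), (-((((r : ℂ) * X 0 0 + ((d : ℂ) - r) * X 1 1) * f r
        + ((r : ℂ) + 1) * X 0 1 * f (r + 1)
        + (if r = 0 then 0 else ((d : ℂ) - r + 1) * X 1 0 * f (r - 1)))) * ζ ^ (d - r) + f r *
      (((d : ℂ) - r) * ζ ^ (d - r - 1) * (X 1 0 + (X 1 1 - X 0 0) * ζ - X 0 1 * ζ ^ 2))) =
      -((d : ℂ) * (X 0 0 + X 0 1 * ζ)) * ∑ r ∈ range (d + 1), f r * ζ ^ (d - r) := by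
    have e1 : ∀ r ∈ range (d + 1), (-((((r : ℂ) * X 0 0 + ((d : ℂ) - r) * X 1 1) * f r
        + ((r : ℂ) + 1) * X 0 1 * f (r + 1)
        + (if r = 0 then 0 else ((d : ℂ) - r + 1) * X 1 0 * f (r - 1)))) * ζ ^ (d - r) + f r *
      (((d : ℂ) - r) * ζ ^ (d - r - 1) * (X 1 0 + (X 1 1 - X 0 0) * ζ - X 0 1 * ζ ^ 2))) =
      -((d : ℂ) * (X 0 0 + X 0 1 * ζ)) * (f r * ζ ^ (d - r)) +
      (-X 0 1 * (((r : ℂ) + 1) * f (r + 1) * ζ ^ (d - r)) +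
        X 0 1 * ((r : ℂ) * f r * ζ ^ (d - r + 1)) +
        -X 1 0 * ((if r = 0 then 0 else ((d : ℂ) - r + 1) * f (r - 1)) * ζ ^ (d - r)) +
        X 1 0 * (((d : ℂ) - r) * f r * ζ ^ (d - r - 1))) := by
      intro r hr
      have := hpow r hr
      rw [hX]
      split_ifs
      · linear_combination (-2 * X 0 0 - X 0 1 * ζ) * this
      · linear_combination (-2 * X 0 0 - X 0 1 * ζ) * this
    rw [sum_congr rfl e1]
    simp only [sum_add_distrib, ← mul_sum, s1, s2]
    ring
  rw [← Fin.sum_univ_eq_sum_range (fun r => (-((((r : ℂ) * X 0 0 + ((d : ℂ) - r) * X 1 1) * f r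
        + ((r : ℂ) + 1) * X 0 1 * f (r + 1)
        + (if r = 0 then 0 else ((d : ℂ) - r + 1) * X 1 0 * f (r - 1)))) * ζ ^ (d - r) + f r *
      (((d : ℂ) - r) * ζ ^ (d - r - 1) * (X 1 0 + (X 1 1 - X 0 0) * ζ - X 0 1 * ζ ^ 2))))
      (d + 1), ← Fin.sum_univ_eq_sum_range (fun r => f r * ζ ^ (d - r)) (d + 1)] at key
  simp only [hc]
  rw [← key]
  refine sum_congr rfl fun r _ => ?_
  rw [Nat.cast_sub (by omega)]
  simp only [sl2Field, hc, f]

/-- The constraints on the map are gauge invariant, on solutions. -/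
lemma jac_mapConstraint_mul_gauge (K : Kinematics d d') (x : CSVar d d' → ℂ) :
    jac (mapConstraint K) x * gauge x = 0 := by
  have hsl : ∀ X : Matrix (Fin 2) (Fin 2) ℂ, X 1 1 = -X 0 0 →
      jac (mapConstraint K) x *ᵥ sl2Field x X = 0 := by
    intro X hX
    funext ⟨i, α⟩
    rw [jac_mapConstraint_mulVec]
    have h := sum_sl2Field x X hX α (z x (.inl i))
    have e1 : ∀ r, rho (sl2Field x X) r α = sl2Field x X (.inl (r, α)) := fun r => rfl
    have e2 : z (sl2Field x X) (.inl i) = X 1 0 + (X 1 1 - X 0 0) * z x (.inl i) -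
      X 0 1 * z x (.inl i) ^ 2 := rfl
    have e3 : t (sl2Field x X) (.inl i) = (d : ℂ) * (X 0 0 + X 0 1 * z x (.inl i)) *
      t x (.inl i) := rfl
    simp only [e1, e2, e3, h, lamMap, C_pt, Pi.zero_apply]
    ring
  have hsc : jac (mapConstraint K) x *ᵥ scaleField x = 0 := by
    funext ⟨i, α⟩
    rw [jac_mapConstraint_mulVec]
    have e1 : ∀ r, rho (scaleField x) r α = rho x r α := fun r => rfl
    have e2 : z (scaleField x) (.inl i) = 0 := rfl
    have e3 : t (scaleField x) (.inl i) = -t x (.inl i) := rfl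
    simp only [e1, e2, e3, lamMap, C_pt, Pi.zero_apply, mul_zero, add_zero]
    ring
  ext c j
  have h : jac (mapConstraint K) x *ᵥ (gauge x).col j = 0 := by
    fin_cases j
    · exact hsl !![0, 1; 0, 0] (by simp)
    · exact hsl !![0, 0; 1, 0] (by simp)
    · exact hsl !![1, 0; 0, -1] (by simp)
    · exact hsc
  exact congrFun h c

/-- The change of variables intertwines the two actions up to a compensating `GL(1)`: the scales
contain products over the points `z_i`, so `E` and `H` acquire multiples `∑_i z_i` and `d + 1` of
the scaling generator. The mixing is unitriangular and drops out of the Faddeev–Popov determinants.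
-/
lemma Dom.jac_toAmb_mul_gauge {x : CSVar d d' → ℂ} (hx : Dom x) :
    jac CS.toAmb x * gauge x = Amb.gauge (CS.toAmb x) * gaugeMix x := by
  have hsl : ∀ X : Matrix (Fin 2) (Fin 2) ℂ, X 1 1 = -X 0 0 → ∀ a,
      (jac CS.toAmb x *ᵥ sl2Field x X) (a, 0) = scale x a * (X 0 0 + X 0 1 * z x a -
        tSign a * ((d + 1) * X 0 0 + X 0 1 * ∑ i : Fin (d + 1), z x (.inl i))) ∧
      (jac CS.toAmb x *ᵥ sl2Field x X) (a, 1) = scale x a * (X 1 0 + X 1 1 * z x a -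
        tSign a * ((d + 1) * X 0 0 + X 0 1 * ∑ i : Fin (d + 1), z x (.inl i)) * z x a) := by
    intro X hX a
    have h := hx.fderiv_toAmb (w := sl2Field x X)
      (τ := fun a => (d : ℂ) * (X 0 0 + X 0 1 * z x a))
      (m := fun a b => (X 1 1 - X 0 0) - X 0 1 * (z x a + z x b))
      (fun a => mul_comm _ _) (fun a b => by
        have e : ∀ c, z (sl2Field x X) c = X 1 0 + (X 1 1 - X 0 0) * z x c -
          X 0 1 * z x c ^ 2 := fun c => rfl
        rw [e, e]; ring) a
    have h0 : scaleRate (fun a => (d : ℂ) * (X 0 0 + X 0 1 * z x a))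
        (fun a b => (X 1 1 - X 0 0) - X 0 1 * (z x a + z x b)) a = X 0 0 + X 0 1 * z x a -
        tSign a * ((d + 1) * X 0 0 + X 0 1 * ∑ i : Fin (d + 1), z x (.inl i)) := by
      rcases a with i | p
      · simp only [scaleRate, tSign, Sum.elim_inl]
        have : ∀ i : Fin (d + 1), ∑ j ∈ univ.erase i, z x (.inl j) =
            (∑ j : Fin (d + 1), z x (.inl j)) - z x (.inl i) := fun i => by
          rw [eq_sub_iff_add_eq, sum_erase_add _ _ (mem_univ i)]
        simp only [sum_sub_distrib, mul_add, sum_add_distrib, ← mul_sum, this, sum_const,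
          card_erase_of_mem (mem_univ i), card_univ, Fintype.card_fin, nsmul_eq_mul,
          Nat.add_sub_cancel, hX]
        ring
      · simp only [scaleRate, tSign, Sum.elim_inr]
        simp only [sum_sub_distrib, mul_add, sum_add_distrib, ← mul_sum, sum_const, card_univ,
          Fintype.card_fin, nsmul_eq_mul, hX]
        push_cast
        ring
    rw [h0] at h
    refine ⟨h.1, h.2.trans ?_⟩
    have e : z (sl2Field x X) a = X 1 0 + (X 1 1 - X 0 0) * z x a - X 0 1 * z x a ^ 2 := rfl
    rw [e]; ring
  have hsc : ∀ a, (jac CS.toAmb x *ᵥ scaleField x) (a, 0) = -tSign a * scale x a ∧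
      (jac CS.toAmb x *ᵥ scaleField x) (a, 1) = -tSign a * scale x a * z x a := by
    intro a
    have h := hx.fderiv_toAmb (w := scaleField x) (τ := fun _ => -1) (m := 0)
      (fun a => (neg_eq_neg_one_mul _).trans (mul_comm _ _)) (fun a b => by
        have e : ∀ c, z (scaleField x) c = 0 := fun c => rfl
        rw [e, e]; simp) a
    have h0 : scaleRate (fun _ => (-1 : ℂ)) 0 a = -tSign a := by
      rcases a with i | p <;> simp [scaleRate, tSign]
    have e : z (scaleField x) a = 0 := rfl
    rw [h0, e] at h
    exact ⟨h.1.trans (by ring), h.2.trans (by ring)⟩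
  have hG : ∀ a α, (Sum.elim (fun _ => -CS.toAmb x (a, α)) (fun _ => CS.toAmb x (a, α)) a : ℂ) =
      -tSign a * CS.toAmb x (a, α) := by
    intro a α
    rcases a with i | p <;> simp [tSign]
  have hA0 : ∀ a, CS.toAmb x (a, 0) = scale x a := fun a => by simp [CS.toAmb, pt]
  have hA1 : ∀ a, CS.toAmb x (a, 1) = scale x a * z x a := fun a => by simp [CS.toAmb, pt]
  ext ⟨a, α⟩ j
  change (jac CS.toAmb x *ᵥ (gauge x).col j) (a, α) = _
  have c0 : (gauge x).col 0 = sl2Field x !![0, 1; 0, 0] := rfl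
  have c1 : (gauge x).col 1 = sl2Field x !![0, 0; 1, 0] := rfl
  have c2 : (gauge x).col 2 = sl2Field x !![1, 0; 0, -1] := rfl
  have c3 : (gauge x).col 3 = scaleField x := rfl
  rw [Matrix.mul_apply, Fin.sum_univ_four]
  fin_cases j <;> fin_cases α
  · refine (congrFun (congrArg _ c0) _).trans ((hsl _ (by simp) a).1.trans ?_)
    simp [Amb.gauge, gaugeMix, Amb.pt, hA0, hA1, hG, Matrix.mulVec, dotProduct]
    ring
  · refine (congrFun (congrArg _ c0) _).trans ((hsl _ (by simp) a).2.trans ?_)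
    simp [Amb.gauge, gaugeMix, Amb.pt, hA0, hA1, hG, Matrix.mulVec, dotProduct]
    ring
  · refine (congrFun (congrArg _ c1) _).trans ((hsl _ (by simp) a).1.trans ?_)
    simp [Amb.gauge, gaugeMix, Amb.pt, hA0, hA1, hG, Matrix.mulVec, dotProduct]
  · refine (congrFun (congrArg _ c1) _).trans ((hsl _ (by simp) a).2.trans ?_)
    simp [Amb.gauge, gaugeMix, Amb.pt, hA0, hA1, hG, Matrix.mulVec, dotProduct]
  · refine (congrFun (congrArg _ c2) _).trans ((hsl _ (by simp) a).1.trans ?_)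
    simp [Amb.gauge, gaugeMix, Amb.pt, hA0, hA1, hG, Matrix.mulVec, dotProduct]
    ring
  · refine (congrFun (congrArg _ c2) _).trans ((hsl _ (by simp) a).2.trans ?_)
    simp [Amb.gauge, gaugeMix, Amb.pt, hA0, hA1, hG, Matrix.mulVec, dotProduct]
    ring
  · refine (congrFun (congrArg _ c3) _).trans ((hsc a).1.trans ?_)
    simp [Amb.gauge, gaugeMix, Amb.pt, hA0, hA1, hG, Matrix.mulVec, dotProduct]
  · refine (congrFun (congrArg _ c3) _).trans ((hsc a).2.trans ?_)
    simp [Amb.gauge, gaugeMix, Amb.pt, hA0, hA1, hG, Matrix.mulVec, dotProduct]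
    ring

lemma Dom.varChange_mul_gauge {x : CSVar d d' → ℂ} (hx : Dom x) (K : Kinematics d d') :
    varChange K x * gauge x = Matrix.fromRows 0 (Amb.gauge (CS.toAmb x)) * gaugeMix x := by
  rw [varChange, Matrix.fromRows_mul, Matrix.fromRows_mul, jac_mapConstraint_mul_gauge,
    hx.jac_toAmb_mul_gauge, Matrix.zero_mul]

end CS
end

/-! ### The finite action of the gauge group on the punctures -/

noncomputable section

namespace Amb

open Finset

variable {d d' : ℕ}

/-- The factors by which `GL(1)` scales the punctures. -/
def charge (c : ℂ) : Particle d d' → ℂ := Sum.elim (fun _ => c⁻¹) (fun _ => c)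

/-- The action of an element of `SL(2) × GL(1)` on the punctures. -/
def act (g : Matrix (Fin 2) (Fin 2) ℂ) (c : ℂ) : Matrix (AmbVar d d') (AmbVar d d') ℂ :=
  (Matrix.blockDiagonal fun a : Particle d d' => charge c a • g).submatrix
    (Equiv.prodComm _ _) (Equiv.prodComm _ _)

lemma act_mulVec (g : Matrix (Fin 2) (Fin 2) ℂ) (c : ℂ) (x : AmbVar d d' → ℂ)
    (a : Particle d d') : pt (act g c *ᵥ x) a = charge c a • (g *ᵥ pt x a) := by
  funext α
  change ∑ v : Particle d d' × Fin 2, act g c (a, α) v * x v = _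
  rw [Fintype.sum_prod_type, sum_eq_single a]
  · simp only [act, Matrix.submatrix_apply, Equiv.prodComm_apply, Prod.swap_prod_mk,
      Matrix.blockDiagonal_apply, if_true, Matrix.smul_apply, smul_eq_mul, Pi.smul_apply,
      Matrix.mulVec, dotProduct, pt, mul_sum, mul_assoc]
  · intro b _ hb
    simp [act, Matrix.blockDiagonal_apply, hb.symm]
  · simp

lemma act_mul_mulVec (g h : Matrix (Fin 2) (Fin 2) ℂ) (b c : ℂ) (x : AmbVar d d' → ℂ) :
    act g b *ᵥ (act h c *ᵥ x) = act (g * h) (b * c) *ᵥ x := by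
  have : ∀ a, pt (act g b *ᵥ (act h c *ᵥ x)) a = pt (act (g * h) (b * c) *ᵥ x) a := by
    intro a
    rw [act_mulVec, act_mulVec, act_mulVec, Matrix.mulVec_smul, smul_smul, Matrix.mulVec_mulVec]
    congr 1
    rcases a with i | p <;> simp [charge, mul_comm]
  funext v
  exact congrFun (this v.1) v.2

lemma act_one_mulVec (x : AmbVar d d' → ℂ) : act 1 1 *ᵥ x = x := by
  have : ∀ a, pt (act 1 1 *ᵥ x) a = pt x a := by
    intro a
    rw [act_mulVec, Matrix.one_mulVec]
    rcases a with i | p <;> simp [charge]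
  funext v
  exact congrFun (this v.1) v.2

lemma orbit_iff {x y : AmbVar d d' → ℂ} : orbit x y ↔
    ∃ (g : Matrix.SpecialLinearGroup (Fin 2) ℂ) (c : ℂ), c ≠ 0 ∧ y = act g.1 c *ᵥ x := by
  constructor
  · rintro ⟨g, c, hc, hi, hp⟩
    refine ⟨g, c, hc, ?_⟩
    have : ∀ a, pt y a = pt (act g.1 c *ᵥ x) a := by
      rintro (i | p)
      · rw [act_mulVec, hi]; rfl
      · rw [act_mulVec, hp]; rfl
    funext v
    exact congrFun (this v.1) v.2
  · rintro ⟨g, c, hc, rfl⟩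
    exact ⟨g, c, hc, fun i => act_mulVec _ _ _ _, fun p => act_mulVec _ _ _ _⟩

lemma orbit_refl (x : AmbVar d d' → ℂ) : orbit x x :=
  orbit_iff.2 ⟨1, 1, one_ne_zero, by
    rw [Matrix.SpecialLinearGroup.coe_one, act_one_mulVec]⟩

lemma orbit_trans {x y w : AmbVar d d' → ℂ} (h : orbit x y) (h' : orbit y w) : orbit x w := by
  obtain ⟨g, c, hc, rfl⟩ := orbit_iff.1 h
  obtain ⟨g', c', hc', rfl⟩ := orbit_iff.1 h'
  exact orbit_iff.2 ⟨g' * g, c' * c, mul_ne_zero hc' hc, by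
    rw [act_mul_mulVec, Matrix.SpecialLinearGroup.coe_mul]⟩

lemma orbit_symm {x y : AmbVar d d' → ℂ} (h : orbit x y) : orbit y x := by
  obtain ⟨g, c, hc, rfl⟩ := orbit_iff.1 h
  refine orbit_iff.2 ⟨g⁻¹, c⁻¹, inv_ne_zero hc, ?_⟩
  rw [act_mul_mulVec, ← Matrix.SpecialLinearGroup.coe_mul, inv_mul_cancel, inv_mul_cancel₀ hc,
    Matrix.SpecialLinearGroup.coe_one, act_one_mulVec]

lemma br_mulVec (g : Matrix (Fin 2) (Fin 2) ℂ) (s u : Fin 2 → ℂ) :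
    br (g *ᵥ s) (g *ᵥ u) = g.det * br s u := by
  simp only [br, Matrix.mulVec, dotProduct, Fin.sum_univ_two, Matrix.det_fin_two]
  ring

lemma br_smul (a b : ℂ) (s u : Fin 2 → ℂ) : br (a • s) (b • u) = a * b * br s u := by
  simp only [br, Pi.smul_apply, smul_eq_mul]
  ring

variable (g : Matrix.SpecialLinearGroup (Fin 2) ℂ) {c : ℂ} (hc : c ≠ 0)

lemma br_act (c : ℂ) (x : AmbVar d d' → ℂ) (a b : Particle d d') :
    br (pt (act g.1 c *ᵥ x) a) (pt (act g.1 c *ᵥ x) b) =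
      charge c a * charge c b * br (pt x a) (pt x b) := by
  rw [act_mulVec, act_mulVec, br_smul, br_mulVec, g.2, one_mul]

include hc

lemma charge_ne_zero (a : Particle d d') : charge c a ≠ 0 := by
  rcases a with i | p
  · exact inv_ne_zero hc
  · exact hc

lemma dom_act {x : AmbVar d d' → ℂ} (hx : Dom x) : Dom (act g.1 c *ᵥ x) := by
  intro a b hab
  rw [br_act]
  exact mul_ne_zero (mul_ne_zero (charge_ne_zero hc a) (charge_ne_zero hc b)) (hx a b hab)

lemma constraint_act (K : Kinematics d d') (x : AmbVar d d' → ℂ) :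
    constraint K (act g.1 c *ᵥ x) = constraint K x := by
  have h1 : ∀ (i : Fin (d + 1)) (p : Fin (d' + 1)), charge c (.inl i : Particle d d') *
      charge c (.inr p : Particle d d') = 1 := fun i p => inv_mul_cancel₀ hc
  have h2 : ∀ (i : Fin (d + 1)) (p : Fin (d' + 1)), charge c (.inr p : Particle d d') *
      charge c (.inl i : Particle d d') = 1 := fun i p => mul_inv_cancel₀ hc
  funext ⟨a, α⟩
  rcases a with i | p
  · simp only [constraint, lamtMap, br_act, h1, one_mul]
  · simp only [constraint, lamMap, br_act, h2, one_mul]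

/-- This is the derivative of the invariance `constraint_act`, as the action is linear in the
punctures. -/
lemma jac_act (K : Kinematics d d') {x : AmbVar d d' → ℂ} (hx : Dom x) :
    jac (constraint K) x = jac (constraint K) (act g.1 c *ᵥ x) * act g.1 c := by
  have h := jac_comp (f := constraint K) (g := fun y => act g.1 c *ᵥ y) (x := x)
    ((dom_act g hc hx).differentiableAt_constraint K)
    (fun v => (HasFDerivAt.fun_sum (u := univ) fun e _ =>
      (hasFDerivAt_apply (𝕜 := ℂ) e x).const_mul (act g.1 c v e)).differentiableAt)
  rw [jac_toLin] at h
  rw [← h]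
  congr 1
  funext y
  exact (constraint_act g hc K y).symm

omit hc

/-- The adjoint representation on `sl(2) ⊕ gl(1)`. -/
def adjoint : Matrix (Fin 4) (Fin 4) ℂ :=
  !![g.1 0 0 ^ 2, -g.1 0 1 ^ 2, -2 * g.1 0 0 * g.1 0 1, 0;
    -g.1 1 0 ^ 2, g.1 1 1 ^ 2, 2 * g.1 1 0 * g.1 1 1, 0;
    -g.1 0 0 * g.1 1 0, g.1 0 1 * g.1 1 1, g.1 0 0 * g.1 1 1 + g.1 0 1 * g.1 1 0, 0;
    0, 0, 0, 1]

lemma adjoint_det : (adjoint g).det = 1 := by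
  have h := g.2
  rw [Matrix.det_fin_two] at h
  have : (adjoint g).det = (g.1 0 0 * g.1 1 1 - g.1 0 1 * g.1 1 0) ^ 3 := by
    simp [adjoint, Matrix.det_succ_row_zero, Fin.sum_univ_succ, Fin.succAbove]
    ring
  rw [this, h, one_pow]

/-- Since `g X σ = (g X g⁻¹) (g σ)`, the generators are conjugated; the scaling commutes with the
action. The condition `det g = 1` enters in every entry of the `sl(2)` part. -/
lemma act_mul_gauge (c : ℂ) (x : AmbVar d d' → ℂ) :
    act g.1 c * gauge x = gauge (act g.1 c *ᵥ x) * adjoint g := by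
  have h := g.2
  rw [Matrix.det_fin_two] at h
  have hcol : ∀ w : AmbVar d d' → ℂ, ∀ a α, (act g.1 c *ᵥ w) (a, α) =
      charge c a * (g.1 α 0 * w (a, 0) + g.1 α 1 * w (a, 1)) := by
    intro w a α
    have := congrFun (act_mulVec g.1 c w a) α
    rw [Pi.smul_apply, smul_eq_mul, Matrix.mulVec, dotProduct, Fin.sum_univ_two] at this
    exact this
  have hG : ∀ (y : AmbVar d d' → ℂ) a α,
      (Sum.elim (fun _ => -y (a, α)) (fun _ => y (a, α)) a : ℂ) = -CS.tSign a * y (a, α) := by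
    intro y a α
    rcases a with i | p <;> simp [CS.tSign]
  ext ⟨a, α⟩ j
  change (act g.1 c *ᵥ (gauge x).col j) (a, α) = _
  rw [Matrix.mul_apply, Fin.sum_univ_four, hcol]
  have hy := hcol x
  generalize act g.1 c *ᵥ x = y at hy ⊢
  fin_cases j <;> fin_cases α <;>
    simp only [gauge, adjoint, pt, hy, hG, Matrix.col, Matrix.mulVec, dotProduct,
      Fin.sum_univ_two, Matrix.of_apply, Matrix.transpose_apply, Matrix.cons_val',
      Matrix.cons_val_zero, Matrix.cons_val_one, Matrix.cons_val, Fin.zero_eta, Fin.mk_one,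
      Fin.reduceFinMk, Fin.isValue]
  · linear_combination (-charge c a * g.1 0 0 * x (a, 1)) * h
  · linear_combination (-charge c a * g.1 1 0 * x (a, 1)) * h
  · linear_combination (-charge c a * g.1 0 1 * x (a, 0)) * h
  · linear_combination (-charge c a * g.1 1 1 * x (a, 0)) * h
  · linear_combination (-charge c a * (g.1 0 0 * x (a, 0) - g.1 0 1 * x (a, 1))) * h
  · linear_combination (-charge c a * (g.1 1 0 * x (a, 0) - g.1 1 1 * x (a, 1))) * h
  · rcases a with i | p <;> simp only [CS.tSign, Sum.elim_inl, Sum.elim_inr] <;> ring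
  · rcases a with i | p <;> simp only [CS.tSign, Sum.elim_inl, Sum.elim_inr] <;> ring

lemma act_det (c : ℂ) : (act g.1 c : Matrix (AmbVar d d') (AmbVar d d') ℂ).det =
    (c⁻¹ ^ (d + 1) * c ^ (d' + 1)) ^ 2 := by
  rw [act, Matrix.det_submatrix_equiv_self, Matrix.det_blockDiagonal]
  simp only [Matrix.det_smul, g.2, Fintype.card_fin, mul_one, prod_pow]
  simp [charge, Fintype.prod_sum_type]

end Amb
end

/-! ### Transport of nondegenerate solutions and of their weights -/

noncomputable section

namespace CS

open Finset Matrix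

variable {d d' : ℕ}

lemma extConstraint_eq_zero_iff (K : Kinematics d d') (x : CSVar d d' → ℂ) :
    extConstraint K x = 0 ↔ mapConstraint K x = 0 ∧ Amb.constraint K (toAmb x) = 0 := by
  constructor
  · intro h
    exact ⟨funext fun v => congrFun h (.inl v), funext fun v => congrFun h (.inr v)⟩
  · rintro ⟨h1, h2⟩
    funext v
    rcases v with v | v
    · exact congrFun h1 v
    · exact congrFun h2 v

section

variable (g : Matrix.SpecialLinearGroup (Fin 2) ℂ) {c : ℂ} (hc : c ≠ 0)

/-- The differential of the change of variables, followed by a gauge transformation. -/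
def transport (c : ℂ) (K : Kinematics d d') (x : CSVar d d' → ℂ) :
    Matrix (CSVar d d') (CSVar d d') ℂ :=
  fromBlocks (1 : Matrix (Fin (d + 1) × Fin 2) (Fin (d + 1) × Fin 2) ℂ) 0 0 (Amb.act g.1 c) *
    varChange K x

lemma transport_det (c : ℂ) (K : Kinematics d d') (x : CSVar d d' → ℂ) :
    (transport g c K x).det =
      (Amb.act g.1 c : Matrix (AmbVar d d') (AmbVar d d') ℂ).det * (varChange K x).det := by
  rw [transport, det_mul, det_fromBlocks_zero₂₁, det_one, one_mul]

lemma Dom.transport_mul_gauge {x : CSVar d d' → ℂ} (hx : Dom x) (c : ℂ) (K : Kinematics d d') :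
    transport g c K x * gauge x =
      fromRows 0 (Amb.gauge (Amb.act g.1 c *ᵥ CS.toAmb x)) * (Amb.adjoint g * gaugeMix x) := by
  rw [transport, Matrix.mul_assoc, hx.varChange_mul_gauge, ← Matrix.mul_assoc,
    fromBlocks_mul_fromRows, ← Matrix.mul_assoc]
  simp only [Matrix.one_mul, Matrix.zero_mul, Matrix.mul_zero, add_zero, zero_add, fromRows_mul]
  exact congrArg (fun M => fromRows 0 (M * gaugeMix x)) (Amb.act_mul_gauge g c (CS.toAmb x))

include hc

lemma Dom.transport_det_ne_zero {x : CSVar d d' → ℂ} (hx : Dom x) (K : Kinematics d d') :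
    (transport g c K x).det ≠ 0 := by
  rw [transport_det, Amb.act_det]
  exact mul_ne_zero (pow_ne_zero _ (mul_ne_zero (pow_ne_zero _ (inv_ne_zero hc))
    (pow_ne_zero _ hc))) (hx.varChange_det_ne_zero K)

lemma Dom.jac_constraint_transport {x : CSVar d d' → ℂ} (hx : Dom x) (K : Kinematics d d')
    (h : extConstraint K x = 0) :
    jac (constraint K) x = relation x *
      fromBlocks 1 0 0 (jac (Amb.constraint K) (Amb.act g.1 c *ᵥ CS.toAmb x)) *
        transport g c K x := by
  rw [hx.jac_constraint h, Amb.jac_act g hc K hx.toAmb, transport, Matrix.mul_assoc,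
    Matrix.mul_assoc, ← Matrix.mul_assoc (fromBlocks _ _ _ _), fromBlocks_multiply]
  simp

/-- Both constraint vanishing and nondegeneracy pass through the factorised Jacobian. The gauge
transformation `(g, c)` is arbitrary because the image of `x` need not lie in the slice chosen on
the ambitwistor side. -/
lemma Dom.mem_solutions_iff {x : CSVar d d' → ℂ} (hx : Dom x) (K : Kinematics d d') :
    x ∈ (system K).solutions ↔ mapConstraint K x = 0 ∧
      Amb.act g.1 c *ᵥ CS.toAmb x ∈ (Amb.system K).solutions := by
  have key : extConstraint K x = 0 → (GaugeNondegenerate (jac (constraint K) x) (gauge x)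
      (of (mom K x)) ↔ GaugeNondegenerate (jac (Amb.constraint K) (Amb.act g.1 c *ᵥ CS.toAmb x))
      (Amb.gauge (Amb.act g.1 c *ᵥ CS.toAmb x)) (of (Amb.mom K))) := by
    intro h
    rw [gaugeNondegenerate_mul_mul_iff (hx.jac_constraint_transport g hc K h)
      (hx.transport_mul_gauge g c K) (mom_mul_relation K h) hx.relation_det_ne_zero
      (hx.transport_det_ne_zero g hc K)
      (by rw [det_mul, Amb.adjoint_det, gaugeMix_det, one_mul]),
      gaugeNondegenerate_fromBlocks_one_iff]
  have hact := Amb.constraint_act g hc K (CS.toAmb x)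
  constructor
  · rintro ⟨-, h0, hnd⟩
    have h1 := (hx.constraint_eq_zero_iff K).1 h0
    have h2 := (extConstraint_eq_zero_iff K x).1 h1
    exact ⟨h2.1, Amb.dom_act g hc hx.toAmb, hact.trans h2.2, (key h1).1 hnd⟩
  · rintro ⟨hm, -, h0, hnd⟩
    have h1 := (extConstraint_eq_zero_iff K x).2 ⟨hm, hact.symm.trans h0⟩
    exact ⟨hx, (hx.constraint_eq_zero_iff K).2 h1, (key h1).2 hnd⟩

/-- This is the transformation law of the weights for the factorised Jacobian. The chosen gauge
conditions and traded constraints of the two sides are unrelated, and only their transversality is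
used. -/
lemma weight_eq {K : Kinematics d d'} (gCS : (system K).GaugeFixing)
    (gAmb : (Amb.system K).GaugeFixing) {x : CSVar d d' → ℂ} (hx : x ∈ gCS.slice)
    (hy : Amb.act g.1 c *ᵥ toAmb x ∈ gAmb.slice) :
    gCS.weight x * ((relation x).det * (transport g c K x).det) =
      gAmb.weight (Amb.act g.1 c *ᵥ toAmb x) := by
  have hs := gCS.slice_subset hx
  have hd : Dom x := hs.1
  have h0 := (hd.constraint_eq_zero_iff K).1 hs.2.1
  have hys := gAmb.slice_subset hy
  have hyd : Amb.Dom (Amb.act g.1 c *ᵥ toAmb x) := hys.1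
  have h := fpWeight_mul_mul (J := fromBlocks 1 0 0 (jac (Amb.constraint K)
      (Amb.act g.1 c *ᵥ toAmb x))) (G := fromRows 0 (Amb.gauge (Amb.act g.1 c *ᵥ toAmb x)))
    (L := fromCols 0 (of (Amb.mom K)))
    (A := fromCols 0 (gAmb.cond (Amb.act g.1 c *ᵥ toAmb x)))
    (B := fromRows 0 (gAmb.trade (Amb.act g.1 c *ᵥ toAmb x)))
    (A' := gCS.cond x) (B' := gCS.trade x)
    (by rw [fromBlocks_mul_fromRows]; simp [hyd.jac_mul_gauge K])
    (by rw [fromCols_mul_fromBlocks]; simp [hyd.mom_mul_jac K])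
    (hd.jac_constraint_transport g hc K h0) (hd.transport_mul_gauge g c K)
    (mom_mul_relation K h0) hd.relation_det_ne_zero (hd.transport_det_ne_zero g hc K)
    (by rw [det_mul, Amb.adjoint_det, gaugeMix_det, one_mul])
    (by rw [fromCols_mul_fromRows]; simp only [Matrix.zero_mul, zero_add]
        exact gAmb.cond_ne_zero _ hy)
    (by rw [fromCols_mul_fromRows]; simp only [Matrix.zero_mul, zero_add]
        exact gAmb.trade_ne_zero _ hy)
    (gCS.cond_ne_zero x hx) (gCS.trade_ne_zero x hx)
  rw [fpWeight_fromBlocks_one] at h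
  exact h

end

end CS
end

/-! ### Gauge covariance of the ambitwistor integrand and polynomial form of a solution -/

noncomputable section

open Finset Matrix Polynomial

variable {d d' : ℕ}

namespace Amb

/-- The particles other than `i₀` and `p₀`. -/
def succAboveEquiv (i₀ : Fin (d + 1)) (p₀ : Fin (d' + 1)) :
    Fin d ⊕ Fin d' ≃ {a : Particle d d' // a ≠ .inl i₀ ∧ a ≠ .inr p₀} :=
  Equiv.ofBijective
    (fun v => ⟨Sum.map i₀.succAbove p₀.succAbove v, by
      rcases v with i | p <;> simp [Fin.succAbove_ne]⟩)
    ⟨fun v w h => (Sum.map_injective.2 ⟨Fin.succAbove_right_injective,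
      Fin.succAbove_right_injective⟩) (congrArg Subtype.val h), by
      rintro ⟨i | p, h1, h2⟩
      · obtain ⟨j, rfl⟩ := Fin.exists_succAbove_eq fun h => h1 (congrArg Sum.inl h)
        exact ⟨.inl j, rfl⟩
      · obtain ⟨j, rfl⟩ := Fin.exists_succAbove_eq fun h => h2 (congrArg Sum.inr h)
        exact ⟨.inr j, rfl⟩⟩

lemma detH_eq (K : Kinematics d d') (i₀ : Fin (d + 1)) (p₀ : Fin (d' + 1))
    (x : AmbVar d d' → ℂ) : detH K i₀ p₀ x =
      ((H K x).submatrix i₀.succAbove i₀.succAbove).det *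
        ((Ht K x).submatrix p₀.succAbove p₀.succAbove).det := by
  rw [detH, ← det_submatrix_equiv_self (succAboveEquiv i₀ p₀), submatrix_submatrix,
    ← det_fromBlocks_zero₂₁ _ 0]
  congr 1
  ext (i | p) (j | q) <;> rfl

section

variable (g : Matrix.SpecialLinearGroup (Fin 2) ℂ) {c : ℂ} (hc : c ≠ 0)

include hc

lemma H_act (K : Kinematics d d') (x : AmbVar d d' → ℂ) :
    H K (act g.1 c *ᵥ x) = c ^ 2 • H K x := by
  have h : ∀ i j, br (K.lam (.inl i)) (K.lam (.inl j)) /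
      br (pt (act g.1 c *ᵥ x) (.inl i)) (pt (act g.1 c *ᵥ x) (.inl j)) =
      c ^ 2 * (br (K.lam (.inl i)) (K.lam (.inl j)) / br (pt x (.inl i)) (pt x (.inl j))) := by
    intro i j
    rw [br_act]
    simp only [charge, Sum.elim_inl]
    rw [div_mul_eq_div_div, div_mul_eq_div_div_swap, div_inv_eq_mul, div_inv_eq_mul]
    ring
  ext i j
  simp only [H, h, of_apply, Matrix.smul_apply, smul_eq_mul]
  split_ifs
  · rw [mul_neg, mul_sum]
  · rfl

lemma Ht_act (K : Kinematics d d') (x : AmbVar d d' → ℂ) :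
    Ht K (act g.1 c *ᵥ x) = c⁻¹ ^ 2 • Ht K x := by
  have h : ∀ i j, br (K.lamt (.inr i)) (K.lamt (.inr j)) /
      br (pt (act g.1 c *ᵥ x) (.inr i)) (pt (act g.1 c *ᵥ x) (.inr j)) =
      c⁻¹ ^ 2 * (br (K.lamt (.inr i)) (K.lamt (.inr j)) / br (pt x (.inr i)) (pt x (.inr j))) := by
    intro i j
    rw [br_act]
    simp only [charge, Sum.elim_inr]
    rw [div_mul_eq_div_div]
    ring
  ext i j
  simp only [Ht, h, of_apply, Matrix.smul_apply, smul_eq_mul]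
  split_ifs
  · rw [mul_neg, mul_sum]
  · rfl

/-- The measure scales by `c ^ (2 (d' - d))` and the reduced determinant, with `d` rows of `ℍ` and
`d'` rows of `ℍ̃`, by the inverse power. -/
lemma act_det_mul_detH (K : Kinematics d d') (i₀ : Fin (d + 1)) (p₀ : Fin (d' + 1))
    (x : AmbVar d d' → ℂ) :
    (act g.1 c : Matrix (AmbVar d d') (AmbVar d d') ℂ).det * detH K i₀ p₀ (act g.1 c *ᵥ x) =
      detH K i₀ p₀ x := by
  rw [act_det, detH_eq, detH_eq, H_act g hc, Ht_act g hc]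
  simp only [submatrix_smul, Pi.smul_apply, det_smul, Fintype.card_fin]
  have h1 : c⁻¹ ^ (d + 1) * c ^ (d + 1) = 1 := by rw [← mul_pow, inv_mul_cancel₀ hc, one_pow]
  have h2 : c⁻¹ ^ (d' + 1) * c ^ (d' + 1) = 1 := by rw [← mul_pow, inv_mul_cancel₀ hc, one_pow]
  have h3 : c⁻¹ * c = 1 := inv_mul_cancel₀ hc
  have h4 : (c⁻¹ ^ (d + 1) * c ^ (d' + 1)) ^ 2 * ((c ^ 2) ^ d * (c⁻¹ ^ 2) ^ d') = 1 := by
    have : (c⁻¹ ^ (d + 1) * c ^ (d' + 1)) ^ 2 * ((c ^ 2) ^ d * (c⁻¹ ^ 2) ^ d') =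
        (c⁻¹ * c) ^ (2 * d + 2 * d' + 2) := by rw [mul_pow c⁻¹ c]; ring
    rw [this, h3, one_pow]
  linear_combination (((H K x).submatrix i₀.succAbove i₀.succAbove).det *
        ((Ht K x).submatrix p₀.succAbove p₀.succAbove).det) * h4

lemma fermions_act (N : ℕ) (x : AmbVar d d' → ℂ) :
    fermions N (act g.1 c *ᵥ x) = fermions N x := by
  have h : ∀ (i : Fin (d + 1)) (p : Fin (d' + 1)), charge c (.inr p : Particle d d') *
      charge c (.inl i : Particle d d') = 1 := fun i p => mul_inv_cancel₀ hc
  simp only [fermions, br_act, h, one_mul]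

end

end Amb

namespace CS

/-- For `λ` this is the map itself. For `λ̃` it is the dual statement: the interpolant of degree
`d'` through the points `z_p` takes the right values at the `z_i` as well, and this is precisely
`λ̃_i = λ̃(σ_i)`. -/
lemma exists_polynomials {x : CSVar d d' → ℂ} (hx : Dom x) {K : Kinematics d d'}
    (h0 : constraint K x = 0) : ∃ P Q : Fin 2 → ℂ[X],
      (∀ α, (P α).natDegree ≤ d) ∧ (∀ α, (Q α).natDegree ≤ d') ∧
      (∀ a α, K.lam a α = t x a * (P α).eval (z x a)) ∧
      ∀ a α, t x a * nodeProd (z x) a * K.lamt a α = (Q α).eval (z x a) := by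
  have hamb := ((extConstraint_eq_zero_iff K x).1 ((hx.constraint_eq_zero_iff K).1 h0)).2
  -- The second witness is that interpolant: at `z_p` the factor `1 / s_p` and the product over `q ≠
  -- p` combine to `t_p` times the full node product.
  refine ⟨fun α => ∑ r : Fin (d + 1), Polynomial.C (rho x r α) * X ^ (d - r : ℕ),
    fun α => ∑ p : Fin (d' + 1), Polynomial.C (K.lamt (.inr p) α / scale x (.inr p)) *
      ∏ q ∈ univ.erase p, (Polynomial.C (z x (.inr q)) - X), ?_, ?_, ?_, ?_⟩
  · intro α
    refine natDegree_sum_le_of_forall_le _ _ fun r _ => ?_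
    exact (natDegree_C_mul_X_pow_le _ _).trans (by omega)
  · intro α
    refine natDegree_sum_le_of_forall_le _ _ fun p _ => (natDegree_C_mul_le _ _).trans ?_
    refine (natDegree_prod_le _ _).trans ((sum_le_card_nsmul _ _ 1 fun q _ => ?_).trans ?_)
    · exact natDegree_sub_le_of_le ((natDegree_C _).le.trans zero_le_one) natDegree_X_le
    · simp [card_erase_of_mem]
  · intro a α
    have h := sub_eq_zero.1 (congrFun h0 (.inr (a, α)))
    rw [h]
    simp only [lamMap, C_pt, eval_finsetSum, eval_mul, eval_C, eval_pow, eval_X]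
  · intro a α
    simp only [eval_finsetSum, eval_mul, eval_C, eval_prod, eval_sub, eval_X]
    rcases a with i | p
    · have h := sub_eq_zero.1 (congrFun hamb (.inl i, α))
      rw [h, nodeProd_inl, Amb.lamtMap, mul_sum]
      refine sum_congr rfl fun p _ => ?_
      rw [br_toAmb, ← mul_prod_erase univ _ (mem_univ p)]
      have h1 : scale x (.inl i) ≠ 0 := hx.scale_ne_zero _
      have h2 : scale x (.inr p) ≠ 0 := hx.scale_ne_zero _
      have h3 : z x (.inr p) - z x (.inl i) ≠ 0 := hx.sub_ne_zero (by simp)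
      have h4 : scale x (.inl i) = t x (.inl i) * nodeProd (z x ∘ Sum.inl) i := rfl
      field_simp
      rw [h4]
      ring
    · rw [sum_eq_single p, nodeProd_inr]
      · have h1 : scale x (.inr p) =
          (t x (.inr p) * ∏ i : Fin (d + 1), (z x (.inl i) - z x (.inr p)))⁻¹ := rfl
        rw [h1, div_inv_eq_mul]
        simp only [nodeProd, Function.comp_apply]
        ring
      · intro q _ hq
        rw [prod_eq_zero (mem_erase.2 ⟨hq.symm, mem_univ p⟩) (sub_self _), mul_zero]
      · simp

/-- A bracket of two values of a polynomial spinor is antisymmetric in the points, so it is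
divisible by `z_b - z_a`; the quotient is the Bézoutian of the two components. -/
lemma exists_kernels {x : CSVar d d' → ℂ} (hx : Dom x) {K : Kinematics d d'}
    (h0 : constraint K x = 0) :
    ∃ (N : Matrix (Fin d) (Fin d) ℂ) (M : Matrix (Fin d') (Fin d') ℂ),
      (∀ a b, a ≠ b → br (K.lam a) (K.lam b) / (z x b - z x a) =
        t x a * t x b * kernelEval N (z x a) (z x b)) ∧
      ∀ a b, a ≠ b → br (K.lamt a) (K.lamt b) / (z x b - z x a) =
        kernelEval M (z x a) (z x b) / (t x a * nodeProd (z x) a * (t x b * nodeProd (z x) b)) := by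
  obtain ⟨P, Q, hP, hQ, hl, hlt⟩ := exists_polynomials hx h0
  obtain ⟨N, hN⟩ := exists_bezoutian (hP 0) (hP 1)
  obtain ⟨M, hM⟩ := exists_bezoutian (hQ 0) (hQ 1)
  refine ⟨N, M, fun a b hab => ?_, fun a b hab => ?_⟩
  · rw [div_eq_iff (hx.sub_ne_zero hab.symm), mul_assoc, mul_comm (kernelEval _ _ _), hN]
    simp only [br, hl]
    ring
  · have h1 : ∀ a, t x a * nodeProd (z x) a ≠ 0 := fun a =>
      mul_ne_zero (hx.2 a) (nodeProd_ne_zero hx.injective a)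
    rw [div_eq_div_iff (hx.sub_ne_zero hab.symm) (mul_ne_zero (h1 a) (h1 b)),
      mul_comm (kernelEval _ _ _), hM, ← hlt, ← hlt, ← hlt, ← hlt]
    simp only [br]
    ring

end CS
end

/-! ### The reduced determinants and the contribution of one solution -/

noncomputable section

open Finset Matrix Polynomial

variable {d d' : ℕ}

namespace CS

/-- The polynomial whose roots are the given reference spinors. -/
def refPoly {m : ℕ} (u : Fin m → Fin 2 → ℂ) : ℂ[X] :=
  ∏ r, (Polynomial.C (u r 1) - X * Polynomial.C (u r 0))

lemma refPoly_natDegree {m : ℕ} (u : Fin m → Fin 2 → ℂ) : (refPoly u).natDegree ≤ m := by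
  refine (natDegree_prod_le _ _).trans ((sum_le_card_nsmul _ _ 1 fun r _ => ?_).trans (by simp))
  exact natDegree_sub_le_of_le ((natDegree_C _).le.trans zero_le_one)
    ((natDegree_mul_C_le _ _).trans natDegree_X_le)

lemma refPoly_eval {m : ℕ} (u : Fin m → Fin 2 → ℂ) (x : CSVar d d' → ℂ) (a : Particle d d') :
    (refPoly u).eval (z x a) = ∏ r, br (pt x a) (u r) := by
  simp only [refPoly, eval_prod, eval_sub, eval_mul, eval_C, eval_X]
  exact prod_congr rfl fun r _ => by simp [br, pt]

lemma vandermonde_eq {m : ℕ} (x : CSVar d d' → ℂ) (e : Fin m → Particle d d') :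
    vandermonde x e = (Matrix.vandermonde (z x ∘ e)).det := by
  simp only [vandermonde, br_pt, det_vandermonde, Function.comp_apply]

lemma prod_br_erase (x : CSVar d d' → ℂ) (a : Particle d d') :
    ∏ e ∈ univ.erase a, br (pt x a) (pt x e) = nodeProd (z x) a := by
  simp only [br_pt, nodeProd]

variable {x : CSVar d d' → ℂ} (hx : Dom x) {K : Kinematics d d'}

include hx

/-- Off the diagonal this is the definition of the kernel. On the diagonal the reference spinors are
the roots of a polynomial of degree at most `d' + 1`, and `d + (d' + 1) < n` just allows
`kernelEval_diag` to apply; their contribution drops out. -/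
lemma Dom.Phi_apply {N : Matrix (Fin d) (Fin d) ℂ}
    (hN : ∀ a b, a ≠ b → br (K.lam a) (K.lam b) / (z x b - z x a) =
      t x a * t x b * kernelEval N (z x a) (z x b)) {u : Fin (d' + 1) → Fin 2 → ℂ}
    {a b : Particle d d'} (hu : a = b → ∀ r, br (pt x a) (u r) ≠ 0) :
    Phi K x u a b = kernelEval N (z x a) (z x b) := by
  have hoff : ∀ a b, a ≠ b → br (K.lam a) (K.lam b) / br (pt x a) (pt x b) *
      (1 / (t x a * t x b)) = kernelEval N (z x a) (z x b) := by
    intro a b hab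
    rw [br_pt, hN a b hab, mul_one_div, mul_div_cancel_left₀ _ (mul_ne_zero (hx.2 a) (hx.2 b))]
  simp only [Phi, of_apply]
  split_ifs with h
  · subst h
    have hU : (refPoly u).eval (z x a) ≠ 0 := by
      rw [refPoly_eval]; exact prod_ne_zero_iff.2 fun r _ => hu rfl r
    have hD := nodeProd_ne_zero hx.injective a
    have hk := kernelEval_diag N hx.injective (U := refPoly u) (by
      have := refPoly_natDegree u
      simp only [Fintype.card_sum, Fintype.card_fin]; omega) a
    refine mul_right_cancel₀ (div_ne_zero hU hD) (Eq.trans ?_ hk.symm)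
    rw [neg_mul, sum_mul]
    congr 1
    refine sum_congr rfl fun c hc => ?_
    have hD' := nodeProd_ne_zero hx.injective c
    rw [hoff a c (ne_of_mem_erase hc).symm, prod_br_erase, prod_br_erase, prod_div_distrib,
      ← refPoly_eval, ← refPoly_eval]
    field_simp
  · exact hoff a b h

lemma Dom.Phit_apply {M : Matrix (Fin d') (Fin d') ℂ}
    (hM : ∀ a b, a ≠ b → br (K.lamt a) (K.lamt b) / (z x b - z x a) =
      kernelEval M (z x a) (z x b) / (t x a * nodeProd (z x) a * (t x b * nodeProd (z x) b)))
    {w : Fin (d + 1) → Fin 2 → ℂ}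
    {a b : Particle d d'} (hw : a = b → ∀ r, br (pt x a) (w r) ≠ 0) :
    Phit K x w a b =
      (nodeProd (z x) a)⁻¹ * kernelEval M (z x a) (z x b) * (nodeProd (z x) b)⁻¹ := by
  have hoff : ∀ a b, a ≠ b → br (K.lamt a) (K.lamt b) / br (pt x a) (pt x b) *
      (t x a * t x b) =
      (nodeProd (z x) a)⁻¹ * kernelEval M (z x a) (z x b) * (nodeProd (z x) b)⁻¹ := by
    intro a b hab
    have h1 := nodeProd_ne_zero hx.injective a
    have h2 := nodeProd_ne_zero hx.injective b
    have h3 := hx.2 a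
    have h4 := hx.2 b
    rw [br_pt, hM a b hab]
    field_simp
  simp only [Phit, of_apply]
  split_ifs with h
  · subst h
    have hU : (refPoly w).eval (z x a) ≠ 0 := by
      rw [refPoly_eval]; exact prod_ne_zero_iff.2 fun r _ => hw rfl r
    have hD := nodeProd_ne_zero hx.injective a
    have hk := kernelEval_diag M hx.injective (U := refPoly w) (by
      have := refPoly_natDegree w
      simp only [Fintype.card_sum, Fintype.card_fin]; omega) a
    refine mul_right_cancel₀ hU (Eq.trans ?_ ((congrArg (· / nodeProd (z x) a) hk.symm).trans ?_))
    · rw [neg_mul, sum_mul, neg_div, sum_div]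
      congr 1
      refine sum_congr rfl fun c hc => ?_
      have hD' := nodeProd_ne_zero hx.injective c
      rw [hoff a c (ne_of_mem_erase hc).symm, prod_div_distrib, ← refPoly_eval, ← refPoly_eval]
      field_simp
    · field_simp
  · exact hoff a b h

/-- The minor is `det N` times the Vandermondes of its rows and columns, which are the normalising
factors. Independence of all choices is thereby manifest. -/
lemma Dom.detPhi_eq {N : Matrix (Fin d) (Fin d) ℂ}
    (hN : ∀ a b, a ≠ b → br (K.lam a) (K.lam b) / (z x b - z x a) =
      t x a * t x b * kernelEval N (z x a) (z x b)) {c : Choices d d'}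
    (hc : c.NonsingularAt x) : detPhi K c x = N.det := by
  have h : (Phi K x (c.u x)).submatrix c.rows c.cols = of fun i j =>
      (1 : ℂ) * kernelEval N ((z x ∘ c.rows) i) ((z x ∘ c.cols) j) * 1 := by
    ext i j
    rw [submatrix_apply, hx.Phi_apply hN (hc.2 i j), of_apply, one_mul, mul_one]
    rfl
  have hr : (Matrix.vandermonde (z x ∘ c.rows)).det ≠ 0 :=
    det_vandermonde_ne_zero_iff.2 (hx.injective.comp c.rows.injective)
  have hc' : (Matrix.vandermonde (z x ∘ c.cols)).det ≠ 0 :=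
    det_vandermonde_ne_zero_iff.2 (hx.injective.comp c.cols.injective)
  rw [detPhi, h, of_kernelEval_submatrix_det N _ _ (fun _ => 1) fun _ => 1, vandermonde_eq,
    vandermonde_eq, div_eq_iff (mul_ne_zero hr hc')]
  simp only [prod_const_one]
  ring

lemma Dom.detPhit_eq {M : Matrix (Fin d') (Fin d') ℂ}
    (hM : ∀ a b, a ≠ b → br (K.lamt a) (K.lamt b) / (z x b - z x a) =
      kernelEval M (z x a) (z x b) / (t x a * nodeProd (z x) a * (t x b * nodeProd (z x) b)))
    {c : Choices d d'} (hc : c.NonsingularAt x) :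
    detPhit K c x * ((Matrix.vandermonde (z x ∘ Sum.inl)).det *
      (Matrix.vandermonde (z x ∘ Sum.inr)).det *
        ∏ i, ∏ p, (z x (.inr p) - z x (.inl i))) ^ 2 = M.det := by
  have h : (Phit K x (c.w x)).submatrix (c.rowsT ∘ Sum.inr) (c.colsT ∘ Sum.inr) = of fun i j =>
      (nodeProd (z x) (c.rowsT (.inr i)))⁻¹ *
        kernelEval M (z x (c.rowsT (.inr i))) (z x (c.colsT (.inr j))) *
          (nodeProd (z x) (c.colsT (.inr j)))⁻¹ := by
    ext i j
    exact hx.Phit_apply hM (hc.1 i j)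
  rw [← det_kernelEval_complement M hx.injective c.rowsT c.colsT, ← vandermonde_det_sum,
    vandermonde_det_sq, detPhit, h, vandermonde_eq, vandermonde_eq,
    show d + 2 + d' = d + 1 + (d' + 1) by omega]

/-- The scale `s_i` converts `t_i` into the node product over the particles `i` alone. The diagonal
needs no reference spinors, since a kernel of degree below `d` sums to zero over `d + 1` nodes. -/
lemma Dom.H_apply {N : Matrix (Fin d) (Fin d) ℂ}
    (hN : ∀ a b, a ≠ b → br (K.lam a) (K.lam b) / (z x b - z x a) =
      t x a * t x b * kernelEval N (z x a) (z x b)) (i j : Fin (d + 1)) :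
    Amb.H K (CS.toAmb x) i j = (nodeProd (z x ∘ Sum.inl) i)⁻¹ *
      kernelEval N (z x (.inl i)) (z x (.inl j)) * (nodeProd (z x ∘ Sum.inl) j)⁻¹ := by
  have hoff : ∀ i j, i ≠ j → br (K.lam (.inl i)) (K.lam (.inl j)) /
      br (Amb.pt (CS.toAmb x) (.inl i)) (Amb.pt (CS.toAmb x) (.inl j)) =
      (nodeProd (z x ∘ Sum.inl) i)⁻¹ *
      kernelEval N (z x (.inl i)) (z x (.inl j)) * (nodeProd (z x ∘ Sum.inl) j)⁻¹ := by
    intro i j hij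
    have h1 := nodeProd_ne_zero hx.injective_inl i
    have h2 := nodeProd_ne_zero hx.injective_inl j
    have h3 := hx.2 (.inl i)
    have h4 := hx.2 (.inl j)
    rw [br_toAmb, div_mul_eq_div_div_swap, hN _ _ (by simpa using hij)]
    simp only [scale]
    field_simp
  simp only [Amb.H, of_apply]
  split_ifs with h
  · subst h
    have hD := nodeProd_ne_zero hx.injective_inl i
    have hk := kernelEval_diag N hx.injective_inl (U := 1) (by simp) i
    simp only [eval_one, one_div] at hk
    rw [mul_assoc]
    refine Eq.trans ?_ (congrArg (fun y => (nodeProd (z x ∘ Sum.inl) i)⁻¹ * y) hk.symm)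
    rw [mul_neg, mul_sum]
    congr 1
    refine sum_congr rfl fun l hl => ?_
    rw [hoff i l (ne_of_mem_erase hl).symm, mul_assoc]
    rfl
  · exact hoff i j h

lemma Dom.Ht_apply {M : Matrix (Fin d') (Fin d') ℂ}
    (hM : ∀ a b, a ≠ b → br (K.lamt a) (K.lamt b) / (z x b - z x a) =
      kernelEval M (z x a) (z x b) / (t x a * nodeProd (z x) a * (t x b * nodeProd (z x) b)))
    (p q : Fin (d' + 1)) :
    Amb.Ht K (CS.toAmb x) p q = (nodeProd (z x ∘ Sum.inr) p)⁻¹ *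
      kernelEval M (z x (.inr p)) (z x (.inr q)) * (nodeProd (z x ∘ Sum.inr) q)⁻¹ := by
  have hoff : ∀ p q, p ≠ q → br (K.lamt (.inr p)) (K.lamt (.inr q)) /
      br (Amb.pt (CS.toAmb x) (.inr p)) (Amb.pt (CS.toAmb x) (.inr q)) =
      (nodeProd (z x ∘ Sum.inr) p)⁻¹ *
      kernelEval M (z x (.inr p)) (z x (.inr q)) * (nodeProd (z x ∘ Sum.inr) q)⁻¹ := by
    intro p q hpq
    have h1 := nodeProd_ne_zero hx.injective_inr p
    have h2 := nodeProd_ne_zero hx.injective_inr q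
    have h3 := hx.2 (.inr p)
    have h4 := hx.2 (.inr q)
    have h5 := hx.prod_ne_zero p
    have h6 := hx.prod_ne_zero q
    rw [br_toAmb, div_mul_eq_div_div_swap, hM _ _ (by simpa using hpq), nodeProd_inr, nodeProd_inr]
    simp only [scale]
    field_simp
  simp only [Amb.Ht, of_apply]
  split_ifs with h
  · subst h
    have hk := kernelEval_diag M hx.injective_inr (U := 1) (by simp) p
    simp only [eval_one, one_div] at hk
    rw [mul_assoc]
    refine Eq.trans ?_ (congrArg (fun y => (nodeProd (z x ∘ Sum.inr) p)⁻¹ * y) hk.symm)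
    rw [mul_neg, mul_sum]
    congr 1
    refine sum_congr rfl fun l hl => ?_
    rw [hoff p l (ne_of_mem_erase hl).symm, mul_assoc]
    rfl
  · exact hoff p q h

/-- The reduced determinants of the two formulae. -/
lemma Dom.detPhi_mul_detPhit (h0 : constraint K x = 0) {c : Choices d d'}
    (hc : c.NonsingularAt x) (i₀ : Fin (d + 1)) (p₀ : Fin (d' + 1)) :
    detPhi K c x * detPhit K c x * (∏ i, ∏ p, (z x (.inr p) - z x (.inl i))) ^ 2 =
      Amb.detH K i₀ p₀ (CS.toAmb x) := by
  obtain ⟨N, M, hN, hM⟩ := exists_kernels hx h0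
  have h1 := det_succAbove_kernelEval N hx.injective_inl i₀
  have h2 := det_succAbove_kernelEval M hx.injective_inr p₀
  have h3 : (Amb.H K (CS.toAmb x)).submatrix i₀.succAbove i₀.succAbove = of fun i j =>
      (nodeProd (z x ∘ Sum.inl) (i₀.succAbove i))⁻¹ *
        kernelEval N ((z x ∘ Sum.inl) (i₀.succAbove i)) ((z x ∘ Sum.inl) (i₀.succAbove j)) *
          (nodeProd (z x ∘ Sum.inl) (i₀.succAbove j))⁻¹ := by
    ext i j
    exact hx.H_apply hN _ _
  have h4 : (Amb.Ht K (CS.toAmb x)).submatrix p₀.succAbove p₀.succAbove = of fun i j =>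
      (nodeProd (z x ∘ Sum.inr) (p₀.succAbove i))⁻¹ *
        kernelEval M ((z x ∘ Sum.inr) (p₀.succAbove i)) ((z x ∘ Sum.inr) (p₀.succAbove j)) *
          (nodeProd (z x ∘ Sum.inr) (p₀.succAbove j))⁻¹ := by
    ext i j
    exact hx.Ht_apply hM _ _
  rw [← h3] at h1
  rw [← h4] at h2
  have h5 := hx.detPhit_eq hM hc
  rw [Amb.detH_eq, hx.detPhi_eq hN hc]
  have hI : (Matrix.vandermonde (z x ∘ (Sum.inl : Fin (d + 1) → Particle d d'))).det ≠ 0 :=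
    det_vandermonde_ne_zero_iff.2 hx.injective_inl
  have hP : (Matrix.vandermonde (z x ∘ (Sum.inr : Fin (d' + 1) → Particle d d'))).det ≠ 0 :=
    det_vandermonde_ne_zero_iff.2 hx.injective_inr
  refine mul_right_cancel₀ (mul_ne_zero (pow_ne_zero 2 hI) (pow_ne_zero 2 hP)) ?_
  linear_combination N.det * h5 - h2 * ((Amb.H K (CS.toAmb x)).submatrix i₀.succAbove
    i₀.succAbove).det * (Matrix.vandermonde (z x ∘ Sum.inl)).det ^ 2 - M.det * h1

/-- The fourth power of the determinant is `∏ t_i^4` times the squared node products of the `z_i`,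
while `s_i² / t_i` has one power of `t_i` and `s_p² / t_p` has `t_p^(-3)`. The factors `1 / t_a³`
are just what balances the two sides. -/
lemma Dom.det_basisMatrix_pow_four :
    (∏ a, 1 / t x a ^ 3) * (basisMatrix x).det ^ 4 =
      (∏ a, (scale x a ^ 2 / t x a)) * (∏ i, ∏ p, (z x (.inr p) - z x (.inl i))) ^ 2 := by
  have hI := vandermonde_det_sq (Equiv.refl _) (z x ∘ (Sum.inl : Fin (d + 1) → Particle d d'))
  have hI2 : (∏ i, nodeProd (z x ∘ (Sum.inl : Fin (d + 1) → Particle d d')) i) ^ 2 =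
      (Matrix.vandermonde (z x ∘ (Sum.inl : Fin (d + 1) → Particle d d'))).det ^ 4 := by
    have := congrArg (· ^ 2) hI
    simp only [mul_pow, ← pow_mul] at this
    rw [mul_comm (Nat.choose _ _), pow_mul (-1 : ℂ), neg_one_sq, one_pow, one_mul] at this
    exact this.symm
  have h4 : (basisMatrix x).det ^ 4 = (∏ i : Fin (d + 1), t x (.inl i)) ^ 4 *
      (∏ i, nodeProd (z x ∘ (Sum.inl : Fin (d + 1) → Particle d d')) i) ^ 2 := by
    rw [show (4 : ℕ) = 2 * 2 from rfl, pow_mul, basisMatrix_det_sq, hI2]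
    ring
  have hR : (∏ i : Fin (d + 1), ∏ p : Fin (d' + 1), (z x (.inr p) - z x (.inl i))) ^ 2 =
      (∏ p : Fin (d' + 1), ∏ i : Fin (d + 1), (z x (.inl i) - z x (.inr p))) ^ 2 := by
    rw [prod_comm]
    simp only [← prod_pow]
    exact prod_congr rfl fun _ _ => prod_congr rfl fun _ _ => by ring
  have hR0 : (∏ p : Fin (d' + 1), ∏ i : Fin (d + 1), (z x (.inl i) - z x (.inr p))) ≠ 0 :=
    prod_ne_zero_iff.2 fun p _ => hx.prod_ne_zero p
  have ht1 : ∏ i : Fin (d + 1), t x (.inl i) ≠ 0 := prod_ne_zero_iff.2 fun i _ => hx.2 _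
  have ht2 : ∏ p : Fin (d' + 1), t x (.inr p) ≠ 0 := prod_ne_zero_iff.2 fun i _ => hx.2 _
  rw [h4, hR]
  simp only [Fintype.prod_sum_type, scale, prod_div_distrib, prod_pow, prod_const_one,
    prod_mul_distrib, prod_inv_distrib]
  field_simp

/-- The contribution of a solution to the Cachazo-Skinner formula. -/
lemma weight_smul_integrand (g : Matrix.SpecialLinearGroup (Fin 2) ℂ) {b : ℂ} (hb : b ≠ 0)
    (gCS : (system K).GaugeFixing) (gAmb : (Amb.system K).GaugeFixing) (hxs : x ∈ gCS.slice)
    (hy : Amb.act g.1 b *ᵥ toAmb x ∈ gAmb.slice) {c : Choices d d'}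
    (hc : c.NonsingularAt x) (i₀ : Fin (d + 1)) (p₀ : Fin (d' + 1)) :
    gCS.weight x • integrand K c x = (-1 : ℂ) ^ (d + 1) •
      (gAmb.weight (Amb.act g.1 b *ᵥ toAmb x) •
        Amb.integrand K 8 i₀ p₀ (Amb.act g.1 b *ᵥ toAmb x)) := by
  have h0 : constraint K x = 0 := (gCS.slice_subset hxs).2.1
  have h1 := hx.detPhi_mul_detPhit h0 hc i₀ p₀
  have h2 := Amb.act_det_mul_detH g hb K i₀ p₀ (toAmb x)
  have h3 := hx.det_basisMatrix_pow_four
  have hs : ((-1 : ℂ) ^ (d + 1)) ^ 2 = 1 := by rw [← pow_mul, mul_comm, pow_mul]; simp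
  rw [integrand, Amb.integrand, Amb.fermions_act g hb, hx.fermions_eq,
    ← weight_eq g hb gCS gAmb hxs hy, relation_det, transport_det, hx.varChange_det]
  simp only [smul_smul]
  congr 1
  rw [← h2] at h1
  -- Of the eight powers of `det B` from the fermions, four are the Jacobian factors of the weight
  -- and four are converted by `h3`.
  linear_combination (gCS.weight x * detPhi K c x * detPhit K c x * (basisMatrix x).det ^ 4) * h3
    + (gCS.weight x * (basisMatrix x).det ^ 4 * ∏ a, (scale x a ^ 2 / t x a)) * h1
    - (gCS.weight x * (basisMatrix x).det ^ 4 * (∏ a, (scale x a ^ 2 / t x a)) *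
      (Amb.act g.1 b : Matrix (AmbVar d d') (AmbVar d d') ℂ).det *
        Amb.detH K i₀ p₀ (Amb.act g.1 b *ᵥ toAmb x)) * hs

end CS
end

/-! ### The bijection between gauge orbits of solutions -/

noncomputable section

open Finset Matrix Polynomial

variable {d d' : ℕ}

namespace Amb

lemma Dom.exists_ne_zero {y : AmbVar d d' → ℂ} (hy : Dom y) (a : Particle d d') :
    y (a, 1) = 0 → y (a, 0) ≠ 0 := by
  intro h1 h0
  obtain ⟨b, hb⟩ : ∃ b, a ≠ b := by
    rcases a with i | p
    · exact ⟨.inr 0, by simp⟩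
    · exact ⟨.inl 0, by simp⟩
  refine hy a b hb ?_
  simp only [br, pt, h0, h1, zero_mul, sub_zero]

/-- A rotation that moves all punctures away from infinity. -/
lemma Dom.exists_rotation {y : AmbVar d d' → ℂ} (hy : Dom y) :
    ∃ g : Matrix.SpecialLinearGroup (Fin 2) ℂ, ∀ a, (act g.1 1 *ᵥ y) (a, 0) ≠ 0 := by
  -- A shear by `τ` sends a puncture to infinity only for `τ = -y (a, 0) / y (a, 1)`. A puncture
  -- with `y (a, 1) = 0` stays finite for all `τ`.
  obtain ⟨τ, hτ⟩ := Infinite.exists_notMem_finset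
    (univ.image fun a : Particle d d' => -y (a, 0) / y (a, 1))
  refine ⟨⟨!![1, τ; 0, 1], by simp [Matrix.det_fin_two]⟩, fun a h => ?_⟩
  have h' := congrFun (act_mulVec !![1, τ; 0, 1] 1 y a) 0
  have hch : charge (1 : ℂ) a = 1 := by rcases a with i | p <;> simp [charge]
  have h2 : y (a, 0) + τ * y (a, 1) = 0 := by
    refine Eq.trans ?_ (h'.symm.trans h)
    simp [hch, Matrix.mulVec, dotProduct, Fin.sum_univ_two, pt]
  by_cases h1 : y (a, 1) = 0
  · exact hy.exists_ne_zero a h1 (by simpa [h1] using h2)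
  · refine hτ (mem_image.2 ⟨a, mem_univ a, ?_⟩)
    rw [div_eq_iff h1]
    linear_combination -h2

end Amb

namespace CS

/-- The variables of the Cachazo-Skinner formula with given points, scalings and values of the
map. -/
def ofAmb (K : Kinematics d d') (y : AmbVar d d' → ℂ) : CSVar d d' → ℂ :=
  let ζ : Particle d d' → ℂ := fun a => y (a, 1) / y (a, 0)
  let τ : Particle d d' → ℂ := Sum.elim
    (fun i => y (.inl i, 0) / nodeProd (ζ ∘ Sum.inl) i)
    (fun p => (y (.inr p, 0) * ∏ i : Fin (d + 1), (ζ (.inl i) - ζ (.inr p)))⁻¹)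
  let v : Particle d d' × Fin 2 → ℂ := fun b => ![ζ b.1, τ b.1] b.2
  -- The basis matrix involves only the points and scalings, so the moduli are set to `0` inside it
  -- before being solved for.
  Sum.elim
    (fun b => ((basisMatrix (Sum.elim 0 v : CSVar d d' → ℂ))⁻¹ *ᵥ
      fun i => K.lam (.inl i) b.2) b.1) v

lemma toAmb_ofAmb (K : Kinematics d d') {y : AmbVar d d' → ℂ} (hy : Amb.Dom y)
    (h0 : ∀ a, y (a, 0) ≠ 0) : Dom (ofAmb K y) ∧ toAmb (ofAmb K y) = y := by
  have hz : ∀ a, z (ofAmb K y) a = y (a, 1) / y (a, 0) := fun a => rfl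
  have hne : ∀ a b, a ≠ b → z (ofAmb K y) a ≠ z (ofAmb K y) b := by
    intro a b hab h
    rw [hz, hz, div_eq_div_iff (h0 a) (h0 b)] at h
    refine hy a b hab ?_
    simp only [br, Amb.pt]
    linear_combination -h
  have hinj : Function.Injective (z (ofAmb K y)) := fun a b h =>
    by_contra fun hab => hne a b hab h
  have hti : ∀ i : Fin (d + 1), t (ofAmb K y) (.inl i) =
      y (.inl i, 0) / nodeProd (z (ofAmb K y) ∘ Sum.inl) i := fun i => rfl
  have htp : ∀ p : Fin (d' + 1), t (ofAmb K y) (.inr p) = (y (.inr p, 0) *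
      ∏ i : Fin (d + 1), (z (ofAmb K y) (.inl i) - z (ofAmb K y) (.inr p)))⁻¹ := fun p => rfl
  have hD : ∀ i : Fin (d + 1), nodeProd (z (ofAmb K y) ∘ Sum.inl) i ≠ 0 :=
    nodeProd_ne_zero (hinj.comp Sum.inl_injective)
  have hR : ∀ p : Fin (d' + 1),
      ∏ i : Fin (d + 1), (z (ofAmb K y) (.inl i) - z (ofAmb K y) (.inr p)) ≠ 0 := fun p =>
    prod_ne_zero_iff.2 fun i _ => sub_ne_zero.2 (hne _ _ (by simp))
  refine ⟨⟨hne, ?_⟩, ?_⟩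
  · rintro (i | p)
    · rw [hti]; exact div_ne_zero (h0 _) (hD i)
    · rw [htp]; exact inv_ne_zero (mul_ne_zero (h0 _) (hR p))
  · have hs : ∀ a, scale (ofAmb K y) a = y (a, 0) := by
      rintro (i | p)
      · simp only [scale]
        rw [hti, div_mul_cancel₀ _ (hD i)]
      · simp only [scale]
        rw [htp, mul_inv, inv_inv, mul_assoc, mul_inv_cancel₀ (hR p), mul_one]
    funext ⟨a, α⟩
    change scale (ofAmb K y) a * pt (ofAmb K y) a α = _
    rw [hs]
    fin_cases α
    · exact mul_one _
    · exact mul_div_cancel₀ _ (h0 a)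

lemma mapConstraint_ofAmb (K : Kinematics d d') {y : AmbVar d d' → ℂ} (hx : Dom (ofAmb K y)) :
    mapConstraint K (ofAmb K y) = 0 := by
  funext ⟨i, α⟩
  have hB : IsUnit (basisMatrix (ofAmb K y)).det := isUnit_iff_ne_zero.2 hx.basisMatrix_det_ne_zero
  have h : basisMatrix (ofAmb K y) *ᵥ ((basisMatrix (ofAmb K y))⁻¹ *ᵥ
      fun i => K.lam (.inl i) α) = fun i => K.lam (.inl i) α := by
    rw [mulVec_mulVec, mul_nonsing_inv _ hB, one_mulVec]
  refine sub_eq_zero.2 (Eq.trans (congrFun h i).symm ?_)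
  change ∑ r, t (ofAmb K y) (.inl i) * C r (pt (ofAmb K y) (.inl i)) * rho (ofAmb K y) r α = _
  rw [lamMap, mul_sum]
  exact sum_congr rfl fun r _ => by ring

/-- The coordinates `(1, z_a)` miss the point at infinity, so the punctures are first rotated into
the chart where the change of variables can be inverted. -/
lemma exists_solution (K : Kinematics d d') {y : AmbVar d d' → ℂ}
    (hy : y ∈ (Amb.system K).solutions) :
    ∃ x ∈ (system K).solutions, Amb.orbit (toAmb x) y := by
  have hd : Amb.Dom y := hy.1
  obtain ⟨g, hg⟩ := hd.exists_rotation
  obtain ⟨h1, h2⟩ := toAmb_ofAmb K (Amb.dom_act g one_ne_zero hd) hg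
  have h3 : Amb.act (g⁻¹).1 1 *ᵥ toAmb (ofAmb K (Amb.act g.1 1 *ᵥ y)) = y := by
    rw [h2, Amb.act_mul_mulVec, one_mul]
    have : (g⁻¹).1 * g.1 = 1 := by
      rw [← Matrix.SpecialLinearGroup.coe_mul, inv_mul_cancel, Matrix.SpecialLinearGroup.coe_one]
    rw [this, Amb.act_one_mulVec]
  refine ⟨_, (h1.mem_solutions_iff g⁻¹ one_ne_zero K).2 ⟨mapConstraint_ofAmb K h1, ?_⟩,
    Amb.orbit_iff.2 ⟨g⁻¹, 1, one_ne_zero, h3.symm⟩⟩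
  rw [h3]
  exact hy

lemma toAmb_mem_solutions {K : Kinematics d d'} {x : CSVar d d' → ℂ}
    (hx : x ∈ (system K).solutions) : toAmb x ∈ (Amb.system K).solutions := by
  have h := ((Dom.mem_solutions_iff (x := x) 1 one_ne_zero hx.1 K).1 hx).2
  rwa [Matrix.SpecialLinearGroup.coe_one, Amb.act_one_mulVec] at h

/-- If each `g σ_a` is a multiple of `(1, z'_a)`, then the factors relate the differences of the
points. -/
lemma factor_mul_factor {x x' : CSVar d d' → ℂ} (g : Matrix.SpecialLinearGroup (Fin 2) ℂ)
    (h : ∀ a, g.1 *ᵥ pt x a = ((g.1 *ᵥ pt x a) 0) • pt x' a) (a b : Particle d d') :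
    (g.1 *ᵥ pt x a) 0 * (g.1 *ᵥ pt x b) 0 * (z x' b - z x' a) = z x b - z x a := by
  rw [← br_pt, ← br_pt, ← Amb.br_smul, ← h, ← h, Amb.br_mulVec, g.2, one_mul]

lemma factor_ne_zero {x x' : CSVar d d' → ℂ} (hx : Dom x) {m : Particle d d' → ℂ}
    (hm : ∀ a b, m a * m b * (z x' b - z x' a) = z x b - z x a) (a : Particle d d') : m a ≠ 0 := by
  intro h
  obtain ⟨b, hb⟩ : ∃ b, b ≠ a := by
    rcases a with i | p
    · exact ⟨.inr 0, by simp⟩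
    · exact ⟨.inl 0, by simp⟩
  refine hx.sub_ne_zero hb ?_
  rw [← hm a b, h]
  ring

section

variable {x x' : CSVar d d' → ℂ} (hx : Dom x) (hx' : Dom x') {m : Particle d d' → ℂ}

include hx hx'

/-- The transformation of the scales under a Möbius transformation of the points. -/
lemma scale_eq_iff (hm0 : ∀ a, m a ≠ 0)
    (hm : ∀ a b, m a * m b * (z x' b - z x' a) = z x b - z x a) {c c' : ℂ} (hc : c ≠ 0)
    (hc' : c' = c * ∏ i : Fin (d + 1), m (.inl i)) (a : Particle d d') :
    scale x' a = Amb.charge c' a * scale x a * m a ↔ t x' a = c⁻¹ * m a ^ d * t x a := by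
  have hM : ∏ i : Fin (d + 1), m (.inl i) ≠ 0 := prod_ne_zero_iff.2 fun i _ => hm0 _
  have hma := hm0 a
  subst hc'
  rcases a with i | p
  · have hD := nodeProd_ne_zero hx'.injective_inl i
    have h : nodeProd (z x' ∘ Sum.inl) i * m (.inl i) ^ d * ∏ j : Fin (d + 1), m (.inl j) =
        m (.inl i) * nodeProd (z x ∘ Sum.inl) i := by
      have h1 : nodeProd (z x ∘ Sum.inl) i =
          ∏ j ∈ univ.erase i, m (.inl i) * m (.inl j) * (z x' (.inl j) - z x' (.inl i)) :=
        prod_congr rfl fun j _ => (hm _ _).symm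
      rw [h1, prod_mul_distrib, prod_mul_distrib, prod_const, card_erase_of_mem (mem_univ i),
        card_univ, Fintype.card_fin, add_tsub_cancel_right, ← mul_prod_erase univ _ (mem_univ i)]
      simp only [nodeProd, Function.comp_apply]
      ring
    simp only [scale, Amb.charge, Sum.elim_inl]
    have hR : (c * ∏ j : Fin (d + 1), m (.inl j))⁻¹ *
        (t x (.inl i) * nodeProd (z x ∘ Sum.inl) i) * m (.inl i) =
        c⁻¹ * m (.inl i) ^ d * t x (.inl i) * nodeProd (z x' ∘ Sum.inl) i := by
      field_simp
      linear_combination -t x (.inl i) * h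
    rw [hR, mul_left_inj' hD]
  · have hR' := hx'.prod_ne_zero p
    have hR := hx.prod_ne_zero p
    have ht := hx.2 (.inr p)
    have h : (∏ j : Fin (d + 1), m (.inl j)) * m (.inr p) ^ (d + 1) *
        ∏ i : Fin (d + 1), (z x' (.inl i) - z x' (.inr p)) =
        ∏ i : Fin (d + 1), (z x (.inl i) - z x (.inr p)) := by
      rw [prod_congr rfl fun i _ => (hm (.inr p) (.inl i)).symm, prod_mul_distrib,
        prod_mul_distrib, prod_const, card_univ, Fintype.card_fin]
      ring
    simp only [scale, Amb.charge, Sum.elim_inr]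
    have hS : (c * ∏ j : Fin (d + 1), m (.inl j)) *
        (t x (.inr p) * ∏ i : Fin (d + 1), (z x (.inl i) - z x (.inr p)))⁻¹ * m (.inr p) =
        (c⁻¹ * m (.inr p) ^ d * t x (.inr p) *
          ∏ i : Fin (d + 1), (z x' (.inl i) - z x' (.inr p)))⁻¹ := by
      rw [← h]
      field_simp
      ring
    rw [hS, _root_.inv_inj, mul_left_inj' hR']


lemma toAmb_orbit (h : orbit x x') : Amb.orbit (toAmb x) (toAmb x') := by
  obtain ⟨g, c, hc, -, hp, ht⟩ := h
  have hm := factor_mul_factor g hp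
  have hm0 := factor_ne_zero hx hm
  -- The `GL(1)` parameter is shifted by the factors of the points `σ_i`, the finite form of the
  -- mixing in `gaugeMix`.
  refine Amb.orbit_iff.2 ⟨g, c * ∏ i : Fin (d + 1), (g.1 *ᵥ pt x (.inl i)) 0,
    mul_ne_zero hc (prod_ne_zero_iff.2 fun i _ => hm0 _), ?_⟩
  have hs := fun a => (scale_eq_iff hx hx' hm0 hm hc rfl a).2 (ht a)
  have : ∀ a, Amb.pt (toAmb x') a = Amb.pt (Amb.act g.1
      (c * ∏ i : Fin (d + 1), (g.1 *ᵥ pt x (.inl i)) 0) *ᵥ toAmb x) a := by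
    intro a
    rw [Amb.act_mulVec, pt_toAmb, pt_toAmb, Matrix.mulVec_smul, hp a, smul_smul, smul_smul, hs]
  funext v
  exact congrFun (this v.1) v.2

end

/-- The component `λ_α(g (1, w))` of the map as a polynomial in `w`. -/
def mapPoly (x : CSVar d d' → ℂ) (g : Matrix (Fin 2) (Fin 2) ℂ) (α : Fin 2) : ℂ[X] :=
  ∑ r : Fin (d + 1), Polynomial.C (rho x r α) *
    ((Polynomial.C (g 0 0) + Polynomial.C (g 0 1) * X) ^ (r : ℕ) *
      (Polynomial.C (g 1 0) + Polynomial.C (g 1 1) * X) ^ (d - r : ℕ))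

lemma mapPoly_eval (x : CSVar d d' → ℂ) (g : Matrix (Fin 2) (Fin 2) ℂ) (α : Fin 2) (w : ℂ) :
    (mapPoly x g α).eval w = lamMap x (g *ᵥ ![1, w]) α := by
  simp [mapPoly, lamMap, C, eval_finsetSum, mulVec, dotProduct, Fin.sum_univ_two]

lemma mapPoly_natDegree (x : CSVar d d' → ℂ) (g : Matrix (Fin 2) (Fin 2) ℂ) (α : Fin 2) :
    (mapPoly x g α).natDegree ≤ d := by
  have hl : ∀ a b : ℂ, (Polynomial.C a + Polynomial.C b * X).natDegree ≤ 1 := fun a b =>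
    natDegree_add_le_of_degree_le ((natDegree_C _).le.trans zero_le_one)
      ((natDegree_C_mul_le _ _).trans natDegree_X_le)
  refine natDegree_sum_le_of_forall_le _ _ fun r _ => (natDegree_C_mul_le _ _).trans ?_
  refine (natDegree_mul_le_of_le (natDegree_pow_le_of_le r (hl _ _))
    (natDegree_pow_le_of_le (d - r : ℕ) (hl _ _))).trans ?_
  have := r.2
  omega

lemma lamMap_smul (x : CSVar d d' → ℂ) (b : ℂ) (s : Fin 2 → ℂ) :
    lamMap x (b • s) = b ^ d • lamMap x s := by
  funext α
  simp only [lamMap, C, Pi.smul_apply, smul_eq_mul, mul_sum]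
  refine sum_congr rfl fun r _ => ?_
  have : b ^ d = b ^ (r : ℕ) * b ^ (d - r : ℕ) := by
    rw [← pow_add]; congr 1; have := r.2; omega
  rw [this]
  ring

lemma continuous_lamMap (x : CSVar d d' → ℂ) (α : Fin 2) : Continuous fun s => lamMap x s α := by
  unfold lamMap C
  fun_prop

/-- Two maps that agree at `d + 1` points are equal. -/
lemma lamMap_mulVec_eq {x x' : CSVar d d' → ℂ} (hx : Dom x) (g : Matrix (Fin 2) (Fin 2) ℂ)
    (c : ℂ) (h : ∀ i : Fin (d + 1), lamMap x' (g *ᵥ pt x (.inl i)) = c • lamMap x (pt x (.inl i)))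
    (s : Fin 2 → ℂ) : lamMap x' (g *ᵥ s) = c • lamMap x s := by
  funext α
  have h1 : ∀ w : ℂ, lamMap x' (g *ᵥ ![1, w]) α = c * lamMap x ![1, w] α := by
    have hp : mapPoly x' g α - Polynomial.C c * mapPoly x 1 α = 0 := by
      refine eq_zero_of_natDegree_lt_card_of_eval_eq_zero _ hx.injective_inl (fun i => ?_) ?_
      · simp only [eval_sub, eval_mul, eval_C, mapPoly_eval, one_mulVec]
        exact sub_eq_zero.2 (congrFun (h i) α)
      · rw [Fintype.card_fin]
        exact Nat.lt_succ_of_le ((natDegree_sub_le_of_le (mapPoly_natDegree _ _ _)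
          ((natDegree_C_mul_le _ _).trans (mapPoly_natDegree _ _ _))).trans (max_self d).le)
    intro w
    have := congrArg (eval w) hp
    simp only [eval_sub, eval_mul, eval_C, mapPoly_eval, one_mulVec, eval_zero] at this
    exact sub_eq_zero.1 this
  have h2 : ∀ b w : ℂ, b ≠ 0 → lamMap x' (g *ᵥ ![b, w]) α = c * lamMap x ![b, w] α := by
    intro b w hb
    have hs : ![b, w] = b • ![1, w / b] := by
      funext i
      fin_cases i
      · exact (mul_one b).symm
      · exact (mul_div_cancel₀ w hb).symm
    rw [hs, mulVec_smul, lamMap_smul, lamMap_smul, Pi.smul_apply, Pi.smul_apply, smul_eq_mul,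
      smul_eq_mul, h1]
    ring
  -- The remaining spinors, with first component `0`, are reached by continuity.
  have h3 : (fun b => lamMap x' (g *ᵥ ![b, s 1]) α) = fun b => c * lamMap x ![b, s 1] α := by
    have hv : Continuous fun b : ℂ => ![b, s 1] :=
      continuous_pi fun i => by fin_cases i <;> simp <;> fun_prop
    refine Continuous.ext_on (dense_compl_singleton (0 : ℂ))
      ((continuous_lamMap x' α).comp (Continuous.matrix_mulVec continuous_const hv))
      (continuous_const.mul ((continuous_lamMap x α).comp hv)) fun b hb => h2 b _ hb
  have hs : s = ![s 0, s 1] := by funext i; fin_cases i <;> rfl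
  rw [hs]
  exact congrFun h3 (s 0)

/-- The punctures determine the points and scalings, and on solutions the map is determined by its
values at the `d + 1` points `σ_i`. So no information beyond the gauge orbit is lost. -/
lemma orbit_of_toAmb_orbit {K : Kinematics d d'} {x x' : CSVar d d' → ℂ} (hx : Dom x)
    (hx' : Dom x') (h0 : constraint K x = 0) (h0' : constraint K x' = 0)
    (h : Amb.orbit (toAmb x) (toAmb x')) : orbit x x' := by
  obtain ⟨g, c', hc', h⟩ := Amb.orbit_iff.1 h
  have h1 : ∀ a, scale x' a • pt x' a = (Amb.charge c' a * scale x a) • (g.1 *ᵥ pt x a) := by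
    intro a
    rw [← pt_toAmb, h, Amb.act_mulVec, pt_toAmb, mulVec_smul, smul_smul]
  have hs : ∀ a, scale x' a = Amb.charge c' a * scale x a * (g.1 *ᵥ pt x a) 0 := by
    intro a
    have := congrFun (h1 a) 0
    simpa [pt] using this
  have hp : ∀ a, g.1 *ᵥ pt x a = ((g.1 *ᵥ pt x a) 0) • pt x' a := by
    intro a
    have hne := mul_ne_zero (Amb.charge_ne_zero hc' a) (hx.scale_ne_zero a)
    have := h1 a
    rw [hs a, ← smul_smul] at this
    exact (smul_right_injective _ hne this).symm
  have hm := factor_mul_factor g hp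
  have hm0 := factor_ne_zero hx hm
  have hM : ∏ i : Fin (d + 1), (g.1 *ᵥ pt x (.inl i)) 0 ≠ 0 := prod_ne_zero_iff.2 fun i _ => hm0 _
  have hc : c' / ∏ i : Fin (d + 1), (g.1 *ᵥ pt x (.inl i)) 0 ≠ 0 := div_ne_zero hc' hM
  have ht := fun a => (scale_eq_iff hx hx' hm0 hm hc (div_mul_cancel₀ _ hM).symm a).1 (hs a)
  refine ⟨g, _, hc, lamMap_mulVec_eq hx _ _ fun i => ?_, hp, ht⟩
  funext α
  have e1 := sub_eq_zero.1 (congrFun h0 (.inr (.inl i, α)))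
  have e2 := sub_eq_zero.1 (congrFun h0' (.inr (.inl i, α)))
  rw [hp, lamMap_smul]
  rw [e1, ht] at e2
  refine mul_left_cancel₀ (mul_ne_zero (inv_ne_zero hc) (hx.2 (.inl i))) ?_
  simp only [Pi.smul_apply, smul_eq_mul]
  linear_combination (-1 : ℂ) * e2 - t x (.inl i) * lamMap x (pt x (.inl i)) α *
    inv_mul_cancel₀ hc

/-- The correspondence between the solutions of the two systems of equations. -/
lemma exists_slice_equiv {K : Kinematics d d'} (gCS : (system K).GaugeFixing)
    (gAmb : (Amb.system K).GaugeFixing) :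
    ∃ e : gCS.slice ≃ gAmb.slice, ∀ x, Amb.orbit (toAmb x.1) (e x).1 := by
  have hsol : ∀ x : gCS.slice, x.1 ∈ (system K).solutions := fun x => gCS.slice_subset x.2
  choose f hf hfu using fun x : gCS.slice =>
    gAmb.slice_unique _ (toAmb_mem_solutions (hsol x))
  have horb : ∀ x x' : CSVar d d' → ℂ, x ∈ (system K).solutions → x' ∈ (system K).solutions →
      Amb.orbit (toAmb x) (toAmb x') → orbit x x' := fun x x' hx hx' =>
    orbit_of_toAmb_orbit hx.1 hx'.1 hx.2.1 hx'.2.1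
  refine ⟨Equiv.ofBijective (fun x => ⟨f x, (hf x).1⟩) ⟨fun x x' h => ?_, fun y => ?_⟩,
    fun x => (hf x).2⟩
  · have hff : f x = f x' := congrArg Subtype.val h
    have h1 : Amb.orbit (toAmb x.1) (toAmb x'.1) :=
      Amb.orbit_trans (hf x).2 (hff ▸ Amb.orbit_symm (hf x').2)
    exact Subtype.ext ((gCS.slice_unique x.1 (hsol x)).unique
      ⟨x.2, horb _ _ (hsol x) (hsol x) (Amb.orbit_refl _)⟩
      ⟨x'.2, horb _ _ (hsol x) (hsol x') h1⟩)
  · obtain ⟨x, hx, hxy⟩ := exists_solution K (gAmb.slice_subset y.2)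
    obtain ⟨x', ⟨hx', ho⟩, -⟩ := gCS.slice_unique x hx
    have h1 : Amb.orbit (toAmb x') y.1 := Amb.orbit_trans
      (Amb.orbit_symm (toAmb_orbit hx.1 (hsol ⟨x', hx'⟩).1 ho)) hxy
    exact ⟨⟨x', hx'⟩, Subtype.ext (hfu ⟨x', hx'⟩ y.1 ⟨y.2, h1⟩).symm⟩

end CS
end

/-! ### Summation over solutions and the theorem -/

noncomputable section

/-- A linear map that annihilates no term commutes with a possibly infinite sum. -/
lemma LinearMap.map_finsum_smul {α V W : Type} [AddCommGroup V] [Module ℂ V] [AddCommGroup W] [Module ℂ W]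
    (L : V →ₗ[ℂ] W) (w : α → ℂ) (u : α → V) (h : ∀ a, u a ≠ 0 → L (u a) ≠ 0) :
    L (∑ᶠ a, w a • u a) = ∑ᶠ a, w a • L (u a) := by
  have hmap : ∀ a, w a • L (u a) = L (w a • u a) := fun a => (map_smul L _ _).symm
  simp only [hmap]
  by_cases hs : (Function.support fun a => w a • u a).Finite
  · exact L.toAddMonoidHom.map_finsum hs
  -- A `finsum` with infinite support is `0`. As no term is annihilated, the image family also has
  -- infinite support, so both sides are `0`.
  · rw [finsum_of_infinite_support hs, map_zero, finsum_of_infinite_support]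
    refine fun hf => hs (hf.subset fun a ha => ?_)
    simp only [Function.mem_support, map_smul, smul_ne_zero_iff] at ha ⊢
    exact ⟨ha.1, h a ha.2⟩

end

theorem mainTheorem9 (d d' : ℕ) (hn : 3 ≤ d + d' + 2) (K : Kinematics d d')
    (gCS : (CS.system K).GaugeFixing) (gAmb : (Amb.system K).GaugeFixing)
    (c : CS.Choices d d') (hc : ∀ x ∈ gCS.slice, c.NonsingularAt x)
    (i₀ : Fin (d + 1)) (p₀ : Fin (d' + 1)) :
    CS.amplitude K gCS c = (-1 : ℂ) ^ (d + 1) • Amb.amplitude K 8 gAmb i₀ p₀ ∧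
    reduceSusy (CS.amplitude K gCS c) = (-1 : ℂ) ^ (d + 1) • Amb.amplitude K 7 gAmb i₀ p₀ ∧
    ∃ e : gCS.slice ≃ gAmb.slice, ∀ x : gCS.slice,
      gCS.weight x • CS.integrand K c x =
        (-1 : ℂ) ^ (d + 1) • (gAmb.weight (e x) • Amb.integrand K 8 i₀ p₀ (e x)) := by
  obtain ⟨e, he⟩ := CS.exists_slice_equiv gCS gAmb
  have h3 : ∀ x : gCS.slice, gCS.weight x • CS.integrand K c x =
      (-1 : ℂ) ^ (d + 1) • (gAmb.weight (e x) • Amb.integrand K 8 i₀ p₀ (e x)) := by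
    intro x
    obtain ⟨g, b, hb, hy⟩ := Amb.orbit_iff.1 (he x)
    rw [hy]
    exact CS.weight_smul_integrand (gCS.slice_subset x.2).1 g hb gCS gAmb x.2
      (hy ▸ (e x).2) (hc x x.2) i₀ p₀
  have h1 : CS.amplitude K gCS c = (-1 : ℂ) ^ (d + 1) • Amb.amplitude K 8 gAmb i₀ p₀ := by
    simp only [CS.amplitude, Amb.amplitude, DeltaSystem.GaugeFixing.localisedIntegral]
    rw [← finsum_set_coe_eq_finsum_mem gCS.slice, ← finsum_set_coe_eq_finsum_mem gAmb.slice,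
      ← finsum_comp_equiv e, smul_finsum]
    exact finsum_congr h3
  refine ⟨h1, ?_, e, h3⟩
  rw [h1, ← reduceSusyₗ_apply, map_smul]
  congr 1
  simp only [Amb.amplitude, DeltaSystem.GaugeFixing.localisedIntegral, Amb.integrand, smul_smul]
  -- Finiteness of the set of solutions is not assumed; the linear map may be exchanged with the sum
  -- because the fermionic factors for `N = 7` never vanish.
  rw [← finsum_set_coe_eq_finsum_mem gAmb.slice, ← finsum_set_coe_eq_finsum_mem gAmb.slice,
    LinearMap.map_finsum_smul]
  · exact finsum_congr fun y => by rw [reduceSusyₗ_apply, reduceSusy_ambFermions]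
  · intro y _
    rw [reduceSusyₗ_apply, reduceSusy_ambFermions]
    exact ambFermions_seven_ne_zero _
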